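/- A stabilizer on $n$ qubits (qubit $k$ being held by party $k\in\{1,\dots,n\}$) is an abelian subgroup $S$ of the $n$-qubit Pauli group with $-I\notin S$. Let $S$ be generated by $n-1$ independent generators (none lies in the group generated by the others), and let $\mathcal H^{(S)}$ be its code space, the space of vectors fixed by $S$, which is two-dimensional. An LOCC map to party $j$ is a map from operators on $n$ qubits to operators on qubit $j$ implemented by finitely many rounds of local quantum instruments (with local ancillas) and classical communication of the outcomes, followed by discarding everything but qubit $j$. It extracts the quantum information to party $j$, with respect to an orthonormal logical basis $|0\rangle^{(S)},|1\rangle^{(S)}$ of $\mathcal H^{(S)}$, if it maps $\sum_{a,c}\rho_{ac}|a\rangle\langle c|^{(S)}$ to $\sum_{a,c}\rho_{ac}|a\rangle\langle c|^{(j)}$ for every density matrix $(\rho_{ac})$. (1) For every such $S$, every orthonormal basis $|0\rangle^{(S)},|1\rangle^{(S)}$ of $\mathcal H^{(S)}$ and every party $j$: an LOCC map extracting the quantum information to $j$ exists if and only if there is no $A\subseteq\{1,\dots,n\}$ with $j\in A$ such that $|a\rangle^{(S)}=|a\rangle^{(\bar A)}\otimes|\psi\rangle^{(A)}$ for $a=0,1$,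 where $|0\rangle^{(\bar A)},|1\rangle^{(\bar A)}$ are orthonormal states of the qubits outside $A$ and $|\psi\rangle^{(A)}$ is one fixed pure state of the qubits in $A$. (2) There is an algorithm that, given $n$, the $n-1$ generators and $j$, computes in time $O(n^3)$ on a word RAM with words of $O(\log n)$ bits: Pauli operators $\tilde Z,\tilde X$ that are logical operators for some orthonormal logical basis, i.e. $\tilde Z|a\rangle^{(S)}=(-1)^a|a\rangle^{(S)}$ and $\tilde X|a\rangle^{(S)}=|1-a\rangle^{(S)}$; a graph $G$ on the vertices $R,1,\dots,n$ and single-qubit Clifford operators $U_v$ with $|G\rangle=\bigotimes_v U_v\,\tfrac1{\sqrt2}(|0\rangle^{(R)}|0\rangle^{(S)}+|1\rangle^{(R)}|1\rangle^{(S)})$ up to a global phase, where $|G\rangle=\prod_{uv\in E(G)}CZ^{(uv)}\bigotimes_v|+\rangle^{(v)}$; and, exactly when extraction to $j$ is possible, a shortest path $j=v_1,v_2,\dots,v_L=R$ in $G$ (otherwise it reports failure, and $j$ and $R$ are not connected in $G$). When extraction is possible, the following one-way LOCC protocol extracts the quantum information to $j$ with respect to this logical basis; in it every party other than $j$ acts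 at most once, using only outcomes announced before, and $j$ acts last. (i) Every party $u$ that is not on the path but adjacent to a vertex of it applies $U_u$ and measures $Z$; let $m(v)$ be the number of these parties adjacent to $v$ that obtain $|1\rangle$. (ii) For $l=2,\dots,L-1$ in this order, party $v_l$ applies $Z^{m(v_l)+e_l}U_{v_l}$ and measures $X$, where $e_l=1$ if $l\ge 3$ and $v_{l-1}$ obtained $|+\rangle$, and $e_l=0$ otherwise. (iii) Party $j$ applies $U_R^{T}\,Z^{m(R)+e_L}\,H\,C_{L-1}\cdots C_2\,Z^{m(j)}\,U_j$, where $C_l=(iY)^{-1/2}$ if $v_l$ obtained $|+\rangle$, $C_l=(-iY)^{-1/2}$ if it obtained $|-\rangle$, and $e_L=1$ if $L\ge3$ and $v_{L-1}$ obtained $|+\rangle$, and $e_L=0$ otherwise. -/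

import Mathlib

open scoped Matrix Kronecker ComplexOrder

noncomputable section

namespace StabLOCC

/-! ## Pauli operators, stabilizer codes -/

/-- The four single-qubit Pauli letters `I, X, Y, Z`. -/
inductive Letter where
  | one | x | y | z

/-- The matrix of a Pauli letter in the computational basis. -/
def Letter.mat : Letter → Matrix (Fin 2) (Fin 2) ℂ
  | .one => 1
  | .x => !![0, 1; 1, 0]
  | .y => !![0, -Complex.I; Complex.I, 0]
  | .z => !![1, 0; 0, -1]

/-- The number by which a Pauli letter is presented to a machine. -/
def Letter.code : Letter → ℕ
  | .one => 0
  | .x => 1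
  | .y => 2
  | .z => 3

/-- The operator `⨂ᵥ M v` on the qubits labelled by `V`; the computational basis of their joint
space is labelled by `V → Fin 2`. -/
def tensor {V : Type} [Fintype V] (M : V → Matrix (Fin 2) (Fin 2) ℂ) :
    Matrix (V → Fin 2) (V → Fin 2) ℂ :=
  Matrix.of fun x y => ∏ v, M v (x v) (y v)

/-- An element `i ^ phase · ⨂ₖ letter k` of the Pauli group on `n` qubits. -/
structure PauliOp (n : ℕ) where
  phase : Fin 4
  letter : Fin n → Letter

/-- The operator on `n` qubits. -/
def PauliOp.mat {n : ℕ} (p : PauliOp n) : Matrix (Fin n → Fin 2) (Fin n → Fin 2) ℂ :=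
  Complex.I ^ (p.phase : ℕ) • tensor fun k => (p.letter k).mat

/-- The group of operators generated by a set of Pauli operators.  Pauli operators have finite
order, so the generated submonoid is the generated group. -/
def generated {n : ℕ} (T : Set (PauliOp n)) :
    Submonoid (Matrix (Fin n → Fin 2) (Fin n → Fin 2) ℂ) :=
  Submonoid.closure (PauliOp.mat '' T)

/-- `g` is a family of independent generators of a stabilizer: the generated group is abelian and
does not contain `-1`, and no generator is generated by the other ones. -/
structure IsStabilizer {n m : ℕ} (g : Fin m → PauliOp n) : Prop where
  comm : ∀ i k, (g i).mat * (g k).mat = (g k).mat * (g i).mat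
  neg_one_notMem : (-1) ∉ generated (Set.range g)
  independent : ∀ i, (g i).mat ∉ generated (g '' {i}ᶜ)

/-- The space of state vectors of the qubits labelled by `V`. -/
abbrev Qubits (V : Type) : Type := EuclideanSpace ℂ (V → Fin 2)

/-- The code space: all vectors fixed by every element of the stabilizer generated by `g`. -/
def codeSpace {n m : ℕ} (g : Fin m → PauliOp n) : Submodule ℂ (Qubits (Fin n)) where
  carrier := {ψ | ∀ s ∈ generated (Set.range g), s *ᵥ ψ.ofLp = ψ.ofLp}
  add_mem' := by
    intro a b ha hb s hs
    simp only [Set.mem_ofPred_eq, WithLp.ofLp_add] at *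
    rw [Matrix.mulVec_add, ha s hs, hb s hs]
  zero_mem' := by
    intro s _
    simp
  smul_mem' := by
    intro c a ha s hs
    simp only [Set.mem_ofPred_eq, WithLp.ofLp_smul] at *
    rw [Matrix.mulVec_smul, ha s hs]

/-- A logical basis `|0⟩, |1⟩`: an orthonormal basis of the code space, indexed by `Fin 2`. -/
abbrev LogicalBasis {n m : ℕ} (g : Fin m → PauliOp n) : Type :=
  OrthonormalBasis (Fin 2) ℂ (codeSpace g)

/-- The vector `|a⟩` of a logical basis, as a vector of amplitudes. -/
def LogicalBasis.ket {n m : ℕ} {g : Fin m → PauliOp n} (b : LogicalBasis g) (a : Fin 2) :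
    (Fin n → Fin 2) → ℂ :=
  (b a : Qubits (Fin n)).ofLp

/-- The operator `∑ₐ꜀ ρₐ꜀ |a⟩⟨c|` on the code space. -/
def LogicalBasis.encode {n m : ℕ} {g : Fin m → PauliOp n} (b : LogicalBasis g)
    (ρ : Matrix (Fin 2) (Fin 2) ℂ) : Matrix (Fin n → Fin 2) (Fin n → Fin 2) ℂ :=
  ∑ a, ∑ c, ρ a c • Matrix.vecMulVec (b.ket a) (star (b.ket c))

/-- Every logical basis vector is `|a⟩ = |a⟩^(Ā) ⊗ |ψ⟩^(A)`, with orthonormal `|0⟩^(Ā), |1⟩^(Ā)`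
and one unit vector `|ψ⟩^(A)`. -/
def FactorsOn {n m : ℕ} {g : Fin m → PauliOp n} (b : LogicalBasis g) (A : Finset (Fin n)) : Prop :=
  ∃ (φ : Fin 2 → Qubits {k : Fin n // k ∉ A}) (ψ : Qubits {k : Fin n // k ∈ A}),
    Orthonormal ℂ φ ∧ ‖ψ‖ = 1 ∧
      ∀ (a : Fin 2) (x : Fin n → Fin 2),
        b.ket a x = (φ a).ofLp (fun k => x k) * ψ.ofLp (fun k => x k)

/-! ## LOCC maps -/

/-- The system held by one party: its qubit and a private ancilla of dimension `D + 1`. -/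
abbrev Loc (D : ℕ) : Type := Fin 2 × Fin (D + 1)

/-- Party `k` applies `K` to its system, the other parties do nothing. -/
def localOp {n D : ℕ} (k : Fin n) (K : Matrix (Loc D) (Loc D) ℂ) :
    Matrix (Fin n → Loc D) (Fin n → Loc D) ℂ :=
  Matrix.of fun x y => if ∀ l, l ≠ k → x l = y l then K (x k) (y k) else 0

/-- A finite LOCC protocol of `n` parties with ancillas of dimension `D + 1`.  In each step some
party `k` applies to its own system a quantum instrument with Kraus operators `K i`, the outcome
`i` is announced, and the way in which the protocol goes on may depend on it. -/
inductive LOCCProtocol (n D : ℕ) : Type where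
  | done : LOCCProtocol n D
  | step (k : Fin n) (m : ℕ) (K : Fin m → Matrix (Loc D) (Loc D) ℂ)
      (hK : ∑ i, (K i)ᴴ * K i = 1) (next : Fin m → LOCCProtocol n D) : LOCCProtocol n D

/-- The map on operators of the joint system that a protocol performs. -/
def LOCCProtocol.channel {n D : ℕ} : LOCCProtocol n D →
    Matrix (Fin n → Loc D) (Fin n → Loc D) ℂ → Matrix (Fin n → Loc D) (Fin n → Loc D) ℂ
  | .done, σ => σ
  | .step k _ K _ next, σ => ∑ i, (next i).channel (localOp k (K i) * σ * (localOp k (K i))ᴴ)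

/-- All ancillas are prepared in the state `|0⟩`. -/
def addAncillas {n D : ℕ} (ρ : Matrix (Fin n → Fin 2) (Fin n → Fin 2) ℂ) :
    Matrix (Fin n → Loc D) (Fin n → Loc D) ℂ :=
  Matrix.of fun x y =>
    if ∀ k, (x k).2 = 0 ∧ (y k).2 = 0 then ρ (fun k => (x k).1) (fun k => (y k).1) else 0

/-- Partial trace over everything but the qubit of party `j`. -/
def reduceTo {n D : ℕ} (j : Fin n) (σ : Matrix (Fin n → Loc D) (Fin n → Loc D) ℂ) :
    Matrix (Fin 2) (Fin 2) ℂ :=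
  Matrix.of fun a c => ∑ x, ∑ y,
    if (x j).1 = a ∧ (y j).1 = c ∧ (x j).2 = (y j).2 ∧ ∀ l, l ≠ j → x l = y l then σ x y else 0

/-- The map from `n` qubits to the qubit of party `j` that a protocol implements. -/
def LOCCProtocol.toMap {n D : ℕ} (p : LOCCProtocol n D) (j : Fin n)
    (ρ : Matrix (Fin n → Fin 2) (Fin n → Fin 2) ℂ) : Matrix (Fin 2) (Fin 2) ℂ :=
  reduceTo j (p.channel (addAncillas ρ))

/-- `C` is an LOCC map from `n` qubits to the qubit of party `j`. -/
def IsLOCCMap {n : ℕ} (j : Fin n)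
    (C : Matrix (Fin n → Fin 2) (Fin n → Fin 2) ℂ → Matrix (Fin 2) (Fin 2) ℂ) : Prop :=
  ∃ (D : ℕ) (p : LOCCProtocol n D), C = p.toMap j

/-- `C` carries every density operator `∑ₐ꜀ ρₐ꜀ |a⟩⟨c|` of the code space to `∑ₐ꜀ ρₐ꜀ |a⟩⟨c|` on
one qubit. -/
def Extracts {n m : ℕ} {g : Fin m → PauliOp n} (b : LogicalBasis g)
    (C : Matrix (Fin n → Fin 2) (Fin n → Fin 2) ℂ → Matrix (Fin 2) (Fin 2) ℂ) : Prop :=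
  ∀ ρ : Matrix (Fin 2) (Fin 2) ℂ, ρ.PosSemidef → ρ.trace = 1 → C (b.encode ρ) = ρ

/-! ## One-way protocols made of Pauli measurements and local Clifford operations -/

/-- The gates `H` and `S = diag(1, i)`, which generate the single-qubit Clifford group up to
phases. -/
inductive Gate where
  | h | s

/-- The matrix of a gate. -/
def Gate.mat : Gate → Matrix (Fin 2) (Fin 2) ℂ
  | .h => ((Real.sqrt 2 : ℝ) : ℂ)⁻¹ • !![1, 1; 1, -1]
  | .s => !![1, 0; 0, Complex.I]

/-- The Clifford operator of a word of gates; the last gate of the word acts first. -/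
def cliff (w : List Gate) : Matrix (Fin 2) (Fin 2) ℂ := (w.map Gate.mat).prod

/-- The word of `Z ^ m`. -/
def zPow (m : ℕ) : List Gate := List.replicate (2 * m) Gate.s

/-- The axis of a Pauli measurement. -/
inductive Axis where
  | x | y | z

/-- The Pauli operator that is measured. -/
def Axis.mat : Axis → Matrix (Fin 2) (Fin 2) ℂ
  | .x => Letter.x.mat
  | .y => Letter.y.mat
  | .z => Letter.z.mat

/-- The projector of outcome `r` of a Pauli measurement: the eigenvalue is `(-1) ^ r`. -/
def Axis.proj (a : Axis) (r : Fin 2) : Matrix (Fin 2) (Fin 2) ℂ :=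
  (1 / 2 : ℂ) • (1 + (-1 : ℂ) ^ (r : ℕ) • a.mat)

/-- The turn of a party: it applies a Clifford operation that may depend on the outcomes announced
so far, and then performs a Pauli measurement and announces the outcome. -/
structure Turn (n : ℕ) where
  party : Fin n
  axis : Axis
  correction : (Fin n → Fin 2) → List Gate

/-- A sequence of turns, and a Clifford operation of the receiving party that may depend on all
outcomes. -/
structure PauliProtocol (n : ℕ) where
  turns : List (Turn n)
  final : (Fin n → Fin 2) → List Gate

/-- One-way: every party has at most one turn, so that it never gets a message after it has sent
one, and the receiving party `j` has none and acts at the end. -/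
def PauliProtocol.IsOneWay {n : ℕ} (p : PauliProtocol n) (j : Fin n) : Prop :=
  (p.turns.map Turn.party ++ [j]).Nodup

/-- An operator on the qubit of a party that has no further system. -/
def lift (M : Matrix (Fin 2) (Fin 2) ℂ) : Matrix (Loc 0) (Loc 0) ℂ := M ⊗ₖ 1

theorem Gate.mat_unitary (a : Gate) : a.matᴴ * a.mat = 1 := by
  cases a
  · have h2 : ((Real.sqrt 2 : ℝ) : ℂ)⁻¹ * ((Real.sqrt 2 : ℝ) : ℂ)⁻¹ = 1 / 2 := by
      rw [← mul_inv, ← Complex.ofReal_mul, Real.mul_self_sqrt (by norm_num)]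
      norm_num
    ext i k
    fin_cases i <;> fin_cases k <;>
      simp [Gate.mat, Matrix.mul_apply, Fin.sum_univ_two, h2] <;> norm_num
  · ext i k
    fin_cases i <;> fin_cases k <;> simp [Gate.mat, Matrix.mul_apply, Fin.sum_univ_two]

theorem cliff_unitary (w : List Gate) : (cliff w)ᴴ * cliff w = 1 := by
  induction w with
  | nil => simp [cliff]
  | cons a w ih =>
    have h : cliff (a :: w) = a.mat * cliff w := by simp [cliff]
    rw [h, Matrix.conjTranspose_mul, Matrix.mul_assoc, ← Matrix.mul_assoc a.matᴴ,
      a.mat_unitary, Matrix.one_mul, ih]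

theorem Axis.proj_sum (a : Axis) : ∑ r, (a.proj r)ᴴ * a.proj r = 1 := by
  ext i k
  cases a <;> fin_cases i <;> fin_cases k <;>
    simp [Axis.proj, Axis.mat, Letter.mat, Matrix.mul_apply, Fin.sum_univ_two] <;>
    ring_nf <;> simp [Complex.conj_ofNat] <;> norm_num

theorem lift_kraus (M : Matrix (Fin 2) (Fin 2) ℂ) : (lift M)ᴴ * lift M = lift (Mᴴ * M) := by
  simp [lift, Matrix.conjTranspose_kronecker, ← Matrix.mul_kronecker_mul]

theorem turn_kraus (a : Axis) (w : List Gate) :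
    ∑ r, (lift (a.proj r * cliff w))ᴴ * lift (a.proj r * cliff w) = 1 := by
  have h : ∀ r, (lift (a.proj r * cliff w))ᴴ * lift (a.proj r * cliff w) =
      ((cliff w)ᴴ * ((a.proj r)ᴴ * a.proj r) * cliff w) ⊗ₖ 1 := by
    intro r
    rw [lift_kraus, lift, Matrix.conjTranspose_mul]
    simp only [Matrix.mul_assoc]
  simp only [h]
  rw [Fin.sum_univ_two, ← Matrix.add_kronecker, ← Matrix.add_mul, ← Matrix.mul_add]
  have h1 := a.proj_sum
  rw [Fin.sum_univ_two] at h1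
  rw [h1, Matrix.mul_one, cliff_unitary, Matrix.one_kronecker_one]

theorem final_kraus (w : List Gate) : ∑ _i : Fin 1, (lift (cliff w))ᴴ * lift (cliff w) = 1 := by
  simp only [lift_kraus, cliff_unitary]
  simp [lift]

/-- The remaining turns `ts`, followed by the operation of `j`, as an LOCC protocol; `o` records
the outcomes announced so far, by party. -/
def runTurns {n : ℕ} (j : Fin n) (final : (Fin n → Fin 2) → List Gate) :
    List (Turn n) → (Fin n → Fin 2) → LOCCProtocol n 0
  | [], o => .step j 1 (fun _ => lift (cliff (final o))) (final_kraus _) fun _ => .done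
  | t :: ts, o =>
    .step t.party 2 (fun r => lift (t.axis.proj r * cliff (t.correction o))) (turn_kraus _ _)
      fun r => runTurns j final ts (Function.update o t.party r)

/-- The LOCC protocol. -/
def PauliProtocol.toLOCC {n : ℕ} (p : PauliProtocol n) (j : Fin n) : LOCCProtocol n 0 :=
  runTurns j p.final p.turns fun _ => 0

/-! ## Graph states and the protocol along a path

The vertex `none` stands for the reference system `R`, the vertex `some k` for party `k`. -/

open Classical in
/-- The amplitudes of the graph state `∏_{uv ∈ E} CZ^(uv) ⨂ᵥ |+⟩`. -/
def graphState {V : Type} [Fintype V] (G : SimpleGraph V) : (V → Fin 2) → ℂ := fun x =>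
  (((Real.sqrt 2 : ℝ) : ℂ)⁻¹) ^ Fintype.card V *
    ∏ e ∈ G.edgeFinset, if ∀ v ∈ e, x v = 1 then (-1 : ℂ) else 1

/-- The maximally entangled state `(|0⟩|0⟩ + |1⟩|1⟩)/√2` of the reference system and the code
space. -/
def LogicalBasis.maxEntangled {n m : ℕ} {g : Fin m → PauliOp n} (b : LogicalBasis g) :
    (Option (Fin n) → Fin 2) → ℂ := fun x =>
  ((Real.sqrt 2 : ℝ) : ℂ)⁻¹ * b.ket (x none) fun k => x (some k)

/-- The data from which the protocol is read off: a graph on `R` and the parties, a local Clifford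
operation at every vertex, and a path from party `j` to `R`, given as the list of its vertices
(the empty list if there is none); and the logical operators `Z` and `X`. -/
structure PathData (n : ℕ) where
  graph : SimpleGraph (Option (Fin n))
  clifford : Option (Fin n) → List Gate
  path : List (Option (Fin n))
  logicalZ : PauliOp n
  logicalX : PauliOp n

namespace PathData

variable {n : ℕ} (d : PathData n)

open Classical in
/-- The parties that are not on the path, but adjacent to a vertex of it. -/
def side : List (Fin n) :=
  (List.finRange n).filter fun u => some u ∉ d.path ∧ ∃ v ∈ d.path, d.graph.Adj v (some u)

/-- The inner vertices of the path, in the order from `j` to `R`. -/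
def inner : List (Fin n) := d.path.tail.reduceOption

open Classical in
/-- The number of the outcomes `|1⟩` at the parties in `side` adjacent to the vertex `v`. -/
def count (v : Option (Fin n)) (o : Fin n → Fin 2) : ℕ :=
  (d.side.map fun u => if d.graph.Adj (some u) v then (o u : ℕ) else 0).sum

/-- The exponent of the correction `Z` that the vertex after `v` owes to the outcome at `v`: it is
`1` if the outcome was `|+⟩`, and `0` if it was `|-⟩` or if there is no `v`. -/
def carry (o : Fin n → Fin 2) : Option (Fin n) → ℕ
  | none => 0
  | some v => 1 - (o v : ℕ)

/-- The turns of the parties in `side`: they measure `Z`. -/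
def sideTurns : List (Turn n) :=
  d.side.map fun u => ⟨u, .z, fun _ => d.clifford (some u)⟩

/-- The turns of the inner vertices: they correct by powers of `Z` and measure `X`.  The first
argument is the inner vertex before those in the list, if any. -/
def innerTurns : Option (Fin n) → List (Fin n) → List (Turn n)
  | _, [] => []
  | u, v :: vs =>
    ⟨v, .x, fun o => zPow (d.count (some v) o + carry o u) ++ d.clifford (some v)⟩ ::
      innerTurns (some v) vs

/-- The correction of party `j` for the outcome at an inner vertex: `(iY)^(-1/2) = HZ` for `|+⟩`
and `(-iY)^(-1/2) = ZH` for `|-⟩`. -/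
def sqrtY (r : Fin 2) : List Gate :=
  if r = 0 then Gate.h :: zPow 1 else zPow 1 ++ [Gate.h]

/-- The protocol: first the neighbours of the path measure `Z`, then its inner vertices measure
`X` one after the other, and party `j` corrects.  Reversing a word of gates transposes its
matrix. -/
def protocol (j : Fin n) : PauliProtocol n where
  turns := d.sideTurns ++ d.innerTurns none d.inner
  final := fun o =>
    (d.clifford none).reverse ++ zPow (d.count none o + carry o d.inner.getLast?) ++ [Gate.h] ++
      d.inner.reverse.flatMap (fun v => sqrtY (o v)) ++ zPow (d.count (some j) o) ++
        d.clifford (some j)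

end PathData

/-! ## A word RAM

Registers and finitely many arrays hold words.  Arithmetic on words, reading and writing a cell,
and tests cost one unit each.  The word bound `B` is part of the semantics. -/

/-- Expressions: constants, registers, cells of arrays, and arithmetic; `lt` yields `1` or `0`. -/
inductive Expr where
  | const (c : ℕ)
  | reg (r : ℕ)
  | read (a : ℕ) (i : Expr)
  | add (e f : Expr)
  | sub (e f : Expr)
  | mul (e f : Expr)
  | div (e f : Expr)
  | mod (e f : Expr)
  | lt (e f : Expr)

/-- Programs; `loop e p` repeats `p` as long as the value of `e` is not zero. -/
inductive Program where
  | skip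
  | set (r : ℕ) (e : Expr)
  | write (a : ℕ) (i e : Expr)
  | seq (p q : Program)
  | ite (e : Expr) (p q : Program)
  | loop (e : Expr) (p : Program)

/-- The contents of the registers and of the arrays. -/
structure Store where
  reg : ℕ → ℕ
  arr : ℕ → ℕ → ℕ

/-- The value of an expression. -/
def Expr.eval (s : Store) : Expr → ℕ
  | const c => c
  | reg r => s.reg r
  | read a i => s.arr a (i.eval s)
  | add e f => e.eval s + f.eval s
  | sub e f => e.eval s - f.eval s
  | mul e f => e.eval s * f.eval s
  | div e f => e.eval s / f.eval s
  | mod e f => e.eval s % f.eval s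
  | lt e f => if e.eval s < f.eval s then 1 else 0

/-- The number of operations in the evaluation of an expression. -/
def Expr.cost : Expr → ℕ
  | const _ => 1
  | reg _ => 1
  | read _ i => i.cost + 1
  | add e f => e.cost + f.cost + 1
  | sub e f => e.cost + f.cost + 1
  | mul e f => e.cost + f.cost + 1
  | div e f => e.cost + f.cost + 1
  | mod e f => e.cost + f.cost + 1
  | lt e f => e.cost + f.cost + 1

/-- All values that occur in the evaluation are words, that is, less than `B`. -/
def Expr.Fits (B : ℕ) (s : Store) : Expr → Prop
  | const c => c < B
  | reg r => s.reg r < B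
  | read a i => i.Fits B s ∧ s.arr a (i.eval s) < B
  | add e f => e.Fits B s ∧ f.Fits B s ∧ e.eval s + f.eval s < B
  | sub e f => e.Fits B s ∧ f.Fits B s
  | mul e f => e.Fits B s ∧ f.Fits B s ∧ e.eval s * f.eval s < B
  | div e f => e.Fits B s ∧ f.Fits B s
  | mod e f => e.Fits B s ∧ f.Fits B s
  | lt e f => e.Fits B s ∧ f.Fits B s ∧ 1 < B

/-- Assignment to a register. -/
def Store.setReg (s : Store) (r v : ℕ) : Store :=
  ⟨Function.update s.reg r v, s.arr⟩

/-- Assignment to a cell of an array. -/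
def Store.setCell (s : Store) (a i v : ℕ) : Store :=
  ⟨s.reg, Function.update s.arr a (Function.update (s.arr a) i v)⟩

/-- `Exec B p s t s'`: with words less than `B`, the program `p` started in the store `s` halts
after `t` steps in the store `s'`, and no value that occurs is too large for a word. -/
inductive Exec (B : ℕ) : Program → Store → ℕ → Store → Prop where
  | skip (s : Store) : Exec B .skip s 1 s
  | set (r : ℕ) (e : Expr) (s : Store) (he : e.Fits B s) :
      Exec B (.set r e) s (e.cost + 1) (s.setReg r (e.eval s))
  | write (a : ℕ) (i e : Expr) (s : Store) (hi : i.Fits B s) (he : e.Fits B s) :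
      Exec B (.write a i e) s (i.cost + e.cost + 1) (s.setCell a (i.eval s) (e.eval s))
  | seq (p q : Program) (s s' s'' : Store) (t t' : ℕ)
      (hp : Exec B p s t s') (hq : Exec B q s' t' s'') : Exec B (.seq p q) s (t + t') s''
  | ite_true (e : Expr) (p q : Program) (s s' : Store) (t : ℕ) (he : e.Fits B s)
      (h : e.eval s ≠ 0) (hp : Exec B p s t s') : Exec B (.ite e p q) s (e.cost + 1 + t) s'
  | ite_false (e : Expr) (p q : Program) (s s' : Store) (t : ℕ) (he : e.Fits B s)
      (h : e.eval s = 0) (hq : Exec B q s t s') : Exec B (.ite e p q) s (e.cost + 1 + t) s'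
  | loop_true (e : Expr) (p : Program) (s s' s'' : Store) (t t' : ℕ) (he : e.Fits B s)
      (h : e.eval s ≠ 0) (hp : Exec B p s t s') (hw : Exec B (.loop e p) s' t' s'') :
      Exec B (.loop e p) s (e.cost + 1 + t + t') s''
  | loop_false (e : Expr) (p : Program) (s : Store) (he : e.Fits B s) (h : e.eval s = 0) :
      Exec B (.loop e p) s (e.cost + 1) s

/-- The input: `n` and `j` in registers 0 and 1, the letters of the generators row by row in
array 0, and the phases of the generators in array 1.  Everything else is zero. -/
def inputStore {n m : ℕ} (g : Fin m → PauliOp n) (j : Fin n) : Store where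
  reg := fun r => if r = 0 then n else if r = 1 then (j : ℕ) else 0
  arr := fun a i =>
    if a = 0 then
      if h : i < m * n then
        ((g (finProdFinEquiv.symm ⟨i, h⟩).1).letter (finProdFinEquiv.symm ⟨i, h⟩).2).code
      else 0
    else if a = 1 then
      if h : i < m then ((g ⟨i, h⟩).phase : ℕ) else 0
    else 0

/-- The number of a vertex: `k` for party `k`, and `n` for `R`. -/
def vertexCode {n : ℕ} : Option (Fin n) → ℕ
  | none => n
  | some k => k

/-- The word of `S ^ a * H ^ b * S ^ c * H ^ e`.  Every single-qubit Clifford operator has this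
form up to a phase. -/
def cliffordWord (a b c e : ℕ) : List Gate :=
  List.replicate a Gate.s ++ List.replicate b Gate.h ++ List.replicate c Gate.s ++
    List.replicate e Gate.h

/-- The output `d` stands in the store `s`: the number of vertices of the path, and the phases of
the logical operators `Z` and `X`, in registers 0, 1 and 2; the adjacency matrix of the graph, the
four exponents of the Clifford operator of each vertex, the vertices of the path, and the letters
of the logical operators `Z` and `X`, in arrays 2 to 6. -/
structure Outputs {n : ℕ} (s : Store) (d : PathData n) : Prop where
  pathLength : s.reg 0 = d.path.length
  phaseZ : s.reg 1 = (d.logicalZ.phase : ℕ)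
  phaseX : s.reg 2 = (d.logicalX.phase : ℕ)
  adj : ∀ u v, (d.graph.Adj u v → s.arr 2 (vertexCode u * (n + 1) + vertexCode v) = 1) ∧
    (¬ d.graph.Adj u v → s.arr 2 (vertexCode u * (n + 1) + vertexCode v) = 0)
  clifford : ∀ v, d.clifford v =
    cliffordWord (s.arr 3 (4 * vertexCode v)) (s.arr 3 (4 * vertexCode v + 1))
      (s.arr 3 (4 * vertexCode v + 2)) (s.arr 3 (4 * vertexCode v + 3))
  path : ∀ (i : ℕ) (h : i < d.path.length), s.arr 4 i = vertexCode d.path[i]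
  letterZ : ∀ k : Fin n, s.arr 5 k = (d.logicalZ.letter k).code
  letterX : ∀ k : Fin n, s.arr 6 k = (d.logicalX.letter k).code

/-- `b` is the logical basis of the logical operators of `d`, and `d` describes its maximally
entangled state: the Clifford operations carry it to the graph state, up to a global phase. -/
structure Describes {n m : ℕ} {g : Fin m → PauliOp n} (d : PathData n) (b : LogicalBasis g) :
    Prop where
  logicalZ : ∀ a : Fin 2, d.logicalZ.mat *ᵥ b.ket a = (-1 : ℂ) ^ (a : ℕ) • b.ket a
  logicalX : ∀ a : Fin 2, d.logicalX.mat *ᵥ b.ket a = b.ket (1 - a)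
  graph : ∃ z : ℂ, ‖z‖ = 1 ∧
    graphState d.graph = z • (tensor (fun v => cliff (d.clifford v)) *ᵥ b.maxEntangled)

end StabLOCC

end

noncomputable section

set_option linter.unusedSectionVars false

namespace StabLOCC

section

/-! ### Products of local operators -/

/-! The central object is the state `(|0⟩|0⟩ + |1⟩|1⟩)/√2` of a reference qubit `R` and the code.
Its two components at `R` are the logical basis vectors up to a factor, so a local Clifford
equivalence between this state and a graph state turns both directions of the criterion into
statements about a graph on `R` and the parties.

Impossibility. Every branch of an LOCC protocol applies a product of local operators
(`exists_branches`), and such an operator keeps a factorization, with a factor on `A` that does not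
depend on the logical state (`tens_mulVec_split`). If `j ∈ A`, correct transfer of `|0⟩` and of
`|1⟩` forces so many amplitudes to vanish that the coherence of `|+⟩` is lost
(`not_extracts_of_factorsOn`).

The graph. Gaussian elimination with Hadamard gates makes the flips of the `n - 1` generators the
identity matrix on `n - 1` pivot columns. It never gets stuck: a row that is trivial off the earlier
pivots commutes with the earlier rows only if it is trivial (`Pivots.exists_column`). The one free
qubit determines logical operators `Z` and `X`; with an additional letter at `R` they commute with
each other and with the generators (`om_zRow`, `om_xRow`, `om_zRow_xRow`). After one more
elimination step the flips of all `n + 1` rows form the identity matrix. Up to phase gates these are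
the stabilizers of a graph state (`row_fixes`), whose components at `R` give the logical basis
(`Eliminated.exists_describes`).

The dichotomy. If `j` and `R` are not connected, the graph state is a product over the component of
`j` and its complement, so the logical basis factors (`Describes.exists_factorsOn`). If they are
connected, a shortest path is induced. The `Z` measurements at its neighbours leave only signs on
the path, and the amplitude becomes a product of 2×2 matrices along it (`tens_mulVec_graphState`).
The corrections collapse this product to a multiple of the identity (`transfer_innerTurns`,
`transfer_reference`), and trace preservation fixes the scalar (`extracts_of_branches`). Both sides
of the criterion are independent of the logical basis (`FactorsOn.of_basis`, `Extracts.of_basis`).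

The algorithm performs the elimination and then fills a table of walks of exact length `r` from each
vertex to `R`, which yields a shortest path. `WP` is total correctness with resources: running time
is bounded by the nesting of loops (`Program.time_le`), and the size of the words by a degree of the
expressions (`Expr.eval_lt`). Nesting depth three gives `O(n ^ 3)`. -/

/-- The operator `⨂ᵥ M v` on systems of arbitrary local dimension. -/
def tens {V d : Type} [Fintype V] (M : V → Matrix d d ℂ) : Matrix (V → d) (V → d) ℂ :=
  Matrix.of fun x y => ∏ v, M v (x v) (y v)

theorem tensor_eq_tens {V : Type} [Fintype V] (M : V → Matrix (Fin 2) (Fin 2) ℂ) :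
    tensor M = tens M := rfl

/-- Distributivity: a sum over all intermediate assignments of a product over sites is the product
of the sums at the sites. -/
theorem tens_mul {V d : Type} [Fintype V] [DecidableEq V] [Fintype d]
    (M N : V → Matrix d d ℂ) : tens M * tens N = tens fun v => M v * N v := by
  ext x z
  simp only [tens, Matrix.mul_apply, Matrix.of_apply, ← Finset.prod_mul_distrib]
  rw [Finset.prod_univ_sum, Fintype.piFinset_univ]

theorem tens_one {V d : Type} [Fintype V] [DecidableEq V] [DecidableEq d] :
    (tens fun _ : V => (1 : Matrix d d ℂ)) = 1 := by
  ext x y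
  simp only [tens, Matrix.of_apply]
  by_cases h : x = y
  · subst h
    simp
  · obtain ⟨v, hv⟩ := Function.ne_iff.1 h
    rw [Matrix.one_apply_ne h]
    exact Finset.prod_eq_zero (Finset.mem_univ v) (Matrix.one_apply_ne hv)

theorem tens_smul {V d : Type} [Fintype V] (c : V → ℂ) (M : V → Matrix d d ℂ) :
    (tens fun v => c v • M v) = (∏ v, c v) • tens M := by
  ext x y
  simp [tens, Finset.prod_mul_distrib]

theorem tens_conjTranspose {V d : Type} [Fintype V] (M : V → Matrix d d ℂ) :
    (tens M)ᴴ = tens fun v => (M v)ᴴ := by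
  ext x y
  simp [tens, Matrix.conjTranspose_apply]

theorem tens_inv_mul {V d : Type} [Fintype V] [DecidableEq V] [Fintype d] [DecidableEq d]
    {M N : V → Matrix d d ℂ} (h : ∀ v, M v * N v = 1) : tens M * tens N = 1 := by
  rw [tens_mul]
  simp only [h]
  exact tens_one

/-! ### Pauli letters -/

namespace Letter

theorem code_injective : Function.Injective Letter.code := by
  intro a b h
  cases a <;> cases b <;> simp_all [Letter.code]

instance : DecidableEq Letter := fun _ _ => decidable_of_iff _ code_injective.eq_iff

/-- Whether the letter flips the basis states. -/
def xb : Letter → ZMod 2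
  | one => 0
  | x => 1
  | y => 1
  | z => 0

/-- Whether the letter multiplies `|1⟩` by a sign relative to `|0⟩`. -/
def zb : Letter → ZMod 2
  | one => 0
  | x => 0
  | y => 1
  | z => 1

/-- The product of two letters, up to a phase. -/
def mul : Letter → Letter → Letter
  | one, b => b
  | a, one => a
  | x, x => one
  | x, y => z
  | x, z => y
  | y, x => z
  | y, y => one
  | y, z => x
  | z, x => y
  | z, y => x
  | z, z => one

/-- The exponent of `i` in the product of two letters. -/
def lam : Letter → Letter → ℕ
  | x, y => 1
  | y, z => 1
  | z, x => 1
  | y, x => 3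
  | z, y => 3
  | x, z => 3
  | _, _ => 0

/-- Conjugation by the Hadamard gate, up to a sign. -/
def swap : Letter → Letter
  | one => one
  | x => z
  | y => y
  | z => x

/-- The symplectic form: whether two letters anticommute. -/
def om (a b : Letter) : ZMod 2 := a.xb * b.zb + a.zb * b.xb

theorem mat_mul (a b : Letter) : a.mat * b.mat = Complex.I ^ lam a b • (mul a b).mat := by
  have h3 : Complex.I ^ 3 = -Complex.I := by
    rw [pow_succ, Complex.I_sq]; ring
  cases a <;> cases b <;> ext i k <;> fin_cases i <;> fin_cases k <;>
    simp [mat, lam, mul, h3]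

theorem mat_conjTranspose (a : Letter) : a.matᴴ = a.mat := by
  cases a <;> ext i k <;> fin_cases i <;> fin_cases k <;> simp [mat]

theorem mat_mul_self (a : Letter) : a.mat * a.mat = 1 := by
  rw [mat_mul]
  cases a <;> simp [lam, mul, mat]

theorem xb_mul (a b : Letter) : (mul a b).xb = a.xb + b.xb := by
  cases a <;> cases b <;> decide

theorem zb_mul (a b : Letter) : (mul a b).zb = a.zb + b.zb := by
  cases a <;> cases b <;> decide

/-- A product of two Hermitian letters is Hermitian exactly when they commute, so an odd power of
`i` occurs exactly when they anticommute. -/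
theorem lam_cast (a b : Letter) : (lam a b : ZMod 2) = om a b := by
  cases a <;> cases b <;> decide

theorem om_mul_left (a b c : Letter) : om (mul a b) c = om a c + om b c := by
  simp only [om, xb_mul, zb_mul]; ring

theorem om_comm (a b : Letter) : om a b = om b a := by
  simp only [om]; ring

theorem om_self (a : Letter) : om a a = 0 := by
  cases a <;> decide

theorem om_swap (a b : Letter) : om a.swap b.swap = om a b := by
  cases a <;> cases b <;> decide

theorem xb_swap (a : Letter) : a.swap.xb = a.zb := by
  cases a <;> rfl

theorem zb_swap (a : Letter) : a.swap.zb = a.xb := by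
  cases a <;> rfl

theorem ext_bits {a b : Letter} (hx : a.xb = b.xb) (hz : a.zb = b.zb) : a = b := by
  revert hx hz
  cases a <;> cases b <;> decide

/-- The Hadamard gate exchanges `X` and `Z` and therefore reverses the sign of `Y = iXZ`. This is
the only sign, and it is recorded as two powers of `i`. -/
theorem hadamard_conj (a : Letter) :
    Gate.h.mat * a.mat = Complex.I ^ (if a = y then 2 else 0) • (a.swap.mat * Gate.h.mat) := by
  cases a <;> ext i k <;> fin_cases i <;> fin_cases k <;>
    simp [mat, swap, Gate.mat, mul_comm]

end Letter

theorem hadamard_mul_self : Gate.h.mat * Gate.h.mat = 1 := by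
  have h := Gate.mat_unitary .h
  have : (Gate.h.mat)ᴴ = Gate.h.mat := by
    ext i k
    fin_cases i <;> fin_cases k <;> simp [Gate.mat]
  rwa [this] at h

theorem zmod_two_eq_zero_or_one (a : ZMod 2) : a = 0 ∨ a = 1 := by
  revert a; decide

theorem I_pow_eq_of_mod {a b : ℕ} (h : a % 4 = b % 4) : Complex.I ^ a = Complex.I ^ b := by
  rw [← Nat.div_add_mod a 4, ← Nat.div_add_mod b 4, h, pow_add, pow_add, pow_mul, pow_mul,
    Complex.I_pow_four, one_pow, one_pow]

/-! ### Pauli operators on qubits labelled by an arbitrary type -/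

/-- The operator `i ^ phase · ⨂ᵥ letter v`. -/
@[ext] structure Pauli (V : Type) where
  phase : ℕ
  letter : V → Letter

namespace Pauli

variable {V : Type} [Fintype V] [DecidableEq V]

/-- The matrix of a Pauli operator. -/
def mat (p : Pauli V) : Matrix (V → Fin 2) (V → Fin 2) ℂ :=
  Complex.I ^ p.phase • tens fun v => (p.letter v).mat

/-- The product of Pauli operators. -/
def mul (p q : Pauli V) : Pauli V where
  phase := (p.phase + q.phase + ∑ v, (p.letter v).lam (q.letter v)) % 4
  letter := fun v => (p.letter v).mul (q.letter v)

/-- Conjugation by the Hadamard gate at `c`. -/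
def had (c : V) (p : Pauli V) : Pauli V where
  phase := (p.phase + if p.letter c = .y then 2 else 0) % 4
  letter := Function.update p.letter c (p.letter c).swap

/-- The symplectic form of two Pauli operators: whether they anticommute. -/
def om (p q : Pauli V) : ZMod 2 := ∑ v, (p.letter v).om (q.letter v)

/-- The symplectic vector of a Pauli operator. -/
def vec (p : Pauli V) : V → ZMod 2 × ZMod 2 := fun v => ((p.letter v).xb, (p.letter v).zb)

theorem mul_mat (p q : Pauli V) : (p.mul q).mat = p.mat * q.mat := by
  simp only [mat, mul, Matrix.smul_mul, Matrix.mul_smul, tens_mul, Letter.mat_mul, tens_smul,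
    smul_smul, Finset.prod_pow_eq_pow_sum, ← pow_add]
  rw [I_pow_eq_of_mod (Nat.mod_mod _ _), add_left_comm, add_assoc]

theorem om_comm (p q : Pauli V) : om p q = om q p := by
  simp only [om]
  exact Finset.sum_congr rfl fun v _ => Letter.om_comm _ _

theorem om_self (p : Pauli V) : om p p = 0 := by
  simp [om, Letter.om_self]

theorem om_mul_left (p q r : Pauli V) : om (p.mul q) r = om p r + om q r := by
  simp only [om, mul, Letter.om_mul_left, Finset.sum_add_distrib]

theorem om_mul_right (p q r : Pauli V) : om r (p.mul q) = om r p + om r q := by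
  rw [om_comm, om_mul_left, om_comm p, om_comm q]

theorem om_had (c : V) (p q : Pauli V) : om (p.had c) (q.had c) = om p q := by
  simp only [om, had]
  refine Finset.sum_congr rfl fun v _ => ?_
  by_cases h : v = c
  · subst h; simp [Letter.om_swap]
  · simp [h]

theorem cast_mod_four (a : ℕ) : ((a % 4 : ℕ) : ZMod 2) = a := by
  conv_rhs => rw [← Nat.div_add_mod a 4]
  have : ((4 : ℕ) : ZMod 2) = 0 := by decide
  push_cast at this ⊢
  simp [this]

/-- An even phase means a Hermitian operator. By `lam_cast` at each site, a product of commuting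
Hermitian operators has even phase again, which keeps elimination steps inside `IsTableau`. -/
theorem mul_phase_cast (p q : Pauli V) :
    ((p.mul q).phase : ZMod 2) = p.phase + q.phase + om p q := by
  simp only [mul, cast_mod_four, om]
  push_cast
  simp only [Letter.lam_cast]

theorem had_phase_cast (c : V) (p : Pauli V) : ((p.had c).phase : ZMod 2) = p.phase := by
  simp only [had, cast_mod_four]
  have : ((2 : ℕ) : ZMod 2) = 0 := by decide
  split_ifs <;> simp
  exact this

theorem mul_vec (p q : Pauli V) : (p.mul q).vec = p.vec + q.vec := by
  funext v
  simp [mul, vec, Letter.xb_mul, Letter.zb_mul]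

/-- The Hadamard gate at `c`. -/
def hadOp (c : V) : Matrix (V → Fin 2) (V → Fin 2) ℂ :=
  tens fun v => if v = c then Gate.h.mat else 1

theorem hadOp_mul_mat (c : V) (p : Pauli V) :
    hadOp c * p.mat = (p.had c).mat * hadOp c := by
  simp only [hadOp, mat, had, Matrix.mul_smul, Matrix.smul_mul, tens_mul]
  have h : (fun v => (if v = c then Gate.h.mat else 1) * (p.letter v).mat) = fun v =>
      (if v = c then Complex.I ^ (if p.letter c = .y then 2 else 0) else 1) •
        (((Function.update p.letter c (p.letter c).swap) v).mat *
          if v = c then Gate.h.mat else 1) := by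
    funext v
    by_cases hv : v = c
    · subst hv; simp [Letter.hadamard_conj]
    · simp [hv]
  rw [h, tens_smul, smul_smul, Finset.prod_ite_eq' Finset.univ c, if_pos (Finset.mem_univ c),
    ← pow_add, I_pow_eq_of_mod (Nat.mod_mod _ _)]

theorem hadOp_mul_self (c : V) : hadOp c * hadOp c = 1 := by
  refine tens_inv_mul fun v => ?_
  split_ifs
  · exact hadamard_mul_self
  · simp

/-- The basis state reached from `x` by the flips of `p`. -/
def flip (p : Pauli V) (x : V → Fin 2) : V → Fin 2 := fun v => if (p.letter v).xb = 1 then 1 - x v else x v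

/-- Each row of a Pauli matrix has a single nonzero entry, in the column reached by the flips. -/
theorem mat_mulVec (p : Pauli V) (ψ : (V → Fin 2) → ℂ) (x : V → Fin 2) :
    (p.mat *ᵥ ψ) x =
      Complex.I ^ p.phase * (∏ v, (p.letter v).mat (x v) (p.flip x v)) * ψ (p.flip x) := by
  rw [mat, Matrix.smul_mulVec, Pi.smul_apply, smul_eq_mul, mul_assoc]
  congr 1
  simp only [Matrix.mulVec, dotProduct, tens, Matrix.of_apply]
  rw [Finset.sum_eq_single (p.flip x)]
  · intro y _ hy
    obtain ⟨v, hv⟩ := Function.ne_iff.1 hy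
    rw [Finset.prod_eq_zero (Finset.mem_univ v), zero_mul]
    simp only [flip] at hv
    revert hv
    generalize p.letter v = l
    generalize x v = a
    generalize y v = b
    intro h
    cases l <;> fin_cases a <;> fin_cases b <;> simp_all [Letter.xb, Letter.mat]
  · simp

end Pauli

end

section

/-! ### Tableaux and their elimination steps -/

section Tableau

variable {V : Type} [Fintype V] [DecidableEq V]

/-- The first `m` rows are Hermitian and commute. -/
structure IsTableau (m : ℕ) (τ : ℕ → Pauli V) : Prop where
  even : ∀ k < m, ((τ k).phase : ZMod 2) = 0
  om : ∀ k < m, ∀ l < m, Pauli.om (τ k) (τ l) = 0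

/-- All of the first `m` rows fix `φ`. -/
def Fixes (m : ℕ) (τ : ℕ → Pauli V) (φ : (V → Fin 2) → ℂ) : Prop :=
  ∀ k < m, (τ k).mat *ᵥ φ = φ

/-- The first `m` rows are independent. -/
def Independent (m : ℕ) (τ : ℕ → Pauli V) : Prop :=
  LinearIndependent (ZMod 2) fun k : Fin m => (τ k).vec

/-- The first `i` rows have pivots among the columns; `pr` assigns to the pivot column of row `k`
the number `k + 1`, and `0` to the other columns. -/
structure Pivots (m i : ℕ) (τ : ℕ → Pauli V) (pr : V → ℕ) : Prop where
  le : ∀ v, pr v ≤ i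
  surj : ∀ k < i, ∃ v, pr v = k + 1
  inj : ∀ v w, pr v = pr w → pr v ≠ 0 → v = w
  xb : ∀ v k, pr v = k + 1 → ∀ l < m, ((τ l).letter v).xb = if l = k then 1 else 0

/-- Eliminate the flips in column `c` from all rows but row `i`. -/
def elim (τ : ℕ → Pauli V) (i : ℕ) (c : V) : ℕ → Pauli V := fun k =>
  if k ≠ i ∧ ((τ k).letter c).xb = 1 then (τ k).mul (τ i) else τ k

variable {m i : ℕ} {τ : ℕ → Pauli V} {pr : V → ℕ} {c : V}

theorem IsTableau.elim (h : IsTableau m τ) (hi : i < m) : IsTableau m (elim τ i c) where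
  even k hk := by
    unfold StabLOCC.elim
    split_ifs
    · rw [Pauli.mul_phase_cast, h.even k hk, h.even i hi, h.om k hk i hi]; simp
    · exact h.even k hk
  om k hk l hl := by
    unfold StabLOCC.elim
    split_ifs <;> simp only [Pauli.om_mul_left, Pauli.om_mul_right, h.om _ hk _ hl,
      h.om _ hk _ hi, h.om _ hi _ hl, h.om _ hi _ hi, add_zero]

theorem IsTableau.had (h : IsTableau m τ) (c : V) : IsTableau m fun k => (τ k).had c where
  even k hk := by rw [Pauli.had_phase_cast, h.even k hk]
  om k hk l hl := by rw [Pauli.om_had, h.om k hk l hl]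

/-- Row `i` is left unchanged, so it fixes `φ` on either side, and an additional factor that fixes
`φ` does not matter for the other rows. -/
theorem fixes_elim_iff (hi : i < m) (φ : (V → Fin 2) → ℂ) :
    Fixes m (elim τ i c) φ ↔ Fixes m τ φ := by
  have key : ∀ k, (τ i).mat *ᵥ φ = φ →
      ((elim τ i c k).mat *ᵥ φ = φ ↔ (τ k).mat *ᵥ φ = φ) := by
    intro k h
    unfold elim
    split_ifs
    · rw [Pauli.mul_mat, ← Matrix.mulVec_mulVec, h]
    · rfl
  constructor
  · intro h k hk
    have h0 : (τ i).mat *ᵥ φ = φ := by simpa [elim] using h i hi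
    exact (key k h0).1 (h k hk)
  · intro h k hk
    exact (key k (h i hi)).2 (h k hk)

theorem fixes_had_iff (φ : (V → Fin 2) → ℂ) :
    Fixes m (fun k => (τ k).had c) (Pauli.hadOp c *ᵥ φ) ↔ Fixes m τ φ := by
  refine forall_congr' fun k => imp_congr_right fun _ => ?_
  rw [Matrix.mulVec_mulVec, ← Pauli.hadOp_mul_mat, ← Matrix.mulVec_mulVec]
  constructor
  · intro h
    have := congrArg (fun ψ => Pauli.hadOp c *ᵥ ψ) h
    simpa [Matrix.mulVec_mulVec, ← Matrix.mul_assoc, Pauli.hadOp_mul_self] using this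
  · intro h
    rw [h]

/-- On symplectic vectors the step adds multiples of vector `i` to the others, with coefficient zero
at `i` itself, and this is invertible. -/
theorem Independent.elim (h : Independent m τ) (hi : i < m) : Independent m (elim τ i c) := by
  have := (linearIndependent_add_smul_iff (R := ZMod 2) (v := fun k : Fin m => (τ k).vec)
    (c := fun k : Fin m => if (k : ℕ) ≠ i ∧ ((τ k).letter c).xb = 1 then 1 else 0)
    (i := ⟨i, hi⟩) (by simp)).2 h
  unfold Independent
  have e : (fun k : Fin m => (StabLOCC.elim τ i c k).vec) = (fun k : Fin m => (τ k).vec) +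
      fun k : Fin m => (if (k : ℕ) ≠ i ∧ ((τ k).letter c).xb = 1 then (1 : ZMod 2) else 0) •
        (τ i).vec := by
    funext k
    unfold StabLOCC.elim
    split_ifs with h1
    · simp [Pauli.mul_vec, h1]
    · simp [h1]
  rw [e]
  exact this

/-- On symplectic vectors the gate swaps the two bits of one column, an injective linear map. -/
theorem Independent.had (h : Independent m τ) (c : V) :
    Independent m fun k => (τ k).had c := by
  let L : (V → ZMod 2 × ZMod 2) →ₗ[ZMod 2] (V → ZMod 2 × ZMod 2) :=
    { toFun := fun f v => if v = c then (f v).swap else f v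
      map_add' := fun f g => by
        funext v
        by_cases hv : v = c <;> simp [hv]
      map_smul' := fun a f => by
        funext v
        by_cases hv : v = c <;> simp [hv] }
  have hL : LinearMap.ker L = ⊥ := by
    rw [LinearMap.ker_eq_bot]
    intro f g hfg
    funext v
    have := congrFun hfg v
    by_cases hv : v = c
    · simpa [L, hv] using this
    · simpa [L, hv] using this
  have := LinearIndependent.map' h L hL
  unfold Independent
  have e : (fun k : Fin m => ((τ k).had c).vec) = L ∘ fun k : Fin m => (τ k).vec := by
    funext k v
    by_cases hv : v = c
    · subst hv
      simp [L, Pauli.vec, Pauli.had, Letter.xb_swap, Letter.zb_swap]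
    · simp [L, Pauli.vec, Pauli.had, hv]
  rw [e]
  exact this

/-- Suppose row `i` is trivial off the pivot columns. It has no flips in the pivot columns either,
so it consists of letters `Z` there. A `Z` in the pivot column of row `k` would make it anticommute
with row `k`. Hence the row is trivial, against independence. -/
theorem Pivots.exists_column (hP : Pivots m i τ pr) (hT : IsTableau m τ) (hI : Independent m τ)
    (hi : i < m) : ∃ c, pr c = 0 ∧ (τ i).letter c ≠ .one := by
  by_contra! hcon
  refine LinearIndependent.ne_zero (⟨i, hi⟩ : Fin m) hI (funext fun v => ?_)
  have hx : ∀ v, ((τ i).letter v).xb = 0 := by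
    intro v
    rcases Nat.eq_zero_or_pos (pr v) with h0 | h0
    · rw [hcon v h0]; rfl
    · obtain ⟨k, hk⟩ := Nat.exists_eq_succ_of_ne_zero h0.ne'
      have := hP.le v
      rw [hP.xb v k hk i hi, if_neg (by omega)]
  have hz : ((τ i).letter v).zb = 0 := by
    rcases Nat.eq_zero_or_pos (pr v) with h0 | h0
    · rw [hcon v h0]; rfl
    · obtain ⟨k, hk⟩ := Nat.exists_eq_succ_of_ne_zero h0.ne'
      have hki : k < i := by have := hP.le v; omega
      have h1 := hT.om k (hki.trans hi) i hi
      -- Row `i` has no flips, so only flips of row `k` against `Z` bits of row `i` count. Off the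
      -- pivots row `i` is trivial, and among the pivots row `k` flips only `v`.
      have h2 : ∀ w, ((τ k).letter w).om ((τ i).letter w) =
          if w = v then ((τ i).letter v).zb else 0 := by
        intro w
        simp only [Letter.om, hx, mul_zero, add_zero]
        rcases Nat.eq_zero_or_pos (pr w) with hw | hw
        · have : w ≠ v := by rintro rfl; omega
          rw [hcon w hw, if_neg this]; simp [Letter.zb]
        · obtain ⟨l, hl⟩ := Nat.exists_eq_succ_of_ne_zero hw.ne'
          rw [hP.xb w l hl k (hki.trans hi)]
          by_cases hwv : w = v
          · subst hwv
            have : k = l := by omega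
            simp [this]
          · have : k ≠ l := by
              rintro rfl
              exact hwv (hP.inj w v (by omega) (by omega))
            simp [this, hwv]
      simpa [Pauli.om, h2] using h1
  simp [Pauli.vec, hx, hz]

theorem elim_xb (τ : ℕ → Pauli V) (i : ℕ) (c : V) (l : ℕ) (v : V) :
    ((elim τ i c l).letter v).xb = ((τ l).letter v).xb +
      if l ≠ i ∧ ((τ l).letter c).xb = 1 then ((τ i).letter v).xb else 0 := by
  unfold elim
  split_ifs <;> simp [Pauli.mul, Letter.xb_mul]

theorem Pivots.insert (hP : Pivots m i τ pr) (hc : pr c = 0)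
    (hx : ∀ l < m, ((τ l).letter c).xb = if l = i then 1 else 0) :
    Pivots m (i + 1) τ (Function.update pr c (i + 1)) where
  le v := by
    have := hP.le v
    by_cases hv : v = c <;> simp [hv]
    omega
  surj k hk := by
    by_cases h : k = i
    · exact ⟨c, by simp [h]⟩
    · obtain ⟨v, hv⟩ := hP.surj k (by omega)
      have : v ≠ c := by rintro rfl; omega
      exact ⟨v, by simp [this, hv]⟩
  inj v w h h0 := by
    have h1 := hP.le v
    have h2 := hP.le w
    by_cases hv : v = c <;> by_cases hw : w = c <;> simp [hv, hw] at h h0 ⊢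
    · omega
    · omega
    · exact hP.inj v w h h0
  xb v k hk l hl := by
    by_cases hv : v = c
    · subst hv
      simp at hk
      subst hk
      exact hx l hl
    · rw [Function.update_of_ne hv] at hk
      exact hP.xb v k hk l hl

/-- The older pivots belong to rows before `i`, so row `i` has no flips in their columns and
multiplying by it does not disturb them. In column `c` it cancels every other flip. -/
theorem Pivots.elim (hP : Pivots m i τ pr) (hi : i < m) (hc : pr c = 0)
    (hx : ((τ i).letter c).xb = 1) :
    Pivots m (i + 1) (elim τ i c) (Function.update pr c (i + 1)) := by
  refine Pivots.insert ⟨hP.le, hP.surj, hP.inj, ?_⟩ hc ?_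
  · intro v k hk l hl
    have := hP.le v
    rw [elim_xb, hP.xb v k hk l hl, hP.xb v k hk i hi]
    simp [show i ≠ k by omega]
  · intro l hl
    rw [elim_xb]
    by_cases hli : l = i
    · simp [hli, hx]
    · rcases zmod_two_eq_zero_or_one ((τ l).letter c).xb with h | h
      · simp [hli, h]
      · simp only [hli, h, hx, ne_eq, not_false_eq_true, and_self, if_true, if_false]; decide

theorem Pivots.had (hP : Pivots m i τ pr) (hc : pr c = 0) :
    Pivots m i (fun k => (τ k).had c) pr := by
  refine ⟨hP.le, hP.surj, hP.inj, fun v k hk l hl => ?_⟩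
  have : v ≠ c := by rintro rfl; omega
  simp [Pauli.had, this, hP.xb v k hk l hl]

/-- Hadamard gates at the columns `v` with `h v = 1`. -/
def hadOps (h : V → ℕ) : Matrix (V → Fin 2) (V → Fin 2) ℂ :=
  tens fun v => if h v = 1 then Gate.h.mat else 1

theorem hadOps_update {h : V → ℕ} (hc : h c = 0) :
    hadOps (Function.update h c 1) = Pauli.hadOp c * hadOps h := by
  simp only [hadOps, Pauli.hadOp, tens_mul]
  congr 1
  funext v
  by_cases hv : v = c
  · subst hv; simp [hc]
  · simp [hv]

theorem hadOps_mul_self (h : V → ℕ) : hadOps h * hadOps h = 1 := by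
  refine tens_inv_mul fun v => ?_
  split_ifs
  · exact hadamard_mul_self
  · simp

/-- The state of the elimination after `i` rows: `τ` are the transformed rows, `h` the columns at
which Hadamard gates have been applied, and the vectors fixed by the first `m` rows are the
transforms of those satisfying `F`. The columns in `E` are not touched. -/
structure Reduced (m i : ℕ) (e : V) (F : ((V → Fin 2) → ℂ) → Prop) (τ : ℕ → Pauli V)
    (pr h : V → ℕ) : Prop where
  tableau : IsTableau m τ
  independent : Independent m τ
  pivots : Pivots m i τ pr
  had_le : ∀ v, h v ≤ 1
  had_eq : ∀ v, pr v = 0 → h v = 0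
  untouched : ∀ k < m, (τ k).letter e = .one
  trivial : ∀ k, m ≤ k → τ k = ⟨0, fun _ => .one⟩
  fixes : ∀ φ, Fixes m τ (hadOps h *ᵥ φ) ↔ F φ

/-- One step of the elimination with pivot column `c`. -/
theorem Reduced.step {e : V} {F : ((V → Fin 2) → ℂ) → Prop} {h : V → ℕ}
    (H : Reduced m i e F τ pr h) (hi : i < m) (hc : pr c = 0) (hl : (τ i).letter c ≠ .one) :
    Reduced m (i + 1) e F
      (elim (if ((τ i).letter c).xb = 1 then τ else fun k => (τ k).had c) i c)
      (Function.update pr c (i + 1))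
      (if ((τ i).letter c).xb = 1 then h else Function.update h c 1) := by
  have hce : c ≠ e := by
    rintro rfl
    exact hl (H.untouched i hi)
  -- Once row `i` flips column `c`, with or without a Hadamard gate applied there before, the rest
  -- of the step is the same.
  have core : ∀ (τ' : ℕ → Pauli V) (h' : V → ℕ), IsTableau m τ' → Independent m τ' →
      Pivots m i τ' pr → ((τ' i).letter c).xb = 1 → (∀ v, h' v ≤ 1) →
      (∀ v, v ≠ c → pr v = 0 → h' v = 0) → (∀ k < m, (τ' k).letter e = .one) →
      (∀ k, m ≤ k → τ' k = ⟨0, fun _ => .one⟩) →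
      (∀ φ, Fixes m τ' (hadOps h' *ᵥ φ) ↔ F φ) →
      Reduced m (i + 1) e F (elim τ' i c) (Function.update pr c (i + 1)) h' := by
    intro τ' h' hT hI hP hx hle heq hun htr hfix
    refine ⟨hT.elim hi, hI.elim hi, hP.elim hi hc hx, hle, ?_, ?_, ?_, ?_⟩
    · intro v hv
      by_cases hvc : v = c
      · subst hvc; simp at hv
      · rw [Function.update_of_ne hvc] at hv
        exact heq v hvc hv
    · intro k hk
      unfold elim
      split_ifs
      · simp [Pauli.mul, hun k hk, hun i hi, Letter.mul]
      · exact hun k hk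
    · intro k hk
      unfold elim
      rw [if_neg, htr k hk]
      rw [htr k hk]
      simp [Letter.xb]
    · intro φ
      rw [fixes_elim_iff hi, hfix]
  split_ifs with hx
  · exact core τ h H.tableau H.independent H.pivots hx H.had_le (fun v _ => H.had_eq v) H.untouched
      H.trivial H.fixes
  · refine core _ _ (H.tableau.had c) (H.independent.had c) (H.pivots.had hc) ?_ ?_ ?_ ?_ ?_ ?_
    -- A nontrivial letter without flip is `Z`, which the Hadamard gate turns into `X`.
    · simp only [Pauli.had, Function.update_self, Letter.xb_swap]
      revert hx hl
      cases (τ i).letter c <;> simp [Letter.xb, Letter.zb]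
    · intro v
      by_cases hv : v = c
      · simp [hv]
      · simpa [hv] using H.had_le v
    · intro v hv h0
      rw [Function.update_of_ne hv]
      exact H.had_eq v h0
    · intro k hk
      simp [Pauli.had, hce.symm, H.untouched k hk]
    · intro k hk
      rw [H.trivial k hk]
      ext v
      · simp [Pauli.had]
      · by_cases hv : v = c
        · subst hv; simp [Pauli.had, Letter.swap]
        · simp [Pauli.had, hv]
    · intro φ
      rw [hadOps_update (H.had_eq c hc), ← Matrix.mulVec_mulVec, fixes_had_iff, H.fixes]

theorem Reduced.exists_column {e : V} {F : ((V → Fin 2) → ℂ) → Prop} {h : V → ℕ}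
    (H : Reduced m i e F τ pr h) (hi : i < m) : ∃ c, pr c = 0 ∧ (τ i).letter c ≠ .one :=
  H.pivots.exists_column H.tableau H.independent hi

end Tableau

end

section

/-! ### Stabilizers as tableaux -/

theorem I_pow_mod (a : ℕ) : Complex.I ^ a = Complex.I ^ (a % 4) :=
  I_pow_eq_of_mod (Nat.mod_mod _ _).symm

theorem mod_eq_of_I_pow_eq {a b : ℕ} (h : Complex.I ^ a = Complex.I ^ b) : a % 4 = b % 4 := by
  rw [I_pow_mod a, I_pow_mod b] at h
  have ha := Nat.mod_lt a (show 0 < 4 by norm_num)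
  have hb := Nat.mod_lt b (show 0 < 4 by norm_num)
  revert h ha hb
  generalize a % 4 = p
  generalize b % 4 = q
  intro h hp hq
  have h3 : Complex.I ^ 3 = -Complex.I := by rw [pow_succ, Complex.I_sq]; ring
  interval_cases p <;> interval_cases q <;> simp [h3, Complex.ext_iff] at h ⊢ <;> norm_num at h

/-- A Pauli operator, with its phase as a natural number. -/
def PauliOp.toPauli {n : ℕ} (p : PauliOp n) : Pauli (Fin n) := ⟨p.phase, p.letter⟩

theorem PauliOp.toPauli_mat {n : ℕ} (p : PauliOp n) : p.toPauli.mat = p.mat := rfl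

/-- A Pauli operator on `n` qubits, together with a letter at the reference system. -/
def PauliOp.withLetter {n : ℕ} (p : PauliOp n) (l : Letter) : Pauli (Option (Fin n)) :=
  ⟨p.phase, fun o => o.elim l p.letter⟩

/-- A Pauli operator on `n` qubits, acting trivially on the reference system. -/
def PauliOp.extend {n : ℕ} (p : PauliOp n) : Pauli (Option (Fin n)) := p.withLetter .one

theorem Letter.mul_comm (a b : Letter) : Letter.mul a b = Letter.mul b a := by
  cases a <;> cases b <;> rfl

theorem Letter.lam_add_lam (a b : Letter) : (Letter.lam a b + Letter.lam b a) % 4 = 0 := by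
  cases a <;> cases b <;> rfl

/-- Both orders of the product have the same letters, so equality of the matrices is equality of the
phases modulo 4. The exponents contributed by the letters are then congruent modulo 4, while their
sum is divisible by 4 (`Letter.lam_add_lam`). So each is even, and its parity is the symplectic
form. -/
theorem Pauli.om_eq_zero_of_comm {V : Type} [Fintype V] [DecidableEq V] (p q : Pauli V)
    (h : p.mat * q.mat = q.mat * p.mat) : Pauli.om p q = 0 := by
  rw [← Pauli.mul_mat, ← Pauli.mul_mat] at h
  have hl : (p.mul q).letter = (q.mul p).letter := by
    funext v
    exact Letter.mul_comm _ _
  have hone : (tens fun v => ((q.mul p).letter v).mat) * (tens fun v => ((q.mul p).letter v).mat) =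
      1 := tens_inv_mul fun v => Letter.mat_mul_self _
  have h1 := congrArg (fun M => M * (tens fun v => ((q.mul p).letter v).mat)) h
  simp only [Pauli.mat, hl, Matrix.smul_mul, hone] at h1
  have h2 := congrFun (congrFun h1 (fun _ => 0)) (fun _ => 0)
  simp only [Matrix.smul_apply, Matrix.one_apply_eq, smul_eq_mul, mul_one] at h2
  have h3 := mod_eq_of_I_pow_eq h2
  simp only [Pauli.mul, Nat.mod_mod] at h3
  have h4 : (∑ v, (p.letter v).lam (q.letter v) + ∑ v, (q.letter v).lam (p.letter v)) % 4 = 0 := by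
    rw [← Finset.sum_add_distrib, Finset.sum_nat_mod]
    simp [Letter.lam_add_lam]
  have h5 : (∑ v, (p.letter v).lam (q.letter v)) % 2 = 0 := by omega
  have h6 : Pauli.om p q = ((∑ v, (p.letter v).lam (q.letter v) : ℕ) : ZMod 2) := by
    simp only [Pauli.om]
    push_cast
    simp only [Letter.lam_cast]
  rw [h6]
  exact (ZMod.natCast_eq_zero_iff _ _).2 (Nat.dvd_of_mod_eq_zero h5)

theorem Pauli.mat_of_vec_eq_zero {V : Type} [Fintype V] [DecidableEq V] (p : Pauli V)
    (h : p.vec = 0) : p.mat = Complex.I ^ p.phase • 1 := by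
  have : ∀ v, p.letter v = .one := by
    intro v
    have h1 := congrFun h v
    simp only [Pauli.vec, Pi.zero_apply, Prod.mk_eq_zero] at h1
    exact Letter.ext_bits h1.1 h1.2
  simp only [Pauli.mat, this]
  congr 1
  exact tens_one

section Stabilizer

variable {n m : ℕ} {g : Fin m → PauliOp n}

/-- Besides `-1` also `i` and `-i` are excluded, since their square is `-1`. -/
theorem IsStabilizer.I_pow_eq_one (hg : IsStabilizer g) (a : ℕ)
    (h : Complex.I ^ a • (1 : Matrix (Fin n → Fin 2) (Fin n → Fin 2) ℂ) ∈
      generated (Set.range g)) : Complex.I ^ a = 1 := by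
  have hne := hg.neg_one_notMem
  have h2 := mul_mem h h
  rw [Matrix.smul_mul, Matrix.one_mul, smul_smul] at h2
  rw [I_pow_mod a] at h h2 ⊢
  have ha := Nat.mod_lt a (show 0 < 4 by norm_num)
  revert h h2
  generalize a % 4 = p at ha
  have h3 : Complex.I ^ 3 = -Complex.I := by rw [pow_succ, Complex.I_sq]; ring
  intro h h2
  interval_cases p
  · simp
  · simp [hne] at h2
  · simp [hne] at h
  · simp [hne, h3] at h2

theorem mat_mem_generated (k : Fin m) : (g k).mat ∈ generated (Set.range g) :=
  Submonoid.subset_closure ⟨g k, ⟨k, rfl⟩, rfl⟩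

theorem PauliOp.mat_mul_self (p : PauliOp n) : p.mat * p.mat = Complex.I ^ (2 * (p.phase : ℕ)) • 1 := by
  simp only [PauliOp.mat, Matrix.smul_mul, Matrix.mul_smul, smul_smul, ← pow_add, ← two_mul]
  congr 1
  exact tens_inv_mul fun v => Letter.mat_mul_self _

theorem IsStabilizer.sq_eq_one (hg : IsStabilizer g) (k : Fin m) : (g k).mat * (g k).mat = 1 := by
  have h := mul_mem (mat_mem_generated k) (mat_mem_generated (g := g) k)
  rw [PauliOp.mat_mul_self] at h ⊢
  rw [hg.I_pow_eq_one _ h, one_smul]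

theorem IsStabilizer.even (hg : IsStabilizer g) (k : Fin m) :
    (((g k).phase : ℕ) : ZMod 2) = 0 := by
  have h := mul_mem (mat_mem_generated k) (mat_mem_generated (g := g) k)
  rw [PauliOp.mat_mul_self] at h
  have h1 := hg.I_pow_eq_one _ h
  rw [← pow_zero Complex.I] at h1
  have h2 := mod_eq_of_I_pow_eq h1
  rw [ZMod.natCast_eq_zero_iff]
  omega

theorem exists_pauli_of_list (l : List (Fin m)) : ∃ q : Pauli (Fin n),
    q.mat = (l.map fun k => (g k).mat).prod ∧ q.vec = (l.map fun k => (g k).toPauli.vec).sum := by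
  induction l with
  | nil =>
    refine ⟨⟨0, fun _ => .one⟩, ?_, ?_⟩
    · rw [Pauli.mat_of_vec_eq_zero]
      · simp
      · funext v; rfl
    · funext v; rfl
  | cons k l ih =>
    obtain ⟨q, h1, h2⟩ := ih
    exact ⟨(g k).toPauli.mul q, by simp [Pauli.mul_mat, PauliOp.toPauli_mat, h1],
      by simp [Pauli.mul_vec, h2]⟩

/-- A linear relation involving `g i` says that `g i` times the product of the other generators
involved has trivial letters. It is a scalar in the group, hence `1`, and as `g i` is its own
inverse it equals that product, against independence of the generators. -/
theorem IsStabilizer.linearIndependent (hg : IsStabilizer g) :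
    LinearIndependent (ZMod 2) fun k : Fin m => (g k).toPauli.vec := by
  rw [Fintype.linearIndependent_iff]
  intro a ha i
  by_contra hi
  -- The generators other than `g i` with nonzero coefficient; over `ZMod 2` the relation is the
  -- plain sum of their vectors and that of `g i`.
  set s : Finset (Fin m) := (Finset.univ.filter fun k => a k ≠ 0).erase i with hs
  obtain ⟨q, hq1, hq2⟩ := exists_pauli_of_list (g := g) s.toList
  have hsum : (g i).toPauli.vec + q.vec = 0 := by
    rw [hq2, Finset.sum_map_toList, hs,
      Finset.add_sum_erase _ (fun k => (g k).toPauli.vec)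
        (Finset.mem_filter.2 ⟨Finset.mem_univ i, hi⟩), Finset.sum_filter]
    refine Eq.trans ?_ ha
    refine Finset.sum_congr rfl fun k _ => ?_
    rcases zmod_two_eq_zero_or_one (a k) with h | h <;> simp [h]
  have hmem : q.mat ∈ generated (g '' {i}ᶜ) := by
    rw [hq1]
    refine list_prod_mem fun M hM => ?_
    obtain ⟨k, hk, rfl⟩ := List.mem_map.1 hM
    rw [Finset.mem_toList, hs, Finset.mem_erase] at hk
    exact Submonoid.subset_closure ⟨g k, ⟨k, hk.1, rfl⟩, rfl⟩
  have hmem' : q.mat ∈ generated (Set.range g) :=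
    Submonoid.closure_mono (Set.image_mono (Set.image_subset_range _ _)) hmem
  have hprod := mul_mem (mat_mem_generated (g := g) i) hmem'
  rw [← Pauli.mul_vec] at hsum
  have hmat := Pauli.mat_of_vec_eq_zero _ hsum
  rw [Pauli.mul_mat, PauliOp.toPauli_mat] at hmat
  have hp := hprod
  rw [hmat] at hprod
  rw [hg.I_pow_eq_one _ hprod, one_smul] at hmat
  have : q.mat = (g i).mat := by
    have h := congrArg (fun M => (g i).mat * M) hmat
    simpa [← Matrix.mul_assoc, hg.sq_eq_one i] using h
  exact hg.independent i (this ▸ hmem)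

theorem mem_codeSpace_iff (ψ : Qubits (Fin n)) :
    ψ ∈ codeSpace g ↔ ∀ k, (g k).mat *ᵥ ψ.ofLp = ψ.ofLp := by
  constructor
  · intro h k
    exact h _ (mat_mem_generated k)
  · intro h s hs
    refine Submonoid.closure_induction (motive := fun s _ => s *ᵥ ψ.ofLp = ψ.ofLp) ?_ ?_ ?_ hs
    · rintro _ ⟨_, ⟨k, rfl⟩, rfl⟩
      exact h k
    · simp
    · intro x y _ _ hx hy
      rw [← Matrix.mulVec_mulVec, hy, hx]

/-- The assignment of basis states with `a` at the reference system. -/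
def withRef (a : Fin 2) (x : Fin n → Fin 2) : Option (Fin n) → Fin 2 := fun o => o.elim a x

/-- The component of a vector that belongs to the basis state `a` of the reference system. -/
def slice (Φ : (Option (Fin n) → Fin 2) → ℂ) (a : Fin 2) : (Fin n → Fin 2) → ℂ :=
  fun x => Φ (withRef a x)

theorem withRef_eta (x : Option (Fin n) → Fin 2) : withRef (x none) (fun k => x (some k)) = x := by
  funext o
  cases o <;> rfl

/-- The letter at the reference system selects which component contributes and multiplies it by one
matrix entry. For the logical rows this converts a stabilizer equation of the entangled state into
the action of a logical operator on the components. -/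
theorem slice_withLetter_mulVec (p : PauliOp n) (l : Letter)
    (Φ : (Option (Fin n) → Fin 2) → ℂ) (a : Fin 2) :
    slice ((p.withLetter l).mat *ᵥ Φ) a =
      l.mat a (if l.xb = 1 then 1 - a else a) •
        (p.mat *ᵥ slice Φ (if l.xb = 1 then 1 - a else a)) := by
  funext x
  rw [slice, Pauli.mat_mulVec, ← PauliOp.toPauli_mat, Pi.smul_apply, Pauli.mat_mulVec, slice]
  have h : (p.withLetter l).flip (withRef a x) =
      withRef (if l.xb = 1 then 1 - a else a) (p.toPauli.flip x) := by
    funext o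
    cases o with
    | none => rfl
    | some k => rfl
  rw [h, Fintype.prod_option, smul_eq_mul]
  have h0 : ((p.withLetter l).letter none).mat (withRef a x none)
      (withRef (if l.xb = 1 then 1 - a else a) (p.toPauli.flip x) none) =
      l.mat a (if l.xb = 1 then 1 - a else a) := rfl
  have h1 : ∀ k, ((p.withLetter l).letter (some k)).mat (withRef a x (some k))
      (withRef (if l.xb = 1 then 1 - a else a) (p.toPauli.flip x) (some k)) =
      (p.toPauli.letter k).mat (x k) (p.toPauli.flip x k) := fun _ => rfl
  have h2 : (p.withLetter l).phase = p.toPauli.phase := rfl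
  simp only [h0, h1, h2]
  ring

theorem slice_extend_mulVec (p : PauliOp n) (Φ : (Option (Fin n) → Fin 2) → ℂ) (a : Fin 2) :
    slice (p.extend.mat *ᵥ Φ) a = p.mat *ᵥ slice Φ a := by
  have h := slice_withLetter_mulVec p .one Φ a
  rw [if_neg (by decide)] at h
  rw [PauliOp.extend, h]
  simp [Letter.mat]

/-- The rows given by the generators. -/
def genRows (g : Fin m → PauliOp n) : ℕ → Pauli (Option (Fin n)) := fun k =>
  if h : k < m then (g ⟨k, h⟩).extend else ⟨0, fun _ => .one⟩

/-- All components of the vector are in the code space. -/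
def InCode (g : Fin m → PauliOp n) (Φ : (Option (Fin n) → Fin 2) → ℂ) : Prop :=
  ∀ a k, (g k).mat *ᵥ slice Φ a = slice Φ a

theorem fixes_genRows_iff (Φ : (Option (Fin n) → Fin 2) → ℂ) :
    Fixes m (genRows g) Φ ↔ InCode g Φ := by
  constructor
  · intro h a k
    rw [← slice_extend_mulVec]
    have := h k k.2
    simp only [genRows, k.2, dif_pos] at this
    rw [this]
  · intro h k hk
    simp only [genRows, hk, dif_pos]
    funext x
    have := congrFun (h (x none) ⟨k, hk⟩) fun i => x (some i)
    rw [← slice_extend_mulVec] at this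
    simpa only [slice, withRef_eta] using this

theorem extend_om (p q : PauliOp n) : Pauli.om p.extend q.extend = Pauli.om p.toPauli q.toPauli := by
  unfold Pauli.om
  rw [Fintype.sum_option]
  exact zero_add _

theorem genRows_of_lt {k : ℕ} (hk : k < m) : genRows g k = (g ⟨k, hk⟩).extend := dif_pos hk

theorem IsStabilizer.isTableau (hg : IsStabilizer g) : IsTableau m (genRows g) where
  even := by
    intro k hk
    rw [genRows_of_lt hk]
    exact hg.even ⟨k, hk⟩
  om := by
    intro k hk l hl
    rw [genRows_of_lt hk, genRows_of_lt hl, extend_om]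
    refine Pauli.om_eq_zero_of_comm _ _ ?_
    rw [PauliOp.toPauli_mat, PauliOp.toPauli_mat]
    exact hg.comm ⟨k, hk⟩ ⟨l, hl⟩

theorem IsStabilizer.independent_genRows (hg : IsStabilizer g) : Independent m (genRows g) := by
  have h := hg.linearIndependent
  unfold Independent
  rw [Fintype.linearIndependent_iff] at h ⊢
  intro a ha
  refine h a ?_
  funext v
  have := congrFun ha (some v)
  rw [Finset.sum_apply] at this ⊢
  rw [Pi.zero_apply] at this ⊢
  rw [← this]
  refine Finset.sum_congr rfl fun k _ => ?_
  rw [genRows_of_lt k.2]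
  rfl

theorem IsStabilizer.reduced (hg : IsStabilizer g) :
    Reduced m 0 none (InCode g) (genRows g) (fun _ => 0) (fun _ => 0) where
  tableau := hg.isTableau
  independent := hg.independent_genRows
  pivots := ⟨fun _ => le_rfl, by simp, by simp, by simp⟩
  had_le := by simp
  had_eq := by simp
  untouched := by
    intro k hk
    rw [genRows_of_lt hk]
    rfl
  trivial := by
    intro k hk
    simp [genRows, Nat.not_lt.2 hk]
  fixes := by
    intro φ
    rw [show hadOps (fun _ : Option (Fin n) => 0) = 1 by simp [hadOps, tens_one],
      Matrix.one_mulVec, fixes_genRows_iff]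

end Stabilizer

end

section

/-! ### The rows of the logical operators -/

section Logical

variable {n : ℕ} {τ : ℕ → Pauli (Option (Fin n))} {pr : Option (Fin n) → ℕ}

theorem Pivots.none_eq_zero {m i : ℕ} (hP : Pivots m i τ pr) (hi : i ≤ m)
    (he : ∀ k < m, (τ k).letter none = .one) : pr none = 0 := by
  by_contra h
  obtain ⟨k, hk⟩ := Nat.exists_eq_succ_of_ne_zero h
  have hki := hP.le none
  have := hP.xb none k hk k (by omega)
  rw [he k (by omega)] at this
  simp [Letter.xb] at this

/-- There are `n - 1` pivots in distinct columns, none of them at the reference system, so one of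
the `n` parties is left. -/
theorem Pivots.exists_free {m : ℕ} (hP : Pivots m (n - 1) τ pr) (hn : 0 < n) (h0 : pr none = 0) :
    ∃ q : Fin n, pr (some q) = 0 ∧ ∀ v, pr (some v) = 0 → v = q := by
  have hcard : (Finset.univ.filter fun v : Fin n => pr (some v) ≠ 0).card = n - 1 := by
    rw [← Finset.card_range (n - 1)]
    refine Finset.card_bij (fun v _ => pr (some v) - 1) ?_ ?_ ?_
    · intro v hv
      have := hP.le (some v)
      simp only [Finset.mem_filter, Finset.mem_univ, true_and] at hv
      rw [Finset.mem_range]; omega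
    · intro v hv w hw h
      simp only [Finset.mem_filter, Finset.mem_univ, true_and] at hv hw
      exact Option.some_injective _ (hP.inj _ _ (by omega) hv)
    · intro k hk
      obtain ⟨v, hv⟩ := hP.surj k (Finset.mem_range.1 hk)
      cases v with
      | none => omega
      | some v => exact ⟨v, by simp [hv], by simp [hv]⟩
  have hc := Finset.card_filter_add_card_filter_not (s := (Finset.univ : Finset (Fin n)))
    (fun v : Fin n => pr (some v) ≠ 0)
  rw [hcard, Finset.card_univ, Fintype.card_fin] at hc
  obtain ⟨q, hq⟩ := Finset.card_eq_one.1 (show (Finset.univ.filter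
    fun v : Fin n => ¬ pr (some v) ≠ 0).card = 1 by omega)
  have hmem : ∀ v, v ∈ (Finset.univ.filter fun v : Fin n => ¬ pr (some v) ≠ 0) ↔
      pr (some v) = 0 := by simp
  refine ⟨q, (hmem q).1 (by rw [hq]; simp), fun v hv => ?_⟩
  have := (hmem v).2 hv
  rw [hq] at this
  simpa using this

/-- The row of the logical operator `Z`, with the letter `Z` at the reference system. -/
def zRow (τ : ℕ → Pauli (Option (Fin n))) (pr : Option (Fin n) → ℕ) (q : Fin n) :
    Pauli (Option (Fin n)) where
  phase := 0
  letter := fun o => o.elim .z fun v =>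
    if pr (some v) = 0 then .x else
      if ((τ (pr (some v) - 1)).letter (some q)).zb = 1 then .z else .one

/-- The row of the logical operator `X`, with the letter `X` at the reference system. -/
def xRow (τ : ℕ → Pauli (Option (Fin n))) (pr : Option (Fin n) → ℕ) (q : Fin n) :
    Pauli (Option (Fin n)) where
  phase := 0
  letter := fun o => o.elim .x fun v =>
    if pr (some v) = 0 then .z else
      if ((τ (pr (some v) - 1)).letter (some q)).xb = 1 then .z else .one

/-- The rows of the generators, followed by those of the logical operators. -/
def logicalRows (τ : ℕ → Pauli (Option (Fin n))) (pr : Option (Fin n) → ℕ) (q : Fin n) :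
    ℕ → Pauli (Option (Fin n)) := fun k =>
  if k = n - 1 then zRow τ pr q else if k = n then xRow τ pr q else τ k

theorem ite_zb (a : ZMod 2) : (if a = 1 then Letter.z else Letter.one).zb = a := by
  revert a; decide

theorem ite_xb (a : ZMod 2) : (if a = 1 then Letter.z else Letter.one).xb = 0 := by
  revert a; decide

variable {q : Fin n}

/-- Row `k` can anticommute with the logical row in two places only: in the free column, where the
logical row has `X`, and in the pivot column of row `k`, where the letter of the logical row copies
the `Z` bit of row `k` at the free column. The two contributions are equal and cancel. -/
theorem om_zRow (hP : Pivots (n - 1) (n - 1) τ pr) (he : ∀ k < n - 1, (τ k).letter none = .one)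
    (hq : pr (some q) = 0) (hq' : ∀ v, pr (some v) = 0 → v = q) {k : ℕ} (hk : k < n - 1) :
    Pauli.om (τ k) (zRow τ pr q) = 0 := by
  obtain ⟨v, hv⟩ := hP.surj k hk
  have h : ∀ w, ((τ k).letter w).om ((zRow τ pr q).letter w) =
      (if w = some q then ((τ k).letter (some q)).zb else 0) +
        if w = v then ((τ k).letter (some q)).zb else 0 := by
    intro w
    have h0 := hP.none_eq_zero le_rfl he
    cases w with
    | none =>
      have : none ≠ v := by rintro rfl; omega
      simp [he k hk, zRow, Letter.om, Letter.xb, Letter.zb, this]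
    | some w =>
      by_cases hw : pr (some w) = 0
      · have hwq := hq' w hw
        subst hwq
        have : some w ≠ v := by rintro rfl; omega
        simp [zRow, hq, Letter.om, Letter.xb, Letter.zb, this]
      · obtain ⟨l, hl⟩ := Nat.exists_eq_succ_of_ne_zero hw
        have hwq : w ≠ q := by rintro rfl; omega
        simp only [zRow, Option.elim, hw, if_false, Letter.om, ite_zb, ite_xb, hP.xb _ l hl k hk,
          mul_zero, add_zero, Option.some.injEq, hwq, zero_add]
        rw [hl, Nat.succ_sub_one]
        by_cases hwv : some w = v
        · subst hwv
          have : k = l := by omega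
          simp [this]
        · have : k ≠ l := by
            rintro rfl
            exact hwv (hP.inj _ _ (by omega) (by omega))
          simp [this, hwv]
  simp only [Pauli.om, h, Finset.sum_add_distrib, Finset.sum_ite_eq', Finset.mem_univ, if_true]
  exact CharTwo.add_self_eq_zero _

/-- The same cancellation, now with the flip of row `k` at the free column, where the logical row
has `Z`. -/
theorem om_xRow (hP : Pivots (n - 1) (n - 1) τ pr) (he : ∀ k < n - 1, (τ k).letter none = .one)
    (hq : pr (some q) = 0) (hq' : ∀ v, pr (some v) = 0 → v = q) {k : ℕ} (hk : k < n - 1) :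
    Pauli.om (τ k) (xRow τ pr q) = 0 := by
  obtain ⟨v, hv⟩ := hP.surj k hk
  have h : ∀ w, ((τ k).letter w).om ((xRow τ pr q).letter w) =
      (if w = some q then ((τ k).letter (some q)).xb else 0) +
        if w = v then ((τ k).letter (some q)).xb else 0 := by
    intro w
    have h0 := hP.none_eq_zero le_rfl he
    cases w with
    | none =>
      have : none ≠ v := by rintro rfl; omega
      simp [he k hk, xRow, Letter.om, Letter.xb, Letter.zb, this]
    | some w =>
      by_cases hw : pr (some w) = 0
      · have hwq := hq' w hw
        subst hwq
        have : some w ≠ v := by rintro rfl; omega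
        simp [xRow, hq, Letter.om, Letter.xb, Letter.zb, this]
      · obtain ⟨l, hl⟩ := Nat.exists_eq_succ_of_ne_zero hw
        have hwq : w ≠ q := by rintro rfl; omega
        simp only [xRow, Option.elim, hw, if_false, Letter.om, ite_zb, ite_xb, hP.xb _ l hl k hk,
          mul_zero, add_zero, Option.some.injEq, hwq, zero_add]
        rw [hl, Nat.succ_sub_one]
        by_cases hwv : some w = v
        · subst hwv
          have : k = l := by omega
          simp [this]
        · have : k ≠ l := by
            rintro rfl
            exact hwv (hP.inj _ _ (by omega) (by omega))
          simp [this, hwv]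
  simp only [Pauli.om, h, Finset.sum_add_distrib, Finset.sum_ite_eq', Finset.mem_univ, if_true]
  exact CharTwo.add_self_eq_zero _

/-- The two rows anticommute at the free qubit and once more at the reference system. On the parties
alone they anticommute, as logical `Z` and `X` must. -/
theorem om_zRow_xRow (hq : pr (some q) = 0) (hq' : ∀ v, pr (some v) = 0 → v = q) :
    Pauli.om (zRow τ pr q) (xRow τ pr q) = 0 := by
  have h : ∀ w, ((zRow τ pr q).letter w).om ((xRow τ pr q).letter w) =
      (if w = some q then 1 else 0) + if w = none then 1 else 0 := by
    intro w
    cases w with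
    | none => simp [zRow, xRow, Letter.om, Letter.xb, Letter.zb]
    | some w =>
      by_cases hw : pr (some w) = 0
      · have hwq := hq' w hw
        subst hwq
        simp [zRow, xRow, hq, Letter.om, Letter.xb, Letter.zb]
      · have hwq : w ≠ q := by rintro rfl; omega
        simp only [zRow, xRow, Option.elim, hw, if_false, Letter.om, ite_xb]
        simp [hwq]
  simp only [Pauli.om, h, Finset.sum_add_distrib, Finset.sum_ite_eq', Finset.mem_univ, if_true]
  exact CharTwo.add_self_eq_zero _

theorem logicalRows_of_lt {k : ℕ} (hk : k < n - 1) : logicalRows τ pr q k = τ k := by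
  simp [logicalRows, show k ≠ n - 1 by omega, show k ≠ n by omega]

theorem logicalRows_cases (hn : 0 < n) {k : ℕ} (hk : k < n + 1) :
    (k < n - 1 ∧ logicalRows τ pr q k = τ k) ∨ (k = n - 1 ∧ logicalRows τ pr q k = zRow τ pr q) ∨
      (k = n ∧ logicalRows τ pr q k = xRow τ pr q) := by
  rcases lt_trichotomy k (n - 1) with h | h | h
  · exact Or.inl ⟨h, logicalRows_of_lt h⟩
  · exact Or.inr (Or.inl ⟨h, by simp [logicalRows, h]⟩)
  · have : k = n := by omega
    refine Or.inr (Or.inr ⟨this, ?_⟩)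
    simp only [logicalRows]
    rw [if_neg (by omega), if_pos this]

theorem logicalRows_isTableau (hn : 0 < n) (hT : IsTableau (n - 1) τ)
    (hP : Pivots (n - 1) (n - 1) τ pr) (he : ∀ k < n - 1, (τ k).letter none = .one)
    (hq : pr (some q) = 0) (hq' : ∀ v, pr (some v) = 0 → v = q) :
    IsTableau (n + 1) (logicalRows τ pr q) where
  even k hk := by
    rcases logicalRows_cases (τ := τ) (pr := pr) (q := q) hn hk with ⟨h, e⟩ | ⟨-, e⟩ | ⟨-, e⟩ <;>
      rw [e]
    · exact hT.even k h
    · simp [zRow]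
    · simp [xRow]
  om k hk l hl := by
    rcases logicalRows_cases (τ := τ) (pr := pr) (q := q) hn hk with ⟨h, e⟩ | ⟨-, e⟩ | ⟨-, e⟩ <;>
    rcases logicalRows_cases (τ := τ) (pr := pr) (q := q) hn hl with ⟨h', e'⟩ | ⟨-, e'⟩ | ⟨-, e'⟩ <;>
      rw [e, e']
    · exact hT.om k h l h'
    · exact om_zRow hP he hq hq' h
    · exact om_xRow hP he hq hq' h
    · rw [Pauli.om_comm]; exact om_zRow hP he hq hq' h'
    · exact Pauli.om_self _
    · exact om_zRow_xRow hq hq'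
    · rw [Pauli.om_comm]; exact om_xRow hP he hq hq' h'
    · rw [Pauli.om_comm]; exact om_zRow_xRow hq hq'
    · exact Pauli.om_self _

/-- In the pivot columns the logical rows have only `Z` and the identity, so the existing pivots
stay valid. -/
theorem logicalRows_pivots (hn : 0 < n) (hP : Pivots (n - 1) (n - 1) τ pr)
    (he : ∀ k < n - 1, (τ k).letter none = .one) :
    Pivots (n + 1) (n - 1) (logicalRows τ pr q) pr := by
  refine ⟨hP.le, hP.surj, hP.inj, fun v k hk l hl => ?_⟩
  have h0 := hP.none_eq_zero le_rfl he
  have hle := hP.le v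
  cases v with
  | none => omega
  | some v =>
    rcases logicalRows_cases (τ := τ) (pr := pr) (q := q) hn hl with ⟨h, e⟩ | ⟨h, e⟩ | ⟨h, e⟩ <;>
      rw [e]
    · exact hP.xb _ k hk l h
    · simp [zRow, hk, ite_xb, show l ≠ k by omega]
    · simp [xRow, hk, ite_xb, show l ≠ k by omega]

/-- The final rows and pivots. -/
theorem finalRows_pivots (hn : 0 < n) (hP : Pivots (n - 1) (n - 1) τ pr)
    (he : ∀ k < n - 1, (τ k).letter none = .one) (hq : pr (some q) = 0) :
    Pivots (n + 1) (n + 1) (elim (logicalRows τ pr q) (n - 1) (some q))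
      (Function.update (Function.update pr (some q) n) none (n + 1)) := by
  -- The `Z` row, row `n - 1`, flips the free qubit and takes its pivot there. It has no flip at the
  -- reference system, so afterwards the `X` row, row `n`, is still the only one with a flip there
  -- and needs no elimination.
  have h1 := (logicalRows_pivots (q := q) hn hP he).elim (c := some q) (by omega) hq
    (by simp [logicalRows, zRow, hq, Letter.xb])
  rw [Nat.sub_add_cancel hn] at h1
  refine h1.insert ?_ ?_
  · simp [hP.none_eq_zero le_rfl he]
  · intro l hl
    have hz : (logicalRows τ pr q (n - 1)) = zRow τ pr q := by simp [logicalRows]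
    have hz' : ((zRow τ pr q).letter none).xb = 0 := rfl
    rw [elim_xb, hz, hz', ite_self, add_zero]
    rcases logicalRows_cases (τ := τ) (pr := pr) (q := q) hn hl with ⟨h, e⟩ | ⟨h, e⟩ | ⟨h, e⟩ <;>
      rw [e]
    · simp [he l h, Letter.xb, show l ≠ n by omega]
    · simp [hz', show l ≠ n by omega]
    · simp [xRow, Letter.xb, h]

end Logical

/-! ### Graph states -/

section Graph

variable {V : Type} [Fintype V] [DecidableEq V]

open Classical in
/-- The product of the signs of the edges. -/
def edgeSign (G : SimpleGraph V) (x : V → Fin 2) : ℂ :=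
  ∏ e ∈ G.edgeFinset, if ∀ v ∈ e, x v = 1 then (-1 : ℂ) else 1

theorem graphState_eq (G : SimpleGraph V) (x : V → Fin 2) :
    graphState G x = (((Real.sqrt 2 : ℝ) : ℂ)⁻¹) ^ Fintype.card V * edgeSign G x := by
  unfold graphState edgeSign
  congr!

open Classical in
/-- The product of the signs of the edges at `p` when `p` is in the state `1`. -/
def starSign (G : SimpleGraph V) (p : V) (x : V → Fin 2) : ℂ :=
  ∏ u, if G.Adj p u ∧ x u = 1 then (-1 : ℂ) else 1

-- The edges at `p` correspond to the neighbours of `p` and give a sign only if `p` is in the state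
-- `1`.
open Classical in
theorem edgeSign_eq (G : SimpleGraph V) (p : V) (x : V → Fin 2) :
    edgeSign G x = (if x p = 1 then starSign G p x else 1) *
      ∏ e ∈ G.edgeFinset.filter fun e => p ∉ e, if ∀ v ∈ e, x v = 1 then (-1 : ℂ) else 1 := by
  rw [edgeSign, ← Finset.prod_filter_mul_prod_filter_not G.edgeFinset fun e => p ∈ e]
  congr 1
  have h : (G.edgeFinset.filter fun e => p ∈ e) =
      (Finset.univ.filter fun u => G.Adj p u).image fun u => s(p, u) := by
    ext e
    induction e with
    | h a b =>
      simp only [Finset.mem_filter, SimpleGraph.mem_edgeFinset, SimpleGraph.mem_edgeSet,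
        Sym2.mem_iff, Finset.mem_image, Finset.mem_univ, true_and, Sym2.eq_iff]
      constructor
      · rintro ⟨h, rfl | rfl⟩
        · exact ⟨b, h, Or.inl ⟨rfl, rfl⟩⟩
        · exact ⟨a, h.symm, Or.inr ⟨rfl, rfl⟩⟩
      · rintro ⟨u, h, ⟨rfl, rfl⟩ | ⟨rfl, rfl⟩⟩
        · exact ⟨h, Or.inl rfl⟩
        · exact ⟨h.symm, Or.inr rfl⟩
  rw [h, Finset.prod_image (by
    intro a _ b _ hab
    exact Sym2.congr_right.1 hab)]
  by_cases hx : x p = 1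
  · simp only [hx, if_true, starSign, Finset.prod_filter]
    refine Finset.prod_congr rfl fun u _ => ?_
    by_cases hu : G.Adj p u <;> simp [hu, hx]
  · rw [if_neg hx]
    exact Finset.prod_eq_one fun u _ => if_neg fun h => hx (h p (Sym2.mem_mk_left _ _))

theorem starSign_update (G : SimpleGraph V) (p : V) (x : V → Fin 2) (b : Fin 2) :
    starSign G p (Function.update x p b) = starSign G p x := by
  refine Finset.prod_congr rfl fun u _ => ?_
  by_cases hu : u = p
  · subst hu
    rw [if_neg fun h => G.irrefl h.1, if_neg fun h => G.irrefl h.1]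
  · rw [Function.update_of_ne hu]

theorem starSign_mul_self (G : SimpleGraph V) (p : V) (x : V → Fin 2) :
    starSign G p x * starSign G p x = 1 := by
  rw [starSign, ← Finset.prod_mul_distrib]
  refine Finset.prod_eq_one fun u _ => ?_
  split_ifs <;> simp

theorem edgeSign_update_one (G : SimpleGraph V) (p : V) (x : V → Fin 2) :
    edgeSign G (Function.update x p 1) = starSign G p x * edgeSign G (Function.update x p 0) := by
  classical
  rw [edgeSign_eq G p, edgeSign_eq G p (Function.update x p 0), starSign_update]
  simp only [Function.update_self, if_true, zero_ne_one, if_false, one_mul]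
  congr 1
  refine Finset.prod_congr rfl fun e he => ?_
  have hp := (Finset.mem_filter.1 he).2
  have : ∀ b, (∀ v ∈ e, Function.update x p b v = 1) ↔ ∀ v ∈ e, x v = 1 := by
    intro b
    refine forall₂_congr fun v hv => ?_
    have : v ≠ p := by rintro rfl; exact hp hv
    simp [this]
  simp only [this]

/-- The phase gates `S ^ a v`, inverted, applied to a graph state. -/
def phasedGraphState (G : SimpleGraph V) (a : V → ℕ) (x : V → Fin 2) : ℂ :=
  (∏ v, if x v = 1 then (Complex.I ^ a v)⁻¹ else 1) * graphState G x

/-- This ratio of amplitudes is all that the stabilizer equations in `row_fixes` require. -/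
theorem phasedGraphState_update_one (G : SimpleGraph V) (a : V → ℕ) (p : V) (x : V → Fin 2) :
    phasedGraphState G a (Function.update x p 1) =
      (Complex.I ^ a p)⁻¹ * starSign G p x * phasedGraphState G a (Function.update x p 0) := by
  have h : ∀ b : Fin 2, (∏ v, if Function.update x p b v = 1 then (Complex.I ^ a v)⁻¹ else 1) =
      (if b = 1 then (Complex.I ^ a p)⁻¹ else 1) *
        ∏ v ∈ Finset.univ.erase p, if x v = 1 then (Complex.I ^ a v)⁻¹ else 1 := by
    intro b
    rw [← Finset.mul_prod_erase _ _ (Finset.mem_univ p)]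
    simp only [Function.update_self]
    congr 1
    refine Finset.prod_congr rfl fun v hv => ?_
    rw [Function.update_of_ne (Finset.ne_of_mem_erase hv)]
  simp only [phasedGraphState, h, graphState_eq, edgeSign_update_one]
  simp only [if_true, zero_ne_one, if_false]
  ring

/-- The graph described by rows with pivots at their own vertices. -/
def rowGraph (r : V → Pauli V) (hom : ∀ u v, Pauli.om (r u) (r v) = 0)
    (hxb : ∀ u v, ((r u).letter v).xb = if u = v then 1 else 0) : SimpleGraph V where
  Adj u v := u ≠ v ∧ ((r u).letter v).zb = 1
  symm := ⟨by
    intro u v ⟨huv, h⟩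
    refine ⟨huv.symm, ?_⟩
    -- Each row flips only its own vertex, so commutation compares the `Z` bit of row `u` at `v`
    -- with that of row `v` at `u`.
    have h1 := hom u v
    simp only [Pauli.om, Letter.om, hxb, ite_mul, mul_ite, one_mul, zero_mul, mul_one, mul_zero,
      Finset.sum_add_distrib, Finset.sum_ite_eq, Finset.mem_univ, if_true, h] at h1
    rcases zmod_two_eq_zero_or_one ((r v).letter u).zb with h2 | h2
    · rw [h2] at h1; exact absurd h1 (by decide)
    · exact h2⟩
  loopless := ⟨fun u h => h.1 rfl⟩

/-- The exponent of the phase gate that turns the row at `v` into one of a graph state. -/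
def rowExponent (p : Pauli V) (v : V) : ℕ := p.phase + if p.letter v = .y then 3 else 0

/-- Row `p` flips only `p` and has `Z` at exactly the neighbours of `p`, so it is the stabilizer
`X_p ∏ Z_u` of the graph state, conjugated by phase gates that absorb its phase and a possible
letter `Y` at `p`. Evenness of the phase makes the flip from `1` to `0` agree with the one from `0`
to `1`. -/
theorem row_fixes (r : V → Pauli V) (hom : ∀ u v, Pauli.om (r u) (r v) = 0)
    (hxb : ∀ u v, ((r u).letter v).xb = if u = v then 1 else 0)
    (heven : ∀ v, ((r v).phase : ZMod 2) = 0) (p : V) :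
    (r p).mat *ᵥ phasedGraphState (rowGraph r hom hxb) (fun v => rowExponent (r v) v) =
      phasedGraphState (rowGraph r hom hxb) fun v => rowExponent (r v) v := by
  classical
  set G := rowGraph r hom hxb
  set a : V → ℕ := fun v => rowExponent (r v) v
  funext x
  have hflip : (r p).flip x = Function.update x p (1 - x p) := by
    funext v
    by_cases hv : v = p
    · subst hv; simp [Pauli.flip, hxb]
    · simp [Pauli.flip, hxb, hv, Ne.symm hv]
  have hamp : ∏ v, ((r p).letter v).mat (x v) ((r p).flip x v) =
      ((r p).letter p).mat (x p) (1 - x p) * starSign G p x := by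
    rw [hflip, ← Finset.mul_prod_erase _ _ (Finset.mem_univ p), starSign,
      ← Finset.mul_prod_erase Finset.univ (fun u => if G.Adj p u ∧ x u = 1 then (-1 : ℂ) else 1)
        (Finset.mem_univ p)]
    simp only [Function.update_self, SimpleGraph.irrefl, false_and, if_false, one_mul]
    congr 1
    refine Finset.prod_congr rfl fun v hv => ?_
    have hvp := Finset.ne_of_mem_erase hv
    rw [Function.update_of_ne hvp]
    have hadj : G.Adj p v ↔ ((r p).letter v).zb = 1 :=
      ⟨fun h => h.2, fun h => ⟨hvp.symm, h⟩⟩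
    have hx0 := hxb p v
    rw [if_neg hvp.symm] at hx0
    simp only [hadj]
    revert hx0
    generalize (r p).letter v = l
    generalize x v = b
    cases l <;> fin_cases b <;> simp [Letter.mat, Letter.xb, Letter.zb]
  have hx : x = Function.update x p (x p) := by simp
  have hI : Complex.I ^ (2 * (r p).phase) = 1 := by
    have h := heven p
    rw [ZMod.natCast_eq_zero_iff] at h
    obtain ⟨c, hc⟩ := h
    rw [hc, ← mul_assoc, pow_mul, show 2 * 2 = 4 by norm_num, Complex.I_pow_four, one_pow]
  have hI0 : Complex.I ^ (r p).phase ≠ 0 := pow_ne_zero _ Complex.I_ne_zero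
  -- For the letter `Y` the entry is `-i = i ^ 3`, the origin of the summand `3` in `rowExponent`.
  have h0 : Complex.I ^ (r p).phase * ((r p).letter p).mat 0 1 * (Complex.I ^ a p)⁻¹ = 1 := by
    have hxp := hxb p p
    rw [if_pos rfl] at hxp
    simp only [a, rowExponent]
    revert hxp
    cases (r p).letter p
    · simp [Letter.xb]
    · simp [Letter.mat, hI0]
    · intro _
      simp only [Letter.mat, if_true, pow_add, Complex.I_pow_three, mul_inv, Matrix.of_apply,
        Matrix.cons_val', Matrix.cons_val_zero, Matrix.cons_val_one, Matrix.cons_val_fin_one,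
        inv_neg, Complex.inv_I]
      linear_combination (-Complex.I ^ 2) * mul_inv_cancel₀ hI0 - Complex.I_sq
    · simp [Letter.xb]
  have h1 : Complex.I ^ (r p).phase * ((r p).letter p).mat 1 0 = (Complex.I ^ a p)⁻¹ := by
    have hxp := hxb p p
    rw [if_pos rfl] at hxp
    rw [two_mul, pow_add] at hI
    simp only [a, rowExponent]
    refine eq_inv_of_mul_eq_one_left ?_
    revert hxp
    cases (r p).letter p
    · simp [Letter.xb]
    · simp [Letter.mat, hI]
    · intro _
      simp only [Letter.mat, if_true, pow_add, Complex.I_pow_three]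
      simp only [Matrix.of_apply, Matrix.cons_val', Matrix.cons_val_zero, Matrix.cons_val_one,
        Matrix.cons_val_fin_one]
      linear_combination (-Complex.I ^ 2) * hI - Complex.I_sq
    · simp [Letter.xb]
  rw [Pauli.mat_mulVec, hamp, hflip]
  conv_rhs => rw [hx]
  have hb : x p = 0 ∨ x p = 1 := by
    generalize x p = b
    fin_cases b <;> simp
  rcases hb with hb | hb
  · rw [hb, show (1 - 0 : Fin 2) = 1 from rfl, phasedGraphState_update_one]
    linear_combination (starSign G p x * starSign G p x *
      phasedGraphState G a (Function.update x p 0)) * h0 +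
      phasedGraphState G a (Function.update x p 0) * starSign_mul_self G p x
  · rw [hb, show (1 - 1 : Fin 2) = 0 from rfl, phasedGraphState_update_one]
    linear_combination (starSign G p x * phasedGraphState G a (Function.update x p 0)) * h1

end Graph

end

section

/-! ### The logical basis belonging to a reduced tableau -/

section General

variable {V : Type} [Fintype V] [DecidableEq V]

/-- Conjugation by Hadamard gates of a Pauli operator without letters `Y`. -/
def Pauli.hads (h : V → ℕ) (p : Pauli V) : Pauli V where
  phase := p.phase
  letter := fun v => if h v = 1 then (p.letter v).swap else p.letter v

/-- Without letters `Y` the conjugation produces no sign, so the phase stays. The logical rows are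
of this kind. -/
theorem hadOps_mul_mat (h : V → ℕ) (p : Pauli V) (hy : ∀ v, p.letter v ≠ .y) :
    hadOps h * p.mat = (p.hads h).mat * hadOps h := by
  simp only [hadOps, Pauli.mat, Pauli.hads, Matrix.mul_smul, Matrix.smul_mul, tens_mul]
  congr 2
  funext v
  split_ifs
  · have := Letter.hadamard_conj (p.letter v)
    rwa [if_neg (hy v), pow_zero, one_smul] at this
  · simp

theorem star_mulVec_dotProduct {ι : Type} [Fintype ι] [DecidableEq ι] {M : Matrix ι ι ℂ}
    (hM : Mᴴ * M = 1) (u v : ι → ℂ) : star (M *ᵥ u) ⬝ᵥ (M *ᵥ v) = star u ⬝ᵥ v := by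
  rw [Matrix.star_mulVec, Matrix.dotProduct_mulVec, Matrix.vecMul_vecMul, hM, Matrix.vecMul_one]

theorem tens_unitary {d : Type} [Fintype d] [DecidableEq d] {M : V → Matrix d d ℂ}
    (h : ∀ v, (M v)ᴴ * M v = 1) : (tens M)ᴴ * tens M = 1 := by
  rw [tens_conjTranspose]
  exact tens_inv_mul h

theorem hadOps_unitary (h : V → ℕ) : (hadOps h)ᴴ * hadOps h = 1 := by
  refine tens_unitary fun v => ?_
  split_ifs
  · exact Gate.mat_unitary .h
  · simp

theorem Pauli.mat_unitary (p : Pauli V) : p.matᴴ * p.mat = 1 := by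
  rw [Pauli.mat, Matrix.conjTranspose_smul, Matrix.smul_mul, Matrix.mul_smul, smul_smul,
    tens_unitary fun v => by rw [Letter.mat_conjTranspose, Letter.mat_mul_self], star_pow,
    ← mul_pow]
  simp

/-- A vector fixed by rows with pivots vanishes if it vanishes off the pivots. -/
theorem Pivots.eq_zero_of_fixes {m : ℕ} {τ : ℕ → Pauli V} {pr : V → ℕ} (hP : Pivots m m τ pr)
    {χ : (V → Fin 2) → ℂ} (hχ : Fixes m τ χ)
    (h0 : ∀ x, (∀ v, pr v ≠ 0 → x v = 0) → χ x = 0) (x : V → Fin 2) : χ x = 0 := by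
  induction hk : (Finset.univ.filter fun v => pr v ≠ 0 ∧ x v ≠ 0).card using Nat.strong_induction_on
    generalizing x with
  | _ k ih =>
    by_cases hx : ∀ v, pr v ≠ 0 → x v = 0
    · exact h0 x hx
    · push Not at hx
      obtain ⟨v, hv, hxv⟩ := hx
      -- The row with pivot `v` relates the amplitude at `x` to the one at an assignment with `v`
      -- reset to `0` and no other pivot coordinate changed. The number of nonzero pivot coordinates
      -- drops.
      obtain ⟨l, hl⟩ := Nat.exists_eq_succ_of_ne_zero hv
      have hlm : l < m := by have := hP.le v; omega
      rw [← hχ l hlm, Pauli.mat_mulVec]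
      have hf : ∀ w, pr w ≠ 0 → (τ l).flip x w = if w = v then 0 else x w := by
        intro w hw
        obtain ⟨l', hl'⟩ := Nat.exists_eq_succ_of_ne_zero hw
        by_cases hwv : w = v
        · subst hwv
          simp only [Pauli.flip, hP.xb _ l hl l hlm, if_true]
          revert hxv
          generalize x w = b
          fin_cases b <;> simp
        · have : l ≠ l' := by
            rintro rfl
            exact hwv (hP.inj _ _ (by omega) (by omega))
          simp [Pauli.flip, hP.xb _ l' hl' l hlm, this, hwv]
      rw [ih _ ?_ ((τ l).flip x) rfl, mul_zero]
      rw [← hk]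
      refine Finset.card_lt_card ?_
      rw [Finset.ssubset_iff_of_subset]
      · refine ⟨v, by simp [hv, hxv], ?_⟩
        simp [hf v hv]
      · intro w hw
        simp only [Finset.mem_filter, Finset.mem_univ, true_and] at hw ⊢
        refine ⟨hw.1, ?_⟩
        have := hw.2
        rw [hf w hw.1] at this
        by_cases hwv : w = v
        · simp [hwv] at this
        · simpa [hwv] using this

end General

section Final

variable {n : ℕ} {g : Fin (n - 1) → PauliOp n} {τ : ℕ → Pauli (Option (Fin n))}
  {pr h : Option (Fin n) → ℕ} {q : Fin n}

/-- The final row with pivot `v`. -/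
def finalRow (τ : ℕ → Pauli (Option (Fin n))) (pr : Option (Fin n) → ℕ) (q : Fin n)
    (v : Option (Fin n)) : Pauli (Option (Fin n)) :=
  elim (logicalRows τ pr q) (n - 1) (some q)
    (Function.update (Function.update pr (some q) n) none (n + 1) v - 1)

/-- The outcome of the elimination: its rows and the column `q` without pivot. -/
structure Eliminated (g : Fin (n - 1) → PauliOp n) (τ : ℕ → Pauli (Option (Fin n)))
    (pr h : Option (Fin n) → ℕ) (q : Fin n) : Prop where
  pos : 0 < n
  red : Reduced (n - 1) (n - 1) none (InCode g) τ pr h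
  free : pr (some q) = 0
  unique : ∀ v, pr (some v) = 0 → v = q

theorem Eliminated.pivots (H : Eliminated g τ pr h q) :
    Pivots (n + 1) (n + 1) (elim (logicalRows τ pr q) (n - 1) (some q))
      (Function.update (Function.update pr (some q) n) none (n + 1)) :=
  finalRows_pivots H.pos H.red.pivots H.red.untouched H.free

theorem Eliminated.none_eq (H : Eliminated g τ pr h q) : pr none = 0 :=
  H.red.pivots.none_eq_zero le_rfl H.red.untouched

theorem Eliminated.pivot_ne_zero (H : Eliminated g τ pr h q) (v : Option (Fin n)) :
    Function.update (Function.update pr (some q) n) none (n + 1) v ≠ 0 := by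
  cases v with
  | none => simp
  | some v =>
    rw [Function.update_of_ne (by simp)]
    by_cases hv : v = q
    · subst hv
      simpa using H.pos.ne'
    · rw [Function.update_of_ne (by simpa using hv)]
      exact fun h0 => hv (H.unique v h0)

theorem Eliminated.isTableau (H : Eliminated g τ pr h q) :
    IsTableau (n + 1) (elim (logicalRows τ pr q) (n - 1) (some q)) :=
  (logicalRows_isTableau H.pos H.red.tableau H.red.pivots H.red.untouched H.free H.unique).elim
    (by omega)

theorem Eliminated.index_lt (H : Eliminated g τ pr h q) (v : Option (Fin n)) :
    Function.update (Function.update pr (some q) n) none (n + 1) v - 1 < n + 1 := by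
  have := H.pivots.le v
  omega

theorem Eliminated.om (H : Eliminated g τ pr h q) (u v : Option (Fin n)) :
    Pauli.om (finalRow τ pr q u) (finalRow τ pr q v) = 0 :=
  H.isTableau.om _ (H.index_lt u) _ (H.index_lt v)

/-- Every vertex now has a pivot. With the rows indexed by their pivot vertices, the flips form the
identity matrix, as for the stabilizers of a graph state. -/
theorem Eliminated.xb (H : Eliminated g τ pr h q) (u v : Option (Fin n)) :
    ((finalRow τ pr q u).letter v).xb = if u = v then 1 else 0 := by
  obtain ⟨k, hk⟩ := Nat.exists_eq_succ_of_ne_zero (H.pivot_ne_zero v)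
  rw [finalRow, H.pivots.xb v k hk _ (H.index_lt u)]
  have hu := H.pivot_ne_zero u
  by_cases huv : u = v
  · subst huv
    simp [hk]
  · rw [if_neg huv, if_neg]
    intro h'
    exact huv (H.pivots.inj _ _ (by omega) hu)

theorem Eliminated.even (H : Eliminated g τ pr h q) (v : Option (Fin n)) :
    ((finalRow τ pr q v).phase : ZMod 2) = 0 :=
  H.isTableau.even _ (H.index_lt v)

/-- The graph read off from the final rows. -/
def Eliminated.graph (H : Eliminated g τ pr h q) : SimpleGraph (Option (Fin n)) :=
  rowGraph (finalRow τ pr q) H.om H.xb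

/-- The graph state before the phase gates. -/
def Eliminated.state (H : Eliminated g τ pr h q) : (Option (Fin n) → Fin 2) → ℂ :=
  phasedGraphState H.graph fun v => rowExponent (finalRow τ pr q v) v

/-- The last elimination step does not change the fixed vectors, so the state built from the final
rows also satisfies the equations of the generators and of the logical rows. -/
theorem Eliminated.fixes (H : Eliminated g τ pr h q) :
    Fixes (n + 1) (logicalRows τ pr q) H.state := by
  rw [← fixes_elim_iff (i := n - 1) (c := some q) (by omega)]
  intro k hk
  obtain ⟨v, hv⟩ := H.pivots.surj k hk
  have : elim (logicalRows τ pr q) (n - 1) (some q) k = finalRow τ pr q v := by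
    rw [finalRow, hv, Nat.add_sub_cancel]
  rw [this]
  exact row_fixes _ H.om H.xb H.even v

/-- The maximally entangled state. -/
def Eliminated.entangled (H : Eliminated g τ pr h q) : (Option (Fin n) → Fin 2) → ℂ :=
  hadOps h *ᵥ H.state

theorem Eliminated.hadOps_entangled (H : Eliminated g τ pr h q) :
    hadOps h *ᵥ H.entangled = H.state := by
  rw [Eliminated.entangled, Matrix.mulVec_mulVec, hadOps_mul_self, Matrix.one_mulVec]

theorem Eliminated.inCode (H : Eliminated g τ pr h q) : InCode g H.entangled := by
  rw [← H.red.fixes, H.hadOps_entangled]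
  intro k hk
  have := H.fixes k (by omega)
  rwa [logicalRows_of_lt hk] at this

/-- The logical operator `Z`. -/
def logZ (τ : ℕ → Pauli (Option (Fin n))) (pr h : Option (Fin n) → ℕ) (q : Fin n) : PauliOp n where
  phase := 0
  letter := fun v => ((zRow τ pr q).hads h).letter (some v)

/-- The logical operator `X`. -/
def logX (τ : ℕ → Pauli (Option (Fin n))) (pr h : Option (Fin n) → ℕ) (q : Fin n) : PauliOp n where
  phase := 0
  letter := fun v => ((xRow τ pr q).hads h).letter (some v)

theorem Eliminated.had_none (H : Eliminated g τ pr h q) : h none = 0 := H.red.had_eq _ H.none_eq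

/-- The `Z` row fixes the state, and after the Hadamard gates are undone it is `Z` at the reference
system tensored with the logical operator. At the component `a` the former contributes the sign. -/
theorem Eliminated.slice_logZ (H : Eliminated g τ pr h q) (a : Fin 2) :
    slice H.entangled a = (-1 : ℂ) ^ (a : ℕ) • ((logZ τ pr h q).mat *ᵥ slice H.entangled a) := by
  have h1 := H.fixes (n - 1) (by omega)
  have hz : (logicalRows τ pr q (n - 1)) = zRow τ pr q := by simp [logicalRows]
  have hy : ∀ v, (zRow τ pr q).letter v ≠ .y := by
    intro v
    cases v with
    | none => simp [zRow]
    | some v => simp only [zRow, Option.elim]; split_ifs <;> simp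
  have he : (zRow τ pr q).hads h = (logZ τ pr h q).withLetter .z := by
    ext v
    · rfl
    · cases v with
      | none => simp [Pauli.hads, H.had_none, PauliOp.withLetter, zRow]
      | some v => rfl
  have h2 : ((logZ τ pr h q).withLetter .z).mat *ᵥ H.entangled = H.entangled := by
    rw [← he, Eliminated.entangled, Matrix.mulVec_mulVec, ← hadOps_mul_mat _ _ hy,
      ← Matrix.mulVec_mulVec, ← hz, h1]
  have h3 := slice_withLetter_mulVec (logZ τ pr h q) .z H.entangled a
  rw [h2, if_neg (by decide)] at h3
  have h4 : Letter.z.mat a a = (-1 : ℂ) ^ (a : ℕ) := by fin_cases a <;> simp [Letter.mat]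
  rw [h4] at h3
  exact h3

theorem Eliminated.slice_logX (H : Eliminated g τ pr h q) (a : Fin 2) :
    slice H.entangled a = (logX τ pr h q).mat *ᵥ slice H.entangled (1 - a) := by
  have h1 := H.fixes n (by omega)
  have hn := H.pos
  have hx : (logicalRows τ pr q n) = xRow τ pr q := by
    simp only [logicalRows]
    rw [if_neg (by omega), if_pos trivial]
  have hy : ∀ v, (xRow τ pr q).letter v ≠ .y := by
    intro v
    cases v with
    | none => simp [xRow]
    | some v => simp only [xRow, Option.elim]; split_ifs <;> simp
  have he : (xRow τ pr q).hads h = (logX τ pr h q).withLetter .x := by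
    ext v
    · rfl
    · cases v with
      | none => simp [Pauli.hads, H.had_none, PauliOp.withLetter, xRow]
      | some v => rfl
  have h2 : ((logX τ pr h q).withLetter .x).mat *ᵥ H.entangled = H.entangled := by
    rw [← he, Eliminated.entangled, Matrix.mulVec_mulVec, ← hadOps_mul_mat _ _ hy,
      ← Matrix.mulVec_mulVec, ← hx, h1]
  have h3 := slice_withLetter_mulVec (logX τ pr h q) .x H.entangled a
  rw [h2, if_pos (by decide)] at h3
  have h4 : Letter.x.mat a (1 - a) = 1 := by fin_cases a <;> simp [Letter.mat]
  rw [h4, one_smul] at h3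
  exact h3

theorem norm_edgeSign {V : Type} [Fintype V] [DecidableEq V] (G : SimpleGraph V) (x : V → Fin 2) :
    star (edgeSign G x) * edgeSign G x = 1 := by
  rw [edgeSign, star_prod, ← Finset.prod_mul_distrib]
  refine Finset.prod_eq_one fun e _ => ?_
  split_ifs <;> simp

theorem phasedGraphState_dotProduct {V : Type} [Fintype V] [DecidableEq V] (G : SimpleGraph V)
    (a : V → ℕ) : star (phasedGraphState G a) ⬝ᵥ phasedGraphState G a = 1 := by
  have h : ∀ x, star (phasedGraphState G a x) * phasedGraphState G a x =
      (2 ^ Fintype.card V)⁻¹ := by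
    intro x
    have h1 : star (∏ v, if x v = 1 then (Complex.I ^ a v)⁻¹ else 1) *
        (∏ v, if x v = 1 then (Complex.I ^ a v)⁻¹ else 1) = 1 := by
      rw [star_prod, ← Finset.prod_mul_distrib]
      refine Finset.prod_eq_one fun v _ => ?_
      split_ifs
      · rw [star_inv₀, star_pow, ← mul_inv, ← mul_pow]
        simp
      · simp
    have h2 : star ((((Real.sqrt 2 : ℝ) : ℂ)⁻¹) ^ Fintype.card V) *
        (((Real.sqrt 2 : ℝ) : ℂ)⁻¹) ^ Fintype.card V = (2 ^ Fintype.card V)⁻¹ := by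
      rw [star_pow, ← mul_pow, star_inv₀, ← mul_inv, ← inv_pow]
      congr 2
      have : star ((Real.sqrt 2 : ℝ) : ℂ) = ((Real.sqrt 2 : ℝ) : ℂ) := Complex.conj_ofReal _
      rw [this, ← Complex.ofReal_mul, Real.mul_self_sqrt (by norm_num)]
      norm_num
    have h3 := norm_edgeSign G x
    simp only [phasedGraphState, graphState_eq, star_mul']
    linear_combination ((2 ^ Fintype.card V)⁻¹) * h1 + (2 ^ Fintype.card V)⁻¹ *
      (star (∏ v, if x v = 1 then (Complex.I ^ a v)⁻¹ else 1) *
        (∏ v, if x v = 1 then (Complex.I ^ a v)⁻¹ else 1)) * h3 +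
      (star (∏ v, if x v = 1 then (Complex.I ^ a v)⁻¹ else 1) *
        (∏ v, if x v = 1 then (Complex.I ^ a v)⁻¹ else 1)) *
      (star (edgeSign G x) * edgeSign G x) * h2
  simp only [dotProduct, Pi.star_apply, h, Finset.sum_const, Finset.card_univ, Fintype.card_fun,
    Fintype.card_fin, nsmul_eq_mul]
  push_cast
  exact mul_inv_cancel₀ (pow_ne_zero _ two_ne_zero)

theorem Eliminated.entangled_dotProduct (H : Eliminated g τ pr h q) :
    star H.entangled ⬝ᵥ H.entangled = 1 := by
  rw [Eliminated.entangled, star_mulVec_dotProduct (hadOps_unitary h)]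
  exact phasedGraphState_dotProduct _ _

/-- Splitting off the basis state of the reference system. -/
def refEquiv (n : ℕ) : Fin 2 × (Fin n → Fin 2) ≃ (Option (Fin n) → Fin 2) where
  toFun p := withRef p.1 p.2
  invFun x := (x none, fun k => x (some k))
  left_inv _ := rfl
  right_inv x := withRef_eta x

theorem dotProduct_eq_slices (u w : (Option (Fin n) → Fin 2) → ℂ) :
    star u ⬝ᵥ w = star (slice u 0) ⬝ᵥ slice w 0 + star (slice u 1) ⬝ᵥ slice w 1 := by
  rw [dotProduct, ← (refEquiv n).sum_comp, Fintype.sum_prod_type, Fin.sum_univ_two]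
  rfl

theorem PauliOp.mat_unitary (p : PauliOp n) : p.matᴴ * p.mat = 1 := p.toPauli.mat_unitary

/-- The logical `X` carries one component to the other, so their norms agree. They are eigenvectors
of the unitary logical `Z` for different eigenvalues, so they are orthogonal. The squared norms add
up to `1`. -/
theorem Eliminated.slice_dotProduct (H : Eliminated g τ pr h q) (a c : Fin 2) :
    star (slice H.entangled a) ⬝ᵥ slice H.entangled c = if a = c then 1 / 2 else 0 := by
  have hx : star (slice H.entangled 0) ⬝ᵥ slice H.entangled 0 =
      star (slice H.entangled 1) ⬝ᵥ slice H.entangled 1 := by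
    have h0 := H.slice_logX 1
    rw [h0, star_mulVec_dotProduct (PauliOp.mat_unitary _)]
    rfl
  have hs := H.entangled_dotProduct
  rw [dotProduct_eq_slices, ← hx] at hs
  have h0 : star (slice H.entangled 0) ⬝ᵥ slice H.entangled 0 = 1 / 2 := by
    linear_combination hs / 2
  have hneg : ∀ a c : Fin 2, a ≠ c →
      star (slice H.entangled a) ⬝ᵥ slice H.entangled c = 0 := by
    intro a c hac
    have h1 : star (slice H.entangled a) ⬝ᵥ slice H.entangled c =
        -(star (slice H.entangled a) ⬝ᵥ slice H.entangled c) := by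
      conv_lhs => rw [H.slice_logZ a, H.slice_logZ c]
      rw [star_smul, smul_dotProduct, dotProduct_smul,
        star_mulVec_dotProduct (PauliOp.mat_unitary _)]
      fin_cases a <;> fin_cases c <;> simp at hac ⊢
    linear_combination h1 / 2
  by_cases hac : a = c
  · subst hac
    rw [if_pos rfl]
    fin_cases a
    · exact h0
    · exact hx ▸ h0
  · rw [if_neg hac, hneg a c hac]

/-- The vector with component `ψ` at the basis state `0` of the reference system. -/
def zeroRef : ((Fin n → Fin 2) → ℂ) →ₗ[ℂ] ((Option (Fin n) → Fin 2) → ℂ) where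
  toFun ψ := fun x => if x none = 0 then ψ fun k => x (some k) else 0
  map_add' ψ φ := by
    funext x
    by_cases hx : x none = 0 <;> simp [hx]
  map_smul' c ψ := by
    funext x
    by_cases hx : x none = 0 <;> simp [hx]

theorem slice_zeroRef (ψ : (Fin n → Fin 2) → ℂ) (a : Fin 2) :
    slice (zeroRef ψ) a = if a = 0 then ψ else 0 := by
  funext x
  by_cases ha : a = 0 <;> simp [slice, zeroRef, withRef, ha]

/-- Reading off two amplitudes after the Hadamard gates. -/
def Eliminated.readOff (h : Option (Fin n) → ℕ) (q : Fin n) :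
    ((Fin n → Fin 2) → ℂ) →ₗ[ℂ] (Fin 2 → ℂ) where
  toFun ψ := fun b => (hadOps h *ᵥ zeroRef ψ) (withRef 0 fun k => if k = q then b else 0)
  map_add' ψ φ := by
    rw [map_add, Matrix.mulVec_add]; rfl
  map_smul' c ψ := by
    rw [map_smul, Matrix.mulVec_smul]; rfl

/-- After the Hadamard gates a code vector is determined by its amplitudes at assignments that
vanish on all pivots (`Pivots.eq_zero_of_fixes`). With the reference qubit in the state `0` only the
free qubit can vary there, which leaves two amplitudes. -/
theorem Eliminated.eq_zero (H : Eliminated g τ pr h q) {ψ : Qubits (Fin n)}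
    (hψ : ψ ∈ codeSpace g) (h0 : Eliminated.readOff h q ψ.ofLp = 0) : ψ = 0 := by
  rw [mem_codeSpace_iff] at hψ
  have hfix : Fixes (n - 1) τ (hadOps h *ᵥ zeroRef ψ.ofLp) := by
    rw [H.red.fixes]
    intro a k
    rw [slice_zeroRef]
    split_ifs
    · exact hψ k
    · simp
  have hz : hadOps h *ᵥ zeroRef ψ.ofLp = 0 := by
    funext x
    refine H.red.pivots.eq_zero_of_fixes hfix (fun x hx => ?_) x
    by_cases hn : x none = 0
    · have := congrFun h0 (x (some q))
      have hx' : x = withRef 0 fun k => if k = q then x (some q) else 0 := by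
        funext o
        cases o with
        | none => exact hn
        | some k =>
          by_cases hk : k = q
          · subst hk; simp [withRef]
          · simp only [withRef, Option.elim, hk, if_false]
            exact hx _ fun h0 => hk (H.unique k h0)
      rw [hx']
      exact this
    -- No Hadamard gate acts at the reference system, so amplitudes with the reference qubit in the
    -- state `1` remain zero.
    · simp only [Matrix.mulVec, dotProduct]
      refine Finset.sum_eq_zero fun y _ => ?_
      by_cases hy : y none = 0
      · have : hadOps h x y = 0 := by
          simp only [hadOps, tens, Matrix.of_apply]
          refine Finset.prod_eq_zero (Finset.mem_univ none) ?_
          rw [H.had_none, if_neg (by norm_num), hy]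
          exact Matrix.one_apply_ne hn
        rw [this, zero_mul]
      · simp [zeroRef, hy]
  have hz' : zeroRef ψ.ofLp = 0 := by
    have := congrArg (fun v => hadOps h *ᵥ v) hz
    simpa [Matrix.mulVec_mulVec, hadOps_mul_self] using this
  ext x
  have := congrArg (fun v => slice v 0 x) hz'
  simp only [slice_zeroRef] at this
  exact this

theorem Eliminated.finrank_le (H : Eliminated g τ pr h q) :
    Module.finrank ℂ (codeSpace g) ≤ 2 := by
  let L : codeSpace g →ₗ[ℂ] (Fin 2 → ℂ) :=
    Eliminated.readOff h q ∘ₗ (WithLp.linearEquiv 2 ℂ ((Fin n → Fin 2) → ℂ)).toLinearMap ∘ₗ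
      (codeSpace g).subtype
  have hL : Function.Injective L := by
    rw [injective_iff_map_eq_zero]
    intro ψ hψ
    exact Subtype.ext (H.eq_zero ψ.2 hψ)
  simpa using LinearMap.finrank_le_finrank_of_injective hL

theorem sqrt_two_mul_self : ((Real.sqrt 2 : ℝ) : ℂ) * ((Real.sqrt 2 : ℝ) : ℂ) = 2 := by
  rw [← Complex.ofReal_mul, Real.mul_self_sqrt (by norm_num)]
  norm_num

theorem sqrt_two_ne_zero : ((Real.sqrt 2 : ℝ) : ℂ) ≠ 0 := by
  intro h
  have := sqrt_two_mul_self
  rw [h] at this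
  norm_num at this

/-- The rescaled components are two orthonormal vectors in a code space of dimension at most two, so
they span it. -/
theorem Eliminated.exists_basis (H : Eliminated g τ pr h q) :
    ∃ b : LogicalBasis g, ∀ a, b.ket a = ((Real.sqrt 2 : ℝ) : ℂ) • slice H.entangled a := by
  let f : Fin 2 → codeSpace g := fun a =>
    ⟨WithLp.toLp 2 (((Real.sqrt 2 : ℝ) : ℂ) • slice H.entangled a), by
      rw [mem_codeSpace_iff]
      intro k
      simp only [Matrix.mulVec_smul, H.inCode a k]⟩
  have hf : Orthonormal ℂ f := by
    rw [orthonormal_iff_ite]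
    intro a c
    have : inner ℂ (f a) (f c) = star (((Real.sqrt 2 : ℝ) : ℂ) • slice H.entangled a) ⬝ᵥ
        (((Real.sqrt 2 : ℝ) : ℂ) • slice H.entangled c) := by
      rw [Submodule.coe_inner, EuclideanSpace.inner_eq_star_dotProduct, dotProduct_comm]
    rw [this, star_smul, smul_dotProduct, dotProduct_smul, H.slice_dotProduct]
    have h2 : star ((Real.sqrt 2 : ℝ) : ℂ) = ((Real.sqrt 2 : ℝ) : ℂ) := Complex.conj_ofReal _
    rw [h2, smul_smul, sqrt_two_mul_self]
    split_ifs <;> simp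
  have hli := hf.linearIndependent
  have hle := H.finrank_le
  have hge := hli.fintype_card_le_finrank
  rw [Fintype.card_fin] at hge
  have hspan := hli.span_eq_top_of_card_eq_finrank' (by rw [Fintype.card_fin]; omega)
  refine ⟨OrthonormalBasis.mk hf hspan.ge, fun a => ?_⟩
  simp [LogicalBasis.ket, f]

theorem cliff_append (u w : List Gate) : cliff (u ++ w) = cliff u * cliff w := by
  simp [cliff]

theorem cliff_replicate (k : ℕ) (a : Gate) : cliff (List.replicate k a) = a.mat ^ k := by
  simp [cliff]

theorem s_pow (k : ℕ) : Gate.s.mat ^ k = !![1, 0; 0, Complex.I ^ k] := by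
  induction k with
  | zero => ext i j; fin_cases i <;> fin_cases j <;> simp
  | succ k ih =>
    rw [pow_succ, ih]
    ext i j
    fin_cases i <;> fin_cases j <;> simp [Gate.mat, Matrix.mul_apply, pow_succ]

theorem cliff_cliffordWord {c : ℕ} (hc : c ≤ 1) (k : ℕ) :
    cliff (cliffordWord k c 0 0) = Gate.s.mat ^ k * if c = 1 then Gate.h.mat else 1 := by
  simp only [cliffordWord, cliff_append, cliff_replicate, pow_zero, mul_one]
  interval_cases c <;> simp

theorem s_pow_mulVec_phasedGraphState {V : Type} [Fintype V] [DecidableEq V] (G : SimpleGraph V)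
    (a : V → ℕ) : (tens fun v => Gate.s.mat ^ a v) *ᵥ phasedGraphState G a = graphState G := by
  funext x
  simp only [Matrix.mulVec, dotProduct, tens, Matrix.of_apply, s_pow]
  rw [Finset.sum_eq_single x]
  · rw [phasedGraphState, ← mul_assoc, ← Finset.prod_mul_distrib, Finset.prod_eq_one, one_mul]
    intro v _
    generalize x v = b
    fin_cases b
    · simp
    · simp
  · intro y _ hy
    obtain ⟨v, hv⟩ := Function.ne_iff.1 hy
    rw [Finset.prod_eq_zero (Finset.mem_univ v), zero_mul]
    revert hv
    generalize x v = b
    generalize y v = b'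
    fin_cases b <;> fin_cases b' <;> simp
  · simp

/-- The data read off from the final rows, with a given path. -/
def Eliminated.data (H : Eliminated g τ pr h q) (path : List (Option (Fin n))) : PathData n where
  graph := H.graph
  clifford := fun v => cliffordWord (rowExponent (finalRow τ pr q v) v) (h v) 0 0
  path := path
  logicalZ := logZ τ pr h q
  logicalX := logX τ pr h q

/-- The Hadamard gates lead back to the phased graph state and the gates `S` remove its phases; the
global phase is `1`. -/
theorem Eliminated.exists_describes (H : Eliminated g τ pr h q) (path : List (Option (Fin n))) :
    ∃ b : LogicalBasis g, Describes (H.data path) b := by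
  obtain ⟨b, hb⟩ := H.exists_basis
  refine ⟨b, ⟨fun a => ?_, fun a => ?_, 1, by simp, ?_⟩⟩
  · have h1 := H.slice_logZ a
    rw [hb, Matrix.mulVec_smul, smul_comm]
    congr 1
    conv_rhs => rw [h1]
    rw [smul_smul, ← mul_pow]
    simp [Eliminated.data]
  · rw [hb, hb, Matrix.mulVec_smul]
    congr 1
    have h1 := H.slice_logX (1 - a)
    rw [sub_sub_cancel] at h1
    exact h1.symm
  · have h1 : b.maxEntangled = H.entangled := by
      funext x
      rw [LogicalBasis.maxEntangled, hb, Pi.smul_apply, smul_eq_mul, ← mul_assoc,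
        inv_mul_cancel₀ sqrt_two_ne_zero, one_mul, slice, withRef_eta]
    have h2 : (tensor fun v => cliff ((H.data path).clifford v)) =
        (tens fun v => Gate.s.mat ^ rowExponent (finalRow τ pr q v) v) * hadOps h := by
      rw [hadOps, tens_mul, tensor_eq_tens]
      congr 1
      funext v
      exact cliff_cliffordWord (H.red.had_le v) _
    rw [one_smul, h1, h2, ← Matrix.mulVec_mulVec, H.hadOps_entangled]
    exact (s_pow_mulVec_phasedGraphState _ _).symm

end Final

end

section

/-! ### LOCC protocols as sums over branches -/

section LOCC

variable {n D : ℕ}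

theorem localOp_eq_tens (k : Fin n) (K : Matrix (Loc D) (Loc D) ℂ) :
    localOp k K = tens (Function.update (fun _ => 1) k K) := by
  ext x y
  simp only [localOp, tens, Matrix.of_apply]
  rw [← Finset.mul_prod_erase _ _ (Finset.mem_univ k), Function.update_self]
  split_ifs with h
  · rw [Finset.prod_eq_one, mul_one]
    intro l hl
    rw [Function.update_of_ne (Finset.ne_of_mem_erase hl), h l (Finset.ne_of_mem_erase hl),
      Matrix.one_apply_eq]
  · push Not at h
    obtain ⟨l, hl, hxy⟩ := h
    rw [Finset.prod_eq_zero (Finset.mem_erase.2 ⟨hl, Finset.mem_univ l⟩), mul_zero]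
    rw [Function.update_of_ne hl, Matrix.one_apply_ne hxy]

theorem localOp_mul (k : Fin n) (K L : Matrix (Loc D) (Loc D) ℂ) :
    localOp k K * localOp k L = localOp k (K * L) := by
  simp only [localOp_eq_tens, tens_mul]
  congr 1
  funext v
  by_cases hv : v = k
  · subst hv; simp
  · simp [hv]

theorem localOp_conjTranspose (k : Fin n) (K : Matrix (Loc D) (Loc D) ℂ) :
    (localOp k K)ᴴ = localOp k Kᴴ := by
  simp only [localOp_eq_tens, tens_conjTranspose]
  congr 1
  funext v
  by_cases hv : v = k
  · subst hv; simp
  · simp [hv]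

theorem localOp_sum {m : ℕ} (k : Fin n) (K : Fin m → Matrix (Loc D) (Loc D) ℂ) :
    ∑ i, localOp k (K i) = localOp k (∑ i, K i) := by
  ext x y
  simp only [localOp, Matrix.sum_apply, Matrix.of_apply]
  split_ifs <;> simp

theorem localOp_one (k : Fin n) : localOp k (1 : Matrix (Loc D) (Loc D) ℂ) = 1 := by
  rw [localOp_eq_tens, Function.update_eq_self_iff.2 rfl, tens_one]

theorem channel_trace (p : LOCCProtocol n D) (σ : Matrix (Fin n → Loc D) (Fin n → Loc D) ℂ) :
    (p.channel σ).trace = σ.trace := by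
  induction p generalizing σ with
  | done => rfl
  | step k m K hK next ih =>
    have h : ∀ i, ((next i).channel (localOp k (K i) * σ * (localOp k (K i))ᴴ)).trace =
        (localOp k ((K i)ᴴ * K i) * σ).trace := by
      intro i
      rw [ih, Matrix.trace_mul_comm, ← Matrix.mul_assoc, localOp_conjTranspose, localOp_mul]
    simp only [LOCCProtocol.channel, Matrix.trace_sum, h]
    rw [← Matrix.trace_sum, ← Finset.sum_mul, localOp_sum, hK, localOp_one, Matrix.one_mul]

/-- A protocol is a sum over its branches, each of which applies a product of local operators. -/
theorem exists_branches (p : LOCCProtocol n D) :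
    ∃ (ι : Type) (_ : Fintype ι) (M : ι → Fin n → Matrix (Loc D) (Loc D) ℂ), ∀ σ,
      p.channel σ = ∑ i, tens (M i) * σ * (tens (M i))ᴴ := by
  induction p with
  | done =>
    exact ⟨Unit, inferInstance, fun _ _ => 1, fun σ => by simp [LOCCProtocol.channel, tens_one]⟩
  | step k m K hK next ih =>
    choose ι hι M hM using ih
    -- A branch is a first outcome together with a branch of what follows it. Only the operator of
    -- party `k` gains a factor.
    refine ⟨Σ i, ι i, inferInstance,
      fun i v => M i.1 i.2 v * (Function.update (fun _ => 1) k (K i.1) : Fin n → _) v, fun σ => ?_⟩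
    simp only [LOCCProtocol.channel, hM, Fintype.sum_sigma]
    refine Finset.sum_congr rfl fun i _ => Finset.sum_congr rfl fun l _ => ?_
    simp only [← tens_mul, ← localOp_eq_tens, Matrix.conjTranspose_mul, Matrix.mul_assoc]

/-- A state vector together with ancillas in the state `|0⟩`. -/
def withAncillas (D : ℕ) (φ : (Fin n → Fin 2) → ℂ) : (Fin n → Loc D) → ℂ := fun x =>
  if ∀ k, (x k).2 = 0 then φ fun k => (x k).1 else 0

theorem addAncillas_encode {m : ℕ} {g : Fin m → PauliOp n} (b : LogicalBasis g)
    (ρ : Matrix (Fin 2) (Fin 2) ℂ) : addAncillas (D := D) (b.encode ρ) =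
      ∑ a, ∑ c, ρ a c • Matrix.vecMulVec (withAncillas D (b.ket a))
        (star (withAncillas D (b.ket c))) := by
  ext x y
  simp only [addAncillas, LogicalBasis.encode, Matrix.of_apply, Matrix.sum_apply,
    Matrix.smul_apply, Matrix.vecMulVec_apply, withAncillas, Pi.star_apply]
  by_cases hx : ∀ k, (x k).2 = 0
  · by_cases hy : ∀ k, (y k).2 = 0
    · simp [hx, hy]
    · have : ¬ ∀ k, (x k).2 = 0 ∧ (y k).2 = 0 := fun h => hy fun k => (h k).2
      simp [this, hy]
  · have : ¬ ∀ k, (x k).2 = 0 ∧ (y k).2 = 0 := fun h => hx fun k => (h k).1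
    simp [hx, this]

theorem mul_vecMulVec_mul {ι : Type} [Fintype ι] (M : Matrix ι ι ℂ) (u w : ι → ℂ) :
    M * Matrix.vecMulVec u (star w) * Mᴴ = Matrix.vecMulVec (M *ᵥ u) (star (M *ᵥ w)) := by
  rw [Matrix.mul_vecMulVec, Matrix.vecMulVec_mul, Matrix.star_mulVec]

theorem reduceTo_apply (j : Fin n) (σ : Matrix (Fin n → Loc D) (Fin n → Loc D) ℂ) (a c : Fin 2) :
    reduceTo j σ a c =
      ∑ x, if (x j).1 = a then σ x (Function.update x j (c, (x j).2)) else 0 := by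
  simp only [reduceTo, Matrix.of_apply]
  refine Finset.sum_congr rfl fun x _ => ?_
  rw [Finset.sum_eq_single (Function.update x j (c, (x j).2))]
  · have : ∀ l, l ≠ j → x l = Function.update x j (c, (x j).2) l := by
      intro l hl; simp [hl]
    simp only [Function.update_self, true_and]
    by_cases h : (x j).1 = a
    · rw [if_pos ⟨h, this⟩, if_pos h]
    · rw [if_neg fun h' => h h'.1, if_neg h]
  · intro y _ hy
    refine if_neg fun h => hy ?_
    funext l
    by_cases hl : l = j
    · subst hl
      rw [Function.update_self]
      exact Prod.ext h.2.1 h.2.2.1.symm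
    · rw [Function.update_of_ne hl, h.2.2.2 l hl]
  · simp

theorem reduceTo_trace (j : Fin n) (σ : Matrix (Fin n → Loc D) (Fin n → Loc D) ℂ) :
    (reduceTo j σ).trace = σ.trace := by
  simp only [Matrix.trace, Matrix.diag_apply, reduceTo_apply]
  rw [Finset.sum_comm]
  refine Finset.sum_congr rfl fun x _ => ?_
  rw [Finset.sum_ite_eq, if_pos (Finset.mem_univ _), Prod.mk.eta, Function.update_eq_self]

/-- An output entry becomes a sum over branches and final configurations of products of two
amplitudes. On the diagonal these are sums of squared absolute values for pure inputs. -/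
theorem toMap_encode_apply {m : ℕ} {g : Fin m → PauliOp n} (b : LogicalBasis g) (j : Fin n)
    {p : LOCCProtocol n D} {ι : Type} [Fintype ι] {M : ι → Fin n → Matrix (Loc D) (Loc D) ℂ}
    (h : ∀ σ, p.channel σ = ∑ i, tens (M i) * σ * (tens (M i))ᴴ)
    (ρ : Matrix (Fin 2) (Fin 2) ℂ) (r s : Fin 2) :
    p.toMap j (b.encode ρ) r s = ∑ i, ∑ x : Fin n → Loc D, if (x j).1 = r then
      ∑ a, ∑ c, ρ a c * ((tens (M i) *ᵥ withAncillas D (b.ket a)) x *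
        star ((tens (M i) *ᵥ withAncillas D (b.ket c)) (Function.update x j (s, (x j).2)))) else 0
      := by
  rw [LOCCProtocol.toMap, h, addAncillas_encode, reduceTo_apply]
  have h1 : ∀ M : Fin n → Matrix (Loc D) (Loc D) ℂ, tens M * (∑ a, ∑ c, ρ a c • Matrix.vecMulVec
      (withAncillas D (b.ket a)) (star (withAncillas D (b.ket c)))) * (tens M)ᴴ =
      ∑ a, ∑ c, ρ a c • Matrix.vecMulVec (tens M *ᵥ withAncillas D (b.ket a))
        (star (tens M *ᵥ withAncillas D (b.ket c))) := by
    intro M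
    simp only [Finset.mul_sum, Finset.sum_mul, Matrix.mul_smul, Matrix.smul_mul, mul_vecMulVec_mul]
  conv_rhs => rw [Finset.sum_comm]
  refine Finset.sum_congr rfl fun x _ => ?_
  simp only [h1]
  split_ifs
  · simp [Matrix.sum_apply, Matrix.vecMulVec_apply]
  · simp

end LOCC

/-! ### Vectors that factor -/

section Factor

variable {V d : Type} [Fintype V] [DecidableEq V] [Fintype d] [DecidableEq d] [Inhabited d]

/-- The function depends only on the coordinates satisfying `P`. -/
def DependsOnly (P : V → Prop) (f : (V → d) → ℂ) : Prop :=
  ∀ x y, (∀ v, P v → x v = y v) → f x = f y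

/-- The assignment with prescribed values on `P` and default values elsewhere. -/
def fill (P : V → Prop) [DecidablePred P] (y : {v // P v} → d) : V → d := fun v =>
  if h : P v then y ⟨v, h⟩ else default

theorem sum_mul_split (P : V → Prop) [DecidablePred P] {f g : (V → d) → ℂ}
    (hf : DependsOnly P f) (hg : DependsOnly (fun v => ¬ P v) g) :
    ∑ x, f x * g x = (∑ y : {v // P v} → d, f (fill P y)) *
      ∑ y : {v // ¬ P v} → d, g (fill (fun v => ¬ P v) y) := by
  rw [Fintype.sum_mul_sum, ← Fintype.sum_prod_type',
    ← (Equiv.piEquivPiSubtypeProd P fun _ => d).sum_comp]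
  refine Finset.sum_congr rfl fun x _ => ?_
  congr 1
  · refine hf _ _ fun v hv => ?_
    simp [fill, hv, Equiv.piEquivPiSubtypeProd]
  · refine hg _ _ fun v hv => ?_
    simp [fill, hv, Equiv.piEquivPiSubtypeProd]

/-- The operator acts separately on the two groups of sites. The point is that `G` is the same for
all `i`: the action on the common factor is blind to the index. -/
theorem tens_mulVec_split {ι : Type} (P : V → Prop) [DecidablePred P] (M : V → Matrix d d ℂ)
    {f : ι → (V → d) → ℂ} {g : (V → d) → ℂ} (hf : ∀ i, DependsOnly P (f i))
    (hg : DependsOnly (fun v => ¬ P v) g) :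
    ∃ (F : ι → (V → d) → ℂ) (G : (V → d) → ℂ), (∀ i, DependsOnly P (F i)) ∧
      DependsOnly (fun v => ¬ P v) G ∧ ∀ i x, (tens M *ᵥ fun y => f i y * g y) x = F i x * G x := by
  refine ⟨fun i x => ∑ y : {v // P v} → d,
      (∏ v : {v // P v}, M v (x v) (fill P y v)) * f i (fill P y), fun x =>
      ∑ y : {v // ¬ P v} → d, (∏ v : {v // ¬ P v}, M v (x v) (fill (fun v => ¬ P v) y v)) *
        g (fill (fun v => ¬ P v) y), ?_, ?_, ?_⟩
  · intro i x x' h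
    refine Finset.sum_congr rfl fun y _ => ?_
    congr 1
    exact Finset.prod_congr rfl fun v _ => by rw [h v v.2]
  · intro x x' h
    refine Finset.sum_congr rfl fun y _ => ?_
    congr 1
    exact Finset.prod_congr rfl fun v _ => by rw [h v v.2]
  · intro i x
    rw [← sum_mul_split P (f := fun z => (∏ v : {v // P v}, M v (x v) (z v)) * f i z)
      (g := fun z => (∏ v : {v // ¬ P v}, M v (x v) (z v)) * g z)]
    · simp only [Matrix.mulVec, dotProduct, tens, Matrix.of_apply]
      refine Finset.sum_congr rfl fun z _ => ?_
      rw [← Fintype.prod_subtype_mul_prod_subtype P]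
      ring
    · intro z z' h
      dsimp only
      rw [hf i z z' h]
      congr 1
      exact Finset.prod_congr rfl fun v _ => by rw [h v v.2]
    · intro z z' h
      dsimp only
      rw [hg z z' h]
      congr 1
      exact Finset.prod_congr rfl fun v _ => by rw [h v v.2]

end Factor

/-! ### Impossibility of extraction for a receiver in the factor that is independent of the logical
state -/

section NoGo

variable {n m : ℕ} {g : Fin m → PauliOp n}

theorem FactorsOn.exists_factors {b : LogicalBasis g} {A : Finset (Fin n)} (h : FactorsOn b A) :
    ∃ (F : Fin 2 → (Fin n → Fin 2) → ℂ) (G : (Fin n → Fin 2) → ℂ),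
      (∀ a, DependsOnly (fun k => k ∉ A) (F a)) ∧ DependsOnly (fun k => ¬ k ∉ A) G ∧
        ∀ a x, b.ket a x = F a x * G x := by
  obtain ⟨φ, ψ, -, -, h⟩ := h
  refine ⟨fun a x => (φ a).ofLp fun k => x k, fun x => ψ.ofLp fun k => x k, ?_, ?_, h⟩
  · intro a x y hxy
    exact congrArg (φ a).ofLp (funext fun k => hxy k k.2)
  · intro x y hxy
    exact congrArg ψ.ofLp (funext fun k => hxy k (not_not.2 k.2))

/-- In every branch the logical vector `a` has become `F' a * G'`, where `F'` does not see the
system of `j`. Correct output for `|0⟩` and `|1⟩` means `F' r * G' = 0` wherever the qubit of `j`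
differs from `r`. As `F'` is unaffected by changing that qubit, these zeros also remove every term
of the off-diagonal entry for `|+⟩`. -/
theorem not_extracts_of_factorsOn {b : LogicalBasis g} {A : Finset (Fin n)} {j : Fin n}
    (hj : j ∈ A) (hA : FactorsOn b A) {C} (hC : IsLOCCMap j C) : ¬ Extracts b C := by
  intro hE
  obtain ⟨D, p, rfl⟩ := hC
  obtain ⟨ι, hι, M, hM⟩ := exists_branches p
  obtain ⟨F, G, hF, hG, hFG⟩ := hA.exists_factors
  have hsplit : ∀ i, ∃ (F' : Fin 2 → (Fin n → Loc D) → ℂ)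
      (G' : (Fin n → Loc D) → ℂ), (∀ a, DependsOnly (fun k => k ∉ A) (F' a)) ∧
      ∀ a x, (tens (M i) *ᵥ withAncillas D (b.ket a)) x = F' a x * G' x := by
    intro i
    have hg : DependsOnly (fun k => ¬ k ∉ A) fun x : Fin n → Loc D =>
        if ∀ k ∈ A, (x k).2 = 0 then G fun k => (x k).1 else 0 := by
      intro x y hxy
      have h1 : (∀ k ∈ A, (x k).2 = 0) ↔ ∀ k ∈ A, (y k).2 = 0 :=
        forall₂_congr fun k hk => by rw [hxy k (not_not.2 hk)]
      simp only [h1]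
      congr 1
      exact hG _ _ fun k hk => by rw [hxy k hk]
    have hf : ∀ a, DependsOnly (fun k => k ∉ A) fun x : Fin n → Loc D =>
        if ∀ k, k ∉ A → (x k).2 = 0 then F a fun k => (x k).1 else 0 := by
      intro a x y hxy
      have h1 : (∀ k, k ∉ A → (x k).2 = 0) ↔ ∀ k, k ∉ A → (y k).2 = 0 :=
        forall₂_congr fun k hk => by rw [hxy k hk]
      simp only [h1]
      congr 1
      exact hF a _ _ fun k hk => by rw [hxy k hk]
    have hanc : ∀ a, withAncillas D (b.ket a) = fun x =>
        (if ∀ k, k ∉ A → (x k).2 = 0 then F a fun k => (x k).1 else 0) *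
          if ∀ k ∈ A, (x k).2 = 0 then G fun k => (x k).1 else 0 := by
      intro a
      funext x
      by_cases h1 : ∀ k, k ∉ A → (x k).2 = 0
      · by_cases h2 : ∀ k ∈ A, (x k).2 = 0
        · have : ∀ k, (x k).2 = 0 := fun k => by
            by_cases hk : k ∈ A
            · exact h2 k hk
            · exact h1 k hk
          rw [withAncillas, if_pos this, if_pos h1, if_pos h2, hFG]
        · rw [withAncillas, if_neg fun h => h2 fun k _ => h k, if_neg h2, mul_zero]
      · rw [withAncillas, if_neg fun h => h1 fun k _ => h k, if_neg h1, zero_mul]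
    obtain ⟨F', G', hF', -, h⟩ := tens_mulVec_split (fun k => k ∉ A) (M i) hf hg
    exact ⟨F', G', hF', fun a x => by rw [hanc, h]⟩
  choose F' G' hF' hsplit using hsplit
  have hupd : ∀ i a (x : Fin n → Loc D) l, F' i a (Function.update x j l) = F' i a x := by
    intro i a x l
    refine hF' i a _ _ fun v hv => ?_
    have : v ≠ j := by rintro rfl; exact hv hj
    simp [this]
  -- For the input `|r⟩⟨r|` the diagonal entry `(s, s)` of the output vanishes. It is a sum of
  -- nonnegative terms, so each of them is zero.
  have hdiag : ∀ r s : Fin 2, r ≠ s → ∀ i (x : Fin n → Loc D), (x j).1 = s →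
      F' i r x * G' i x = 0 := by
    intro r s hrs i x hx
    have h := hE (Matrix.vecMulVec (Pi.single r 1) (star (Pi.single r 1)))
      (Matrix.posSemidef_vecMulVec_self_star _)
      (by fin_cases r <;> simp [Matrix.trace, Matrix.vecMulVec_apply])
    have h1 := congrFun (congrFun h s) s
    rw [toMap_encode_apply b j hM] at h1
    have h2 : ∀ i (x : Fin n → Loc D), (x j).1 = s → (∑ a, ∑ c,
        Matrix.vecMulVec (Pi.single r 1) (star (Pi.single r 1)) a c *
        ((tens (M i) *ᵥ withAncillas D (b.ket a)) x * star ((tens (M i) *ᵥ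
          withAncillas D (b.ket c)) (Function.update x j (s, (x j).2))))) =
        (F' i r x * G' i x) * star (F' i r x * G' i x) := by
      intro i x hx
      rw [← hx, Prod.mk.eta, Function.update_eq_self]
      rw [Finset.sum_eq_single r, Finset.sum_eq_single r]
      · simp [Matrix.vecMulVec_apply, hsplit]
      · intro c _ hc; simp [Matrix.vecMulVec_apply, hc]
      · simp
      · intro c _ hc; simp [Matrix.vecMulVec_apply, hc]
      · simp
    have h3 : Matrix.vecMulVec (Pi.single r (1 : ℂ)) (star (Pi.single r 1)) s s = 0 := by
      simp [Matrix.vecMulVec_apply, hrs.symm]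
    rw [h3, Finset.sum_eq_zero_iff_of_nonneg] at h1
    · have h4 := h1 i (Finset.mem_univ i)
      rw [Finset.sum_eq_zero_iff_of_nonneg] at h4
      · have h5 := h4 x (Finset.mem_univ x)
        rw [if_pos hx, h2 i x hx] at h5
        simpa using h5
      · intro x _
        split_ifs with hx
        · rw [h2 i x hx]; exact mul_star_self_nonneg _
        · exact le_rfl
    · intro i _
      refine Finset.sum_nonneg fun x _ => ?_
      split_ifs with hx
      · rw [h2 i x hx]; exact mul_star_self_nonneg _
      · exact le_rfl
  -- The test state is `|+⟩⟨+|`, whose entry `(0, 1)` is `1 / 2`; every term of that entry of the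
  -- output contains a product that `hdiag` makes zero.
  have h := hE (Matrix.of fun _ _ => 1 / 2) ?_ (by simp [Matrix.trace]) 
  · have h1 := congrFun (congrFun h 0) 1
    rw [toMap_encode_apply b j hM, Finset.sum_eq_zero] at h1
    · norm_num at h1
    · intro i _
      refine Finset.sum_eq_zero fun x _ => ?_
      split_ifs with hx
      · have e1 : F' i 1 x * G' i x = 0 := hdiag 1 0 (by decide) i x hx
        have e2 := hdiag 0 1 (by decide) i (Function.update x j (1, (x j).2)) (by simp)
        rw [hupd] at e2
        simp only [hsplit, hupd, Fin.sum_univ_two, e1, e2, star_zero, mul_zero, zero_mul, add_zero,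
          zero_add]
        rcases mul_eq_zero.1 e2 with e | e <;> simp [e]
      · rfl
  · have : (Matrix.of fun _ _ => 1 / 2 : Matrix (Fin 2) (Fin 2) ℂ) =
        (1 / 2 : ℂ) • Matrix.vecMulVec (fun _ => 1) (star fun _ => 1) := by
      ext a c
      simp [Matrix.vecMulVec_apply]
    rw [this]
    refine (Matrix.posSemidef_vecMulVec_self_star _).smul ?_
    rw [Complex.le_def]
    simp

end NoGo

end

section

/-! ### Independence of the logical basis -/

section Basis

variable {n m : ℕ} {g : Fin m → PauliOp n}

theorem LogicalBasis.ket_dotProduct (b : LogicalBasis g) (a c : Fin 2) :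
    star (b.ket a) ⬝ᵥ b.ket c = if a = c then 1 else 0 := by
  have h := orthonormal_iff_ite.1 b.orthonormal a c
  rw [Submodule.coe_inner, EuclideanSpace.inner_eq_star_dotProduct, dotProduct_comm] at h
  exact h

/-- A pointwise factorization of the basis vectors can be normalized. -/
theorem factorsOn_of_factors (b : LogicalBasis g) {A : Finset (Fin n)}
    {F : Fin 2 → (Fin n → Fin 2) → ℂ} {G : (Fin n → Fin 2) → ℂ}
    (hF : ∀ a, DependsOnly (fun k => k ∉ A) (F a)) (hG : DependsOnly (fun k => k ∈ A) G)
    (h : ∀ a x, b.ket a x = F a x * G x) : FactorsOn b A := by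
  -- Inner products of the basis vectors split into one on `A` and one off `A`. So the vectors off
  -- `A` are orthogonal with a common norm, the inverse of the norm on `A`, and shifting the norm
  -- from one factor to the other normalizes both.
  have hsum : ∀ a c, (∑ y : {k // k ∈ A} → Fin 2, star (G (fill (fun k => k ∈ A) y)) * G (fill (fun k => k ∈ A) y)) *
      (∑ y : {k // k ∉ A} → Fin 2, star (F a (fill (fun k => k ∉ A) y)) * F c (fill (fun k => k ∉ A) y)) =
      if a = c then 1 else 0 := by
    intro a c
    have e := sum_mul_split (fun k => k ∈ A) (f := fun x => star (G x) * G x)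
      (g := fun x => star (F a x) * F c x) (fun x y hxy => by dsimp only; rw [hG x y hxy])
      (fun x y hxy => by dsimp only; rw [hF a x y hxy, hF c x y hxy])
    rw [← b.ket_dotProduct a c]
    refine Eq.trans (Eq.trans ?_ e.symm) ?_
    · congr!
    · simp only [dotProduct, Pi.star_apply, h, star_mul']
      exact Finset.sum_congr rfl fun x _ => by ring
  let ψ : Qubits {k // k ∈ A} := WithLp.toLp 2 fun y => G (fill (fun k => k ∈ A) y)
  let φ : Fin 2 → Qubits {k // k ∉ A} := fun a => WithLp.toLp 2 fun y => F a (fill (fun k => k ∉ A) y)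
  have hψ : ∑ y : {k // k ∈ A} → Fin 2, star (G (fill (fun k => k ∈ A) y)) * G (fill (fun k => k ∈ A) y) = (‖ψ‖ : ℂ) ^ 2 := by
    have h := inner_self_eq_norm_sq_to_K (𝕜 := ℂ) ψ
    rw [EuclideanSpace.inner_eq_star_dotProduct, dotProduct_comm] at h
    exact h
  have hφ : ∀ a c, ∑ y : {k // k ∉ A} → Fin 2, star (F a (fill (fun k => k ∉ A) y)) * F c (fill (fun k => k ∉ A) y) =
      inner ℂ (φ a) (φ c) := by
    intro a c
    rw [EuclideanSpace.inner_eq_star_dotProduct, dotProduct_comm]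
    rfl
  simp only [hψ, hφ] at hsum
  have hne : (‖ψ‖ : ℂ) ≠ 0 := by
    intro h0
    have := hsum 0 0
    simp [h0] at this
  refine ⟨fun a => (‖ψ‖ : ℂ) • φ a, (‖ψ‖ : ℂ)⁻¹ • ψ, ?_, ?_, ?_⟩
  · rw [orthonormal_iff_ite]
    intro a c
    rw [inner_smul_left, inner_smul_right, ← mul_assoc, Complex.conj_ofReal, ← pow_two, hsum]
  · rw [norm_smul, norm_inv, Complex.norm_real, norm_norm]
    exact inv_mul_cancel₀ (by simpa using hne)
  · intro a x
    have h1 : F a x = F a (fill (fun k => k ∉ A) fun k => x k) :=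
      hF a _ _ fun k hk => by simp [fill, hk]
    have h2 : G x = G (fill (fun k => k ∈ A) fun k => x k) :=
      hG _ _ fun k hk => by simp [fill, hk]
    rw [h, h1, h2]
    change _ = ((‖ψ‖ : ℂ) * F a (fill (fun k => k ∉ A) fun k => x k)) *
      ((‖ψ‖ : ℂ)⁻¹ * G (fill (fun k => k ∈ A) fun k => x k))
    field_simp

/-- The coefficients of the basis `b` with respect to the basis `b'`. -/
def transition (b b' : LogicalBasis g) : Matrix (Fin 2) (Fin 2) ℂ :=
  Matrix.of fun c a => inner ℂ (b' c) (b a)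

theorem ket_eq_sum (b b' : LogicalBasis g) (a : Fin 2) :
    b.ket a = ∑ c, transition b b' c a • b'.ket c := by
  have h := b'.sum_repr' (b a)
  have h1 := congrArg (fun ψ : codeSpace g => (ψ : Qubits (Fin n)).ofLp) h
  rw [LogicalBasis.ket, ← h1]
  simp [transition, LogicalBasis.ket]

theorem transition_unitary (b b' : LogicalBasis g) :
    (transition b b')ᴴ * transition b b' = 1 := by
  ext a c
  have h := orthonormal_iff_ite.1 b.orthonormal a c
  rw [Matrix.mul_apply, Matrix.one_apply, ← h, ← b'.sum_inner_mul_inner (b a) (b c)]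
  refine Finset.sum_congr rfl fun e _ => ?_
  simp only [Matrix.conjTranspose_apply, transition, Matrix.of_apply]
  congr 1
  exact inner_conj_symm (𝕜 := ℂ) (b a) (b' e)

theorem encode_transition (b b' : LogicalBasis g) (ρ : Matrix (Fin 2) (Fin 2) ℂ) :
    b.encode ρ = b'.encode (transition b b' * ρ * (transition b b')ᴴ) := by
  have h : ∀ (b : LogicalBasis g) (ρ : Matrix (Fin 2) (Fin 2) ℂ) x y,
      b.encode ρ x y = ∑ a, ∑ c, ρ a c * (b.ket a x * star (b.ket c y)) := by
    intro b ρ x y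
    simp [LogicalBasis.encode, Matrix.sum_apply, Matrix.vecMulVec_apply]
  ext x y
  rw [h, h]
  simp only [ket_eq_sum b b', Matrix.mul_apply, Matrix.conjTranspose_apply, Fin.sum_univ_two,
    Pi.add_apply, Pi.smul_apply, smul_eq_mul, star_add, star_mul']
  ring

/-- The new basis vectors are combinations of the old ones. These share the factor on `A`, so the
combination takes place in the other factor. -/
theorem FactorsOn.of_basis {b' : LogicalBasis g} {A : Finset (Fin n)} (h : FactorsOn b' A)
    (b : LogicalBasis g) : FactorsOn b A := by
  obtain ⟨F, G, hF, hG, hFG⟩ := h.exists_factors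
  refine factorsOn_of_factors b (F := fun a x => ∑ c, transition b b' c a * F c x) (G := G)
    ?_ ?_ ?_
  · intro a x y hxy
    exact Finset.sum_congr rfl fun c _ => by rw [hF c x y hxy]
  · intro x y hxy
    exact hG x y fun k hk => hxy k (not_not.1 hk)
  · intro a x
    rw [ket_eq_sum b b' a, Finset.sum_mul]
    simp [hFG, mul_assoc]

end Basis

/-! ### A final local operation -/

section AndThen

variable {n D : ℕ}

/-- The protocol `p`, followed by a unitary operation of party `k`. -/
def andThen (k : Fin n) (K : Matrix (Loc D) (Loc D) ℂ) (hK : Kᴴ * K = 1) :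
    LOCCProtocol n D → LOCCProtocol n D
  | .done => .step k 1 (fun _ => K) (by simpa using hK) fun _ => .done
  | .step l m L hL next => .step l m L hL fun i => andThen k K hK (next i)

theorem andThen_channel (k : Fin n) (K : Matrix (Loc D) (Loc D) ℂ) (hK : Kᴴ * K = 1)
    (p : LOCCProtocol n D) (σ : Matrix (Fin n → Loc D) (Fin n → Loc D) ℂ) :
    (andThen k K hK p).channel σ = localOp k K * p.channel σ * (localOp k K)ᴴ := by
  induction p generalizing σ with
  | done => simp [andThen, LOCCProtocol.channel]
  | step l m L hL next ih =>
    simp only [andThen, LOCCProtocol.channel, ih, Finset.mul_sum, Finset.sum_mul]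

theorem localOp_mul_apply (k : Fin n) (K : Matrix (Loc D) (Loc D) ℂ)
    (σ : Matrix (Fin n → Loc D) (Fin n → Loc D) ℂ) (x y : Fin n → Loc D) :
    (localOp k K * σ) x y = ∑ l, K (x k) l * σ (Function.update x k l) y := by
  rw [Matrix.mul_apply]
  simp only [localOp, Matrix.of_apply, ite_mul, zero_mul]
  rw [← Finset.sum_filter]
  refine Finset.sum_bij' (fun z _ => z k) (fun l _ => Function.update x k l) ?_ ?_ ?_ ?_ ?_
  · simp
  · intro l _
    simp only [Finset.mem_filter, Finset.mem_univ, true_and]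
    intro v hv
    rw [Function.update_of_ne hv]
  · intro z hz
    simp only [Finset.mem_filter, Finset.mem_univ, true_and] at hz
    funext v
    by_cases hv : v = k
    · subst hv; simp
    · rw [Function.update_of_ne hv, hz v hv]
  · simp
  · intro z hz
    simp only [Finset.mem_filter, Finset.mem_univ, true_and] at hz
    congr 2
    funext v
    by_cases hv : v = k
    · subst hv; simp
    · rw [Function.update_of_ne hv, hz v hv]

theorem kron_localOp_mul_apply (k : Fin n) (K : Matrix (Fin 2) (Fin 2) ℂ)
    (σ : Matrix (Fin n → Loc D) (Fin n → Loc D) ℂ) (x y : Fin n → Loc D) :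
    (localOp k (K ⊗ₖ (1 : Matrix (Fin (D + 1)) (Fin (D + 1)) ℂ)) * σ) x y =
      ∑ a, K (x k).1 a * σ (Function.update x k (a, (x k).2)) y := by
  rw [localOp_mul_apply, Fintype.sum_prod_type]
  refine Finset.sum_congr rfl fun a _ => ?_
  rw [Finset.sum_eq_single (x k).2]
  · simp [Matrix.kroneckerMap_apply]
  · intro e _ he
    rw [Matrix.kroneckerMap_apply, Matrix.one_apply_ne he.symm]
    simp
  · simp

theorem mul_kron_localOp_apply (k : Fin n) (K : Matrix (Fin 2) (Fin 2) ℂ)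
    (σ : Matrix (Fin n → Loc D) (Fin n → Loc D) ℂ) (x y : Fin n → Loc D) :
    (σ * (localOp k (K ⊗ₖ (1 : Matrix (Fin (D + 1)) (Fin (D + 1)) ℂ)))ᴴ) x y =
      ∑ a, σ x (Function.update y k (a, (y k).2)) * star (K (y k).1 a) := by
  have h := congrArg star (kron_localOp_mul_apply k K σᴴ y x)
  rw [← Matrix.conjTranspose_apply, Matrix.conjTranspose_mul, Matrix.conjTranspose_conjTranspose]
    at h
  rw [h, star_sum]
  refine Finset.sum_congr rfl fun a _ => ?_
  rw [star_mul, Matrix.conjTranspose_apply, star_star]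

theorem sum_ite_update (j : Fin n) (r a : Fin 2) (f : (Fin n → Loc D) → ℂ) :
    (∑ x : Fin n → Loc D, if (x j).1 = r then f (Function.update x j (a, (x j).2)) else 0) =
      ∑ x : Fin n → Loc D, if (x j).1 = a then f x else 0 := by
  rw [← Finset.sum_filter, ← Finset.sum_filter]
  refine Finset.sum_bij' (fun x _ => Function.update x j (a, (x j).2))
    (fun x _ => Function.update x j (r, (x j).2)) ?_ ?_ ?_ ?_ ?_
  · simp
  · simp
  · intro x hx
    simp only [Finset.mem_filter, Finset.mem_univ, true_and] at hx
    simp [← hx]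
  · intro x hx
    simp only [Finset.mem_filter, Finset.mem_univ, true_and] at hx
    simp [← hx]
  · simp

theorem reduceTo_localOp (j : Fin n) (K : Matrix (Fin 2) (Fin 2) ℂ)
    (σ : Matrix (Fin n → Loc D) (Fin n → Loc D) ℂ) :
    reduceTo j (localOp j (K ⊗ₖ 1) * σ * (localOp j (K ⊗ₖ 1))ᴴ) = K * reduceTo j σ * Kᴴ := by
  ext r s
  rw [reduceTo_apply]
  simp only [mul_kron_localOp_apply, kron_localOp_mul_apply, Function.update_self,
    Function.update_idem]
  have h : ∀ a c : Fin 2, reduceTo j σ a c = ∑ x : Fin n → Loc D, if (x j).1 = r then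
      σ (Function.update x j (a, (x j).2)) (Function.update x j (c, (x j).2)) else 0 := by
    intro a c
    rw [reduceTo_apply, ← sum_ite_update j r a fun x => σ x (Function.update x j (c, (x j).2))]
    simp
  simp only [Matrix.mul_apply, h, Matrix.conjTranspose_apply, Fin.sum_univ_two, Finset.mul_sum,
    Finset.sum_mul, ← Finset.sum_add_distrib]
  refine Finset.sum_congr rfl fun x _ => ?_
  split_ifs with hx
  · rw [hx]
  · simp

/-- The given map outputs the coordinates with respect to `b'`, which differ from those with respect
to `b` by conjugation with a unitary matrix. Party `j` undoes it at the end. -/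
theorem Extracts.of_basis {m : ℕ} {g : Fin m → PauliOp n} {b' : LogicalBasis g} {j : Fin n} {C}
    (hC : IsLOCCMap j C) (h : Extracts b' C) (b : LogicalBasis g) :
    ∃ C', IsLOCCMap j C' ∧ Extracts b C' := by
  obtain ⟨D, p, rfl⟩ := hC
  set W := transition b b'
  have hW : Wᴴ * W = 1 := transition_unitary b b'
  have hW' : W * Wᴴ = 1 := mul_eq_one_comm.1 hW
  refine ⟨_, ⟨D, andThen j (Wᴴ ⊗ₖ 1) ?_ p, rfl⟩, fun ρ hρ htr => ?_⟩
  · rw [Matrix.conjTranspose_kronecker, ← Matrix.mul_kronecker_mul]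
    simp [hW']
  · have h1 := h (W * ρ * Wᴴ) (hρ.mul_mul_conjTranspose_same W)
      (by rw [Matrix.trace_mul_comm, ← Matrix.mul_assoc, hW, Matrix.one_mul, htr])
    rw [LOCCProtocol.toMap, andThen_channel, encode_transition b b', reduceTo_localOp]
    rw [LOCCProtocol.toMap] at h1
    rw [h1, Matrix.conjTranspose_conjTranspose]
    calc Wᴴ * (W * ρ * Wᴴ) * W = (Wᴴ * W) * ρ * (Wᴴ * W) := by simp only [Matrix.mul_assoc]
      _ = ρ := by rw [hW, Matrix.one_mul, Matrix.mul_one]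

end AndThen

/-! ### Receivers that are not connected to the reference system -/

section Disconnected

/-- No edge joins a vertex with `P` to one without, so every sign belongs to one side. -/
theorem edgeSign_split {V : Type} [Fintype V] [DecidableEq V] (G : SimpleGraph V) (P : V → Prop)
    (hP : ∀ u v, G.Adj u v → (P u ↔ P v)) : ∃ f g : (V → Fin 2) → ℂ, DependsOnly P f ∧
      DependsOnly (fun v => ¬ P v) g ∧ ∀ x, edgeSign G x = f x * g x := by
  classical
  refine ⟨fun x => ∏ e ∈ G.edgeFinset.filter fun e => ∀ v ∈ e, P v,
    if ∀ v ∈ e, x v = 1 then (-1 : ℂ) else 1, fun x => ∏ e ∈ G.edgeFinset.filter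
      fun e => ¬ ∀ v ∈ e, P v, if ∀ v ∈ e, x v = 1 then (-1 : ℂ) else 1, ?_, ?_, ?_⟩
  · intro x y hxy
    refine Finset.prod_congr rfl fun e he => ?_
    have hP := (Finset.mem_filter.1 he).2
    have : (∀ v ∈ e, x v = 1) ↔ ∀ v ∈ e, y v = 1 :=
      forall₂_congr fun v hv => by rw [hxy v (hP v hv)]
    simp only [this]
  · intro x y hxy
    refine Finset.prod_congr rfl fun e he => ?_
    have he' := Finset.mem_filter.1 he
    have hnot : ∀ v ∈ e, ¬ P v := by
      obtain ⟨h1, h2⟩ := he'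
      rw [SimpleGraph.mem_edgeFinset] at h1
      induction e with
      | h a b =>
        have hab := hP a b h1
        simp only [Sym2.mem_iff, forall_eq_or_imp, forall_eq] at h2 ⊢
        tauto
    have : (∀ v ∈ e, x v = 1) ↔ ∀ v ∈ e, y v = 1 :=
      forall₂_congr fun v hv => by rw [hxy v (hnot v hv)]
    simp only [this]
  · intro x
    unfold edgeSign
    rw [Finset.prod_filter_mul_prod_filter_not]

variable {n m : ℕ} {g : Fin m → PauliOp n} {d : PathData n} {b : LogicalBasis g}

theorem Describes.maxEntangled_eq (h : Describes d b) : ∃ z : ℂ, b.maxEntangled =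
    z • ((tens fun v => (cliff (d.clifford v))ᴴ) *ᵥ graphState d.graph) := by
  obtain ⟨z, hz, h⟩ := h.graph
  refine ⟨z⁻¹, ?_⟩
  have h1 : (tens fun v => (cliff (d.clifford v))ᴴ) *
      (tensor fun v => cliff (d.clifford v)) = 1 := by
    rw [tensor_eq_tens]
    exact tens_inv_mul fun v => cliff_unitary _
  have hz0 : z ≠ 0 := by
    rintro rfl
    simp at hz
  rw [h, Matrix.mulVec_smul, Matrix.mulVec_mulVec, h1, Matrix.one_mulVec, smul_smul,
    inv_mul_cancel₀ hz0, one_smul]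

theorem LogicalBasis.ket_eq_slice (b : LogicalBasis g) (a : Fin 2) :
    b.ket a = ((Real.sqrt 2 : ℝ) : ℂ) • slice b.maxEntangled a := by
  funext x
  rw [Pi.smul_apply, slice, LogicalBasis.maxEntangled, smul_eq_mul, ← mul_assoc,
    mul_inv_cancel₀ sqrt_two_ne_zero, one_mul]
  rfl

/-- `A` is the connected component of `j`. The graph state factors along it, and so does its image
under local operators. The reference system lies on the other side, so the logical index enters only
there. -/
theorem Describes.exists_factorsOn (h : Describes d b) {j : Fin n}
    (hj : ¬ d.graph.Reachable (some j) none) : ∃ A : Finset (Fin n), j ∈ A ∧ FactorsOn b A := by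
  classical
  obtain ⟨z, hz⟩ := h.maxEntangled_eq
  set P : Option (Fin n) → Prop := fun v => ¬ d.graph.Reachable (some j) v with hP
  obtain ⟨f, g', hf, hg, hfg⟩ := edgeSign_split d.graph P (fun u v huv =>
    not_congr ⟨fun h => h.trans huv.reachable, fun h => h.trans huv.symm.reachable⟩)
  obtain ⟨F, G, hF, hG, hFG⟩ := tens_mulVec_split (ι := Unit) P
    (fun v => (cliff (d.clifford v))ᴴ) (fun _ => hf) hg
  have hgs : graphState d.graph = (((Real.sqrt 2 : ℝ) : ℂ)⁻¹) ^ Fintype.card (Option (Fin n)) •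
      fun x => f x * g' x := by
    funext x
    rw [graphState_eq, hfg]
    rfl
  have hme : ∀ x, b.maxEntangled x =
      (z * (((Real.sqrt 2 : ℝ) : ℂ)⁻¹) ^ Fintype.card (Option (Fin n))) * (F () x * G x) := by
    intro x
    rw [hz, hgs, Matrix.mulVec_smul, Pi.smul_apply, Pi.smul_apply, hFG]
    simp only [smul_eq_mul]
    ring
  refine ⟨Finset.univ.filter fun k => d.graph.Reachable (some j) (some k), by simp, ?_⟩
  -- `G` does not see the reference system, so its state there may be set to `0`.
  refine factorsOn_of_factors b (F := fun a x => ((Real.sqrt 2 : ℝ) : ℂ) *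
    (z * (((Real.sqrt 2 : ℝ) : ℂ)⁻¹) ^ Fintype.card (Option (Fin n))) * F () (withRef a x))
    (G := fun x => G (withRef 0 x)) ?_ ?_ ?_
  · intro a x y hxy
    dsimp only
    rw [hF () (withRef a x) (withRef a y)]
    intro v hv
    cases v with
    | none => rfl
    | some k => exact hxy k (by simpa using hv)
  · intro x y hxy
    refine hG _ _ fun v hv => ?_
    cases v with
    | none => rfl
    | some k => exact hxy k (by simpa [hP] using hv)
  · intro a x
    rw [b.ket_eq_slice, Pi.smul_apply, slice, hme, smul_eq_mul]
    rw [hG (withRef a x) (withRef 0 x)]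
    · ring
    · intro v hv
      cases v with
      | none => exact absurd hj hv
      | some k => rfl

end Disconnected

end

section

/-! ### Graph state amplitudes along an induced path -/

section Chain

variable {V : Type} [Fintype V] [DecidableEq V]

/-- The graph without the edges that meet `S`. -/
def del (G : SimpleGraph V) (S : Set V) : SimpleGraph V where
  Adj u v := G.Adj u v ∧ u ∉ S ∧ v ∉ S
  symm := ⟨fun _ _ h => ⟨h.1.symm, h.2.2, h.2.1⟩⟩
  loopless := ⟨fun _ h => G.irrefl h.1⟩

theorem edgeSign_del (G : SimpleGraph V) {S : Set V} {p : V} (y : V → Fin 2) :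
    edgeSign (del G S) y = (if y p = 1 then starSign (del G S) p y else 1) *
      edgeSign (del G (insert p S)) y := by
  classical
  rw [edgeSign_eq (del G S) p]
  congr 1
  unfold edgeSign
  refine Finset.prod_congr ?_ fun _ _ => rfl
  ext e
  induction e with
  | h a b =>
    simp only [Finset.mem_filter, SimpleGraph.mem_edgeFinset, SimpleGraph.mem_edgeSet,
      Sym2.mem_iff]
    simp only [del, Set.mem_insert_iff]
    constructor
    · rintro ⟨⟨h1, h2, h3⟩, h4⟩
      exact ⟨h1, fun h => h.elim (fun h => h4 (Or.inl h.symm)) h2,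
        fun h => h.elim (fun h => h4 (Or.inr h.symm)) h3⟩
    · rintro ⟨h1, h2, h3⟩
      exact ⟨⟨h1, fun h => h2 (Or.inr h), fun h => h3 (Or.inr h)⟩,
        fun h => h.elim (fun h => h2 (Or.inl h.symm)) fun h => h3 (Or.inl h.symm)⟩

/-- Each vertex of the list is adjacent to the next one, and to no later one. -/
def InducedChain (G : SimpleGraph V) : List V → Prop
  | [] => True
  | [_] => True
  | v :: w :: l => G.Adj v w ∧ (∀ u ∈ l, ¬ G.Adj v u) ∧ InducedChain G (w :: l)

/-- The sign of an edge. -/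
def edgeFactor (a b : Fin 2) : ℂ := if a = 1 ∧ b = 1 then -1 else 1

/-- The product of weights of the vertices after `v` and of the signs of the edges. -/
def chainProd (w : V → Fin 2 → ℂ) (y : V → Fin 2) : V → List V → ℂ
  | _, [] => 1
  | v, u :: l => edgeFactor (y v) (y u) * w u (y u) * chainProd w y u l

open Classical in
/-- The product of the signs of the edges from `v` to vertices outside of `S`. -/
def outSign (G : SimpleGraph V) (S : Set V) (v : V) (y : V → Fin 2) : ℂ :=
  ∏ u, if G.Adj v u ∧ u ∉ S ∧ y u = 1 then (-1 : ℂ) else 1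

/-- The vertices of the chain are removed one after the other, `S` being those already gone. Since
the chain is induced, the vertex removed next is joined to the rest of the chain by the edge to its
successor only. Its other remaining edges leave the chain and make up `outSign`. -/
theorem edgeSign_chain (G : SimpleGraph V) (F : Set V) (y : V → Fin 2) (l : List V) (v : V)
    (S : Set V) (hc : InducedChain G (v :: l)) (hn : (v :: l).Nodup)
    (hS : ∀ u ∈ v :: l, u ∉ S) (hF : ∀ u, u ∈ F ↔ u ∈ S ∨ u ∈ v :: l) :
    edgeSign (del G S) y = (if y v = 1 then outSign G F v y else 1) *
      chainProd (fun u b => if b = 1 then outSign G F u y else 1) y v l *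
        edgeSign (del G F) y := by
  classical
  induction l generalizing v S with
  | nil =>
    have hF' : F = insert v S := by
      ext u
      rw [hF, Set.mem_insert_iff, List.mem_singleton, or_comm]
    rw [edgeSign_del (p := v), chainProd, mul_one, ← hF']
    congr 1
    split_ifs
    · unfold starSign outSign
      refine Finset.prod_congr rfl fun u _ => if_congr ?_ rfl rfl
      have hvS := hS v (by simp)
      simp only [del, hF', Set.mem_insert_iff]
      constructor
      · rintro ⟨⟨h1, h2, h3⟩, h4⟩
        exact ⟨h1, fun h => h.elim (fun h => h1.ne h.symm) h3, h4⟩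
      · rintro ⟨h1, h2, h3⟩
        exact ⟨⟨h1, hvS, fun h => h2 (Or.inr h)⟩, h3⟩
    · rfl
  | cons w l ih =>
    obtain ⟨hvw, hvl, hc'⟩ := hc
    rw [edgeSign_del (p := v), ih w (insert v S) hc' (List.nodup_cons.1 hn).2]
    · have hstar : starSign (del G S) v y = outSign G F v y * if y w = 1 then -1 else 1 := by
        have h1 : (if y w = 1 then (-1 : ℂ) else 1) =
            ∏ u, if u = w then (if y w = 1 then (-1 : ℂ) else 1) else 1 := by
          rw [Finset.prod_ite_eq' Finset.univ w, if_pos (Finset.mem_univ w)]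
        rw [h1, outSign, ← Finset.prod_mul_distrib]
        unfold starSign
        refine Finset.prod_congr rfl fun u _ => ?_
        have hvS := hS v (by simp)
        have hwF : w ∈ F := (hF w).2 (Or.inr (by simp))
        by_cases huw : u = w
        · subst huw
          have := hS u (by simp)
          simp [del, hvw, hvS, this, hwF]
        · by_cases hu : G.Adj v u
          · have hul : u ∉ v :: w :: l := by
              simp only [List.mem_cons, not_or]
              exact ⟨hu.ne', huw, fun h => hvl u h hu⟩
            have : u ∈ F ↔ u ∈ S := by rw [hF]; tauto
            simp [del, hu, huw, hvS, this]
          · simp [del, hu, huw]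
      rw [chainProd, hstar]
      have hw : ∀ b : Fin 2, b = 0 ∨ b = 1 := by decide
      rcases hw (y v) with h | h <;> rcases hw (y w) with h' | h' <;>
        simp [h, h', edgeFactor] <;> ring
    · intro u hu h
      rcases h with rfl | h
      · exact (List.nodup_cons.1 hn).1 hu
      · exact hS u (List.mem_cons_of_mem _ hu) h
    · intro u
      rw [hF, Set.mem_insert_iff, List.mem_cons (a := u) (b := v)]
      tauto

theorem del_empty (G : SimpleGraph V) : del G ∅ = G := by
  ext u v
  simp [del]

/-- Summing out the vertices of a chain, given the weight of its first vertex. -/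
def transfer (w : V → Fin 2 → ℂ) : (Fin 2 → ℂ) → List V → ℂ
  | A, [] => ∑ b, A b
  | A, u :: l => transfer w (fun b => (∑ c, A c * edgeFactor c b) * w u b) l

/-- Summing over both values of one coordinate counts every assignment twice. Accepting the factor
`2` avoids splitting the coordinate off. -/
theorem sum_update (v : V) (f : (V → Fin 2) → ℂ) :
    ∑ y, ∑ b, f (Function.update y v b) = 2 * ∑ y, f y := by
  have h : ∀ y, ∑ b, f (Function.update y v b) =
      f y + f (Function.update y v (1 - y v)) := by
    intro y
    have hb : ∀ b : Fin 2, b = 0 ∨ b = 1 := by decide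
    have hy : y = Function.update y v (y v) := by simp
    rw [Fin.sum_univ_two]
    rcases hb (y v) with h | h
    · conv_rhs => rw [h]
      rw [h] at hy
      rw [← hy]; rfl
    · conv_rhs => rw [h]
      rw [h] at hy
      rw [← hy, add_comm]; rfl
  have hinv : Function.Involutive fun y : V → Fin 2 => Function.update y v (1 - y v) := by
    intro y
    simp
  simp only [h, Finset.sum_add_distrib]
  have e : ∑ y, f (Function.update y v (1 - y v)) = ∑ y, f y := Equiv.sum_comp hinv.toPerm f
  rw [e]
  ring

theorem chainProd_congr {w : V → Fin 2 → ℂ} {y y' : V → Fin 2} {v : V} {l : List V}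
    (h : ∀ u ∈ v :: l, y u = y' u) : chainProd w y v l = chainProd w y' v l := by
  induction l generalizing v with
  | nil => rfl
  | cons u l ih =>
    rw [chainProd, chainProd, h v (by simp), h u (by simp),
      ih fun z hz => h z (List.mem_cons_of_mem _ hz)]

/-- `K` does not see the first vertex, so this vertex can be summed out; its weight and the edge
sign turn into a weight of the next vertex. Each vertex costs a factor `2` by `sum_update`. -/
theorem sum_chain (w : V → Fin 2 → ℂ) (l : List V) (v : V) (A : Fin 2 → ℂ)
    (K : (V → Fin 2) → ℂ) (hn : (v :: l).Nodup) (hK : DependsOnly (fun u => u ∉ v :: l) K) :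
    2 ^ (l.length + 1) * ∑ y, K y * A (y v) * chainProd w y v l = transfer w A l * ∑ y, K y := by
  induction l generalizing v A with
  | nil =>
    have hKu : ∀ y b, K (Function.update y v b) = K y := by
      intro y b
      refine hK _ _ fun u hu => ?_
      rw [Function.update_of_ne (by simpa using hu)]
    have := sum_update v fun y => K y * A (y v)
    simp only [hKu, Function.update_self, ← Finset.mul_sum] at this
    simp only [chainProd, mul_one, List.length_nil, zero_add, pow_one, ← this, transfer,
      ← Finset.sum_mul]
    ring
  | cons u l ih =>
    have hKu : ∀ y b, K (Function.update y v b) = K y := by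
      intro y b
      refine hK _ _ fun z hz => ?_
      rw [Function.update_of_ne (by rintro rfl; exact hz (by simp))]
    have hv := List.nodup_cons.1 hn
    have hchain : ∀ y b, chainProd w (Function.update y v b) u l = chainProd w y u l := by
      intro y b
      refine chainProd_congr fun z hz => ?_
      rw [Function.update_of_ne (by rintro rfl; exact hv.1 hz)]
    have huv : u ≠ v := by rintro rfl; exact hv.1 (by simp)
    have := sum_update v fun y => K y * A (y v) * chainProd w y v (u :: l)
    simp only [hKu, Function.update_self, chainProd, hchain, Function.update_of_ne huv] at this
    have hih := ih u (fun b => (∑ c, A c * edgeFactor c b) * w u b) hv.2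
      (fun x y hxy => hK x y fun z hz => hxy z fun h => hz (List.mem_cons_of_mem _ h))
    rw [transfer, ← hih, List.length_cons, pow_succ, mul_assoc]
    simp only [chainProd]
    rw [← this]
    congr 1
    refine Finset.sum_congr rfl fun y _ => ?_
    rw [Finset.sum_mul, Finset.mul_sum, Finset.sum_mul]
    exact Finset.sum_congr rfl fun b _ => by ring

theorem chainProd_mul (f w : V → Fin 2 → ℂ) (y : V → Fin 2) (v : V) (l : List V) :
    chainProd (fun u b => f u b * w u b) y v l =
      (l.map fun u => f u (y u)).prod * chainProd w y v l := by
  induction l generalizing v with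
  | nil => simp [chainProd]
  | cons u l ih =>
    simp only [chainProd, ih, List.map_cons, List.prod_cons]
    ring

theorem chainProd_congr_weight {w w' : V → Fin 2 → ℂ} (y : V → Fin 2) (v : V) (l : List V)
    (h : ∀ u ∈ l, w u = w' u) : chainProd w y v l = chainProd w' y v l := by
  induction l generalizing v with
  | nil => rfl
  | cons u l ih =>
    rw [chainProd, chainProd, h u (by simp), ih u fun z hz => h z (List.mem_cons_of_mem _ hz)]

/-- A product of local operators on a graph state, where the vertices outside of an induced path
project onto assignments with prescribed signs `s` of the path vertices. -/
theorem tens_mulVec_graphState (G : SimpleGraph V) (M : V → Matrix (Fin 2) (Fin 2) ℂ) (s : V → ℂ)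
    (v : V) (l : List V) (hc : InducedChain G (v :: l)) (hn : (v :: l).Nodup) (x : V → Fin 2)
    (hs : ∀ y : V → Fin 2, (∀ u, u ∉ v :: l → M u (x u) (y u) ≠ 0) →
      ∀ u ∈ v :: l, outSign G {u | u ∈ v :: l} u y = s u) :
    ∃ K : (V → Fin 2) → ℂ,
      (∀ x', (∀ u, u ∉ v :: l → x' u = x u) → (tens M *ᵥ graphState G) x' =
        transfer (fun u b => M u (x' u) b * if b = 1 then s u else 1)
          (fun b => M v (x' v) b * if b = 1 then s v else 1) l * ∑ y, K y) := by
  classical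
  -- `K` collects the normalization, the operators outside of the path and the edges that avoid it.
  -- The inverse power of `2` makes up for the overcounting in `sum_chain`.
  refine ⟨fun y => (2 ^ (l.length + 1))⁻¹ * ((((Real.sqrt 2 : ℝ) : ℂ)⁻¹) ^ Fintype.card V *
    ((∏ u ∈ Finset.univ.filter fun u => u ∉ v :: l, M u (x u) (y u)) *
      edgeSign (del G {u | u ∈ v :: l}) y)), fun x' hx' => ?_⟩
  rw [← sum_chain _ l v _ _ hn]
  · rw [Finset.mul_sum]
    simp only [Matrix.mulVec, dotProduct, tens, Matrix.of_apply]
    refine Finset.sum_congr rfl fun y _ => ?_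
    have hprod : ∏ u, M u (x' u) (y u) = (∏ u ∈ Finset.univ.filter fun u => u ∉ v :: l,
        M u (x u) (y u)) * (M v (x' v) (y v) * (l.map fun u => M u (x' u) (y u)).prod) := by
      rw [← Finset.prod_filter_mul_prod_filter_not Finset.univ fun u => u ∉ v :: l]
      congr 1
      · refine Finset.prod_congr rfl fun u hu => ?_
        rw [hx' u (Finset.mem_filter.1 hu).2]
      · rw [← List.prod_cons, ← List.map_cons (f := fun u => M u (x' u) (y u)),
          ← List.prod_toFinset _ hn]
        refine Finset.prod_congr ?_ fun _ _ => rfl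
        ext u
        simp
        tauto
    rw [hprod, graphState_eq]
    have h2 : (2 : ℂ) ^ (l.length + 1) ≠ 0 := pow_ne_zero _ two_ne_zero
    -- Assignments that survive the operators outside of the path have the prescribed signs; for the
    -- others both sides are zero.
    by_cases hzero : ∀ u, u ∉ v :: l → M u (x u) (y u) ≠ 0
    · have hes : edgeSign G y = (if y v = 1 then s v else 1) *
          chainProd (fun u b => if b = 1 then s u else 1) y v l *
            edgeSign (del G {u | u ∈ v :: l}) y := by
        conv_lhs => rw [← del_empty G, edgeSign_chain G {u | u ∈ v :: l} y l v ∅ hc hn (by simp)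
          (by simp)]
        rw [hs y hzero v (by simp)]
        congr 2
        refine chainProd_congr_weight y v l fun u hu => ?_
        rw [hs y hzero u (List.mem_cons_of_mem _ hu)]
      rw [hes, chainProd_mul]
      field_simp
    · push Not at hzero
      obtain ⟨u, hu, hu0⟩ := hzero
      rw [Finset.prod_eq_zero (Finset.mem_filter.2 ⟨Finset.mem_univ u, hu⟩) hu0]
      simp
  · intro y y' hyy
    have h1 : ∏ u ∈ Finset.univ.filter fun u => u ∉ v :: l, M u (x u) (y u) =
        ∏ u ∈ Finset.univ.filter fun u => u ∉ v :: l, M u (x u) (y' u) := by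
      refine Finset.prod_congr rfl fun u hu => ?_
      rw [hyy u (Finset.mem_filter.1 hu).2]
    have h2 : edgeSign (del G {u | u ∈ v :: l}) y = edgeSign (del G {u | u ∈ v :: l}) y' := by
      unfold edgeSign
      refine Finset.prod_congr rfl fun e he =>
        if_congr (forall_congr' fun u => forall_congr' fun hu => ?_) rfl rfl
      rw [hyy u]
      rw [SimpleGraph.mem_edgeFinset] at he
      induction e with
      | h a b =>
        have h := he.2
        rcases Sym2.mem_iff.1 hu with rfl | rfl
        · exact h.1
        · exact h.2
    simp only [h1, h2]

end Chain

end

section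

/-! ### Shortest paths -/

/-- An edge from a vertex to a later one other than its successor would give a shorter walk. The
tail of a shortest walk is again shortest, so induction applies. -/
theorem InducedChain.of_shortest {V : Type} [Fintype V] [DecidableEq V] {G : SimpleGraph V}
    {u v : V} (p : G.Walk u v) (hp : p.length = G.dist u v) : InducedChain G p.support := by
  induction p with
  | nil => trivial
  | @cons u w v h p ih =>
    have hp' : p.length = G.dist w v := by
      refine le_antisymm ?_ (SimpleGraph.dist_le p)
      obtain ⟨q, hq⟩ := p.reachable.exists_walk_length_eq_dist
      have h1 := SimpleGraph.dist_le (SimpleGraph.Walk.cons h q)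
      rw [SimpleGraph.Walk.length_cons] at h1 hp
      omega
    have hchain := ih hp'
    rw [SimpleGraph.Walk.support_cons, ← SimpleGraph.Walk.cons_tail_support p]
    refine ⟨h, fun x hx hux => ?_, by rwa [SimpleGraph.Walk.cons_tail_support]⟩
    have hpath := p.isPath_of_length_eq_dist hp'
    have hxw : x ≠ w := by
      rintro rfl
      have := hpath.support_nodup
      rw [← SimpleGraph.Walk.cons_tail_support p] at this
      exact (List.nodup_cons.1 this).1 hx
    have hmem : x ∈ p.support := List.mem_of_mem_tail hx
    have h1 := SimpleGraph.Walk.length_dropUntil_lt_length hmem hxw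
    have h2 := SimpleGraph.dist_le (SimpleGraph.Walk.cons hux (p.dropUntil x hmem))
    rw [SimpleGraph.Walk.length_cons] at h2 hp
    omega

variable {n : ℕ}

namespace PathData

/-- The path of the data is a shortest path from `j` to the reference system. -/
def HasShortestPath (d : PathData n) (j : Fin n) : Prop :=
  ∃ w : d.graph.Walk (some j) none, w.support = d.path ∧ w.length = d.graph.dist (some j) none

variable {d : PathData n} {j : Fin n}

theorem HasShortestPath.nodup (h : d.HasShortestPath j) : d.path.Nodup := by
  obtain ⟨w, hw, hl⟩ := h
  rw [← hw]
  exact (w.isPath_of_length_eq_dist hl).support_nodup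

theorem HasShortestPath.induced (h : d.HasShortestPath j) : InducedChain d.graph d.path := by
  obtain ⟨w, hw, hl⟩ := h
  rw [← hw]
  exact InducedChain.of_shortest w hl

theorem map_some_reduceOption {α : Type} (l : List (Option α)) (h : none ∉ l) :
    l.reduceOption.map some = l := by
  induction l with
  | nil => rfl
  | cons a l ih =>
    cases a with
    | none => simp at h
    | some a =>
      rw [List.reduceOption_cons_of_some, List.map_cons, ih fun h' => h (List.mem_cons_of_mem _ h')]

/-- The reference system is the end of the path and occurs only once, so `reduceOption` removes just
the last entry of the tail. -/
theorem HasShortestPath.path_eq (h : d.HasShortestPath j) :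
    d.path = some j :: (d.inner.map some ++ [none]) := by
  have hn := h.nodup
  obtain ⟨w, hw, hl⟩ := h
  have h1 : d.path = some j :: d.path.tail := by
    rw [← hw]; exact (SimpleGraph.Walk.cons_tail_support w).symm
  have hne : d.path ≠ [] := by rw [h1]; simp
  have hlast : d.path.getLast hne = none := by
    simp only [← hw]
    exact SimpleGraph.Walk.getLast_support w
  have htail : d.path.tail ≠ [] := by
    intro h0
    rw [h0] at h1
    simp only [h1, List.getLast_singleton] at hlast
    exact absurd hlast (by simp)
  have h2 : d.path.tail = d.path.tail.dropLast ++ [none] := by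
    rw [← hlast, ← List.getLast_tail htail, List.dropLast_append_getLast]
  have h3 : d.inner = d.path.tail.dropLast.reduceOption := by
    rw [inner, h2, List.reduceOption_append]
    simp
  have h4 : none ∉ d.path.tail.dropLast := by
    rw [h1, h2] at hn
    have := (List.nodup_cons.1 hn).2
    rw [List.nodup_append] at this
    exact fun hmem => this.2.2 _ hmem none (by simp) rfl
  rw [h3, map_some_reduceOption _ h4, ← h2, ← h1]

theorem HasShortestPath.inner_nodup (h : d.HasShortestPath j) : d.inner.Nodup := by
  have := h.nodup
  rw [h.path_eq, List.nodup_cons, List.nodup_append] at this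
  exact this.2.1.of_map _

theorem HasShortestPath.notMem_inner (h : d.HasShortestPath j) : j ∉ d.inner := by
  have := h.nodup
  rw [h.path_eq, List.nodup_cons] at this
  exact fun hj => this.1 (by simp [hj])

theorem mem_side {u : Fin n} :
    u ∈ d.side ↔ some u ∉ d.path ∧ ∃ v ∈ d.path, d.graph.Adj v (some u) := by
  simp [side]

theorem HasShortestPath.mem_path (h : d.HasShortestPath j) {u : Fin n} :
    some u ∈ d.path ↔ u = j ∨ u ∈ d.inner := by
  rw [h.path_eq]
  simp

theorem HasShortestPath.none_mem_path (h : d.HasShortestPath j) : none ∈ d.path := by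
  rw [h.path_eq]
  simp

theorem side_nodup : d.side.Nodup := (List.nodup_finRange n).filter _

theorem innerTurns_party (u : Option (Fin n)) (vs : List (Fin n)) :
    (d.innerTurns u vs).map Turn.party = vs := by
  induction vs generalizing u with
  | nil => rfl
  | cons v vs ih => simp [innerTurns, ih]

theorem protocol_party : (d.protocol j).turns.map Turn.party = d.side ++ d.inner := by
  simp [protocol, sideTurns, innerTurns_party, Function.comp_def]

theorem HasShortestPath.isOneWay (h : d.HasShortestPath j) : (d.protocol j).IsOneWay j := by
  rw [PauliProtocol.IsOneWay, protocol_party, List.nodup_append, List.nodup_append]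
  refine ⟨⟨side_nodup, h.inner_nodup, ?_⟩, List.nodup_singleton j, ?_⟩
  · rintro a ha _ hb rfl
    exact (mem_side.1 ha).1 (h.mem_path.2 (Or.inr hb))
  · rintro a ha b hb rfl
    rw [List.mem_singleton] at hb
    subst hb
    rcases List.mem_append.1 ha with ha | ha
    · exact (mem_side.1 ha).1 (h.mem_path.2 (Or.inl rfl))
    · exact h.notMem_inner ha

end PathData

/-! ### The branches of a one-way protocol -/

/-- No correction depends on outcomes that are announced later. -/
def Causal : List (Turn n) → Prop
  | [] => True
  | t :: ts => (∀ o o' : Fin n → Fin 2, (∀ k, k ∉ (t :: ts).map Turn.party → o k = o' k) →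
      t.correction o = t.correction o') ∧ Causal ts

theorem PathData.count_congr (d : PathData n) (v : Option (Fin n)) {o o' : Fin n → Fin 2}
    (h : ∀ k ∈ d.side, o k = o' k) : d.count v o = d.count v o' := by
  unfold PathData.count
  congr 1
  refine List.map_congr_left fun k hk => ?_
  rw [h k hk]

/-- A correction uses the outcomes of the side parties and of the preceding inner vertex, all of
which have been announced before. -/
theorem PathData.causal_innerTurns (d : PathData n) (u : Option (Fin n)) (vs : List (Fin n))
    (hs : ∀ k ∈ d.side, k ∉ vs) (hu : ∀ k, u = some k → k ∉ vs) (hn : vs.Nodup) :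
    Causal (d.innerTurns u vs) := by
  induction vs generalizing u with
  | nil => trivial
  | cons v vs ih =>
    refine ⟨fun o o' h => ?_, ih (some v) (fun k hk h => hs k hk (List.mem_cons_of_mem _ h))
      (fun k hk => ?_) (List.nodup_cons.1 hn).2⟩
    · change ∀ k, k ∉ (d.innerTurns u (v :: vs)).map Turn.party → o k = o' k at h
      rw [PathData.innerTurns_party] at h
      have h1 := d.count_congr (some v) fun k hk => h k (hs k hk)
      have h2 : PathData.carry o u = PathData.carry o' u := by
        cases u with
        | none => rfl
        | some k => simp [PathData.carry, h k (hu k rfl)]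
      simp only [h1, h2]
    · cases hk
      exact (List.nodup_cons.1 hn).1

theorem PathData.HasShortestPath.causal {d : PathData n} {j : Fin n} (h : d.HasShortestPath j) :
    Causal (d.protocol j).turns := by
  have hinner : Causal (d.innerTurns none d.inner) := by
    refine d.causal_innerTurns none d.inner (fun k hk hk' => ?_) (by simp) h.inner_nodup
    exact (PathData.mem_side.1 hk).1 (h.mem_path.2 (Or.inr hk'))
  have : ∀ l : List (Fin n), Causal ((l.map fun u => (⟨u, .z, fun _ => d.clifford (some u)⟩ :
      Turn n)) ++ d.innerTurns none d.inner) := by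
    intro l
    induction l with
    | nil => exact hinner
    | cons u l ih => exact ⟨fun _ _ _ => rfl, ih⟩
  exact this d.side

theorem lift_one : lift 1 = 1 := by simp [lift]

theorem lift_mul (M N : Matrix (Fin 2) (Fin 2) ℂ) : lift M * lift N = lift (M * N) := by
  simp [lift, ← Matrix.mul_kronecker_mul]

theorem localOp_lift (k : Fin n) (K : Matrix (Fin 2) (Fin 2) ℂ) :
    localOp k (lift K) = tens fun v => lift (Function.update (fun _ => (1 : Matrix (Fin 2) (Fin 2) ℂ)) k K v) := by
  rw [localOp_eq_tens]
  congr 1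
  funext v
  by_cases hv : v = k
  · subst hv; simp
  · simp [hv, lift_one]

/-- No party has two turns, so an outcome once recorded is never overwritten, and by causality a
correction computed from the partial record equals the one computed from the final record. So all
operators of a branch can be expressed by one record `out i`. -/
theorem exists_outcomes (j : Fin n) (final : (Fin n → Fin 2) → List Gate) (ts : List (Turn n))
    (hn : (ts.map Turn.party ++ [j]).Nodup) (hc : Causal ts) (o : Fin n → Fin 2) :
    ∃ (ι : Type) (_ : Fintype ι) (out : ι → Fin n → Fin 2)
      (N : ι → Fin n → Matrix (Fin 2) (Fin 2) ℂ),
      (∀ σ, (runTurns j final ts o).channel σ =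
        ∑ i, (tens fun v => lift (N i v)) * σ * (tens fun v => lift (N i v))ᴴ) ∧
      ∀ i, (∀ k, k ∉ ts.map Turn.party → out i k = o k) ∧ N i j = cliff (final (out i)) ∧
        (∀ t ∈ ts, N i t.party = t.axis.proj (out i t.party) * cliff (t.correction (out i))) ∧
        ∀ v, v ≠ j → v ∉ ts.map Turn.party → N i v = 1 := by
  induction ts generalizing o with
  | nil =>
    refine ⟨Unit, inferInstance, fun _ => o, fun _ => Function.update (fun _ => (1 : Matrix (Fin 2) (Fin 2) ℂ)) j
      (cliff (final o)), fun σ => ?_, fun _ => ⟨fun _ _ => rfl, by simp, by simp, ?_⟩⟩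
    · simp [runTurns, LOCCProtocol.channel, localOp_lift]
    · intro v hv _
      simp [hv]
  | cons t ts ih =>
    rw [List.map_cons, List.cons_append, List.nodup_cons] at hn
    have htj : t.party ≠ j := fun h => hn.1 (by simp [h])
    have htt : t.party ∉ ts.map Turn.party := fun h => hn.1 (List.mem_append_left _ h)
    choose ι hι out N hN h using fun r => ih hn.2 hc.2 (Function.update o t.party r)
    refine ⟨Σ r : Fin 2, ι r, inferInstance, fun i => out i.1 i.2, fun i v => N i.1 i.2 v *
      Function.update (fun _ => (1 : Matrix (Fin 2) (Fin 2) ℂ)) t.party (t.axis.proj i.1 * cliff (t.correction o)) v,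
      fun σ => ?_, fun ⟨r, i⟩ => ?_⟩
    · rw [runTurns, LOCCProtocol.channel, Fintype.sum_sigma]
      refine Finset.sum_congr rfl fun r _ => ?_
      rw [hN]
      refine Finset.sum_congr rfl fun i _ => ?_
      rw [localOp_lift]
      simp only [← lift_mul, ← tens_mul, Matrix.conjTranspose_mul, Matrix.mul_assoc]
    · dsimp only
      obtain ⟨h1, h2, h3, h4⟩ := h r i
      have hout : out r i t.party = r := by rw [h1 _ htt, Function.update_self]
      have hcorr : t.correction o = t.correction (out r i) := by
        refine hc.1 _ _ fun k hk => ?_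
        rw [List.map_cons, List.mem_cons, not_or] at hk
        rw [h1 k hk.2, Function.update_of_ne hk.1]
      refine ⟨fun k hk => ?_, ?_, ?_, ?_⟩
      · rw [List.map_cons, List.mem_cons, not_or] at hk
        rw [h1 k hk.2, Function.update_of_ne hk.1]
      · simp [h2, Function.update_of_ne htj.symm]
      · intro t' ht'
        rcases List.mem_cons.1 ht' with rfl | ht'
        · rw [Function.update_self, h4 _ htj htt, Matrix.one_mul, hout, ← hcorr]
        · have : t'.party ≠ t.party := fun h' => htt (h' ▸ List.mem_map_of_mem ht')
          simp only [Function.update_of_ne this, Matrix.mul_one]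
          exact h3 t' ht'
      · intro v hv hvt
        rw [List.map_cons, List.mem_cons, not_or] at hvt
        simp [Function.update_of_ne hvt.1, h4 v hv hvt.2]

theorem tens_lift_mulVec (N : Fin n → Matrix (Fin 2) (Fin 2) ℂ) (φ : (Fin n → Fin 2) → ℂ)
    (x : Fin n → Loc 0) : ((tens fun v => lift (N v)) *ᵥ withAncillas 0 φ) x =
      (tens N *ᵥ φ) fun k => (x k).1 := by
  simp only [Matrix.mulVec, dotProduct, tens, Matrix.of_apply]
  let e : Fin 2 ≃ Loc 0 := (Equiv.prodUnique (Fin 2) (Fin 1)).symm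
  refine (Equiv.sum_comp (Equiv.arrowCongr (Equiv.refl (Fin n)) e) _).symm.trans ?_
  refine Finset.sum_congr rfl fun y _ => ?_
  have h1 : ∀ k, (Equiv.arrowCongr (Equiv.refl (Fin n)) e) y k = (y k, 0) := fun k => rfl
  simp only [h1, lift, withAncillas, implies_true, if_true]
  congr 1
  refine Finset.prod_congr rfl fun k _ => ?_
  have h2 : (x k).2 = 0 := Fin.fin_one_eq_zero _
  rw [Matrix.kroneckerMap_apply, h2, Matrix.one_apply_eq, mul_one]

/-- The action on the components of a vector that belong to the parties. -/
theorem tens_mulVec_slice (N : Fin n → Matrix (Fin 2) (Fin 2) ℂ) (Φ : (Option (Fin n) → Fin 2) → ℂ)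
    (a : Fin 2) (x : Fin n → Fin 2) : (tens N *ᵥ slice Φ a) x =
      (tens (fun v : Option (Fin n) => v.elim 1 N) *ᵥ Φ) (withRef a x) := by
  simp only [Matrix.mulVec, dotProduct, tens, Matrix.of_apply]
  obtain ⟨e, he⟩ : ∃ e : (Fin 2 × (Fin n → Fin 2)) ≃ (Option (Fin n) → Fin 2),
      ∀ c y, e (c, y) = withRef c y :=
    ⟨⟨fun p => withRef p.1 p.2, fun y => (y none, fun k => y (some k)), fun _ => rfl,
      withRef_eta⟩, fun _ _ => rfl⟩
  rw [← Equiv.sum_comp e, Fintype.sum_prod_type, Finset.sum_eq_single a]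
  · refine Finset.sum_congr rfl fun y _ => ?_
    simp [he, Fintype.prod_option, withRef, slice]
  · intro c _ hc
    refine Finset.sum_eq_zero fun y _ => ?_
    simp [he, Fintype.prod_option, withRef, Matrix.one_apply_ne hc.symm]
  · simp

end

section

/-! ### The transfer matrices of the protocol -/

/-- The matrix `Z ^ m`. -/
def zMat (m : ℕ) : Matrix (Fin 2) (Fin 2) ℂ := !![1, 0; 0, (-1) ^ m]

/-- The matrix `X ^ m`. -/
def xMat (m : ℕ) : Matrix (Fin 2) (Fin 2) ℂ := Letter.x.mat ^ m

/-- The matrix of the signs of an edge. -/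
def edgeMat : Matrix (Fin 2) (Fin 2) ℂ := !![1, 1; 1, -1]

theorem cliff_zPow (m : ℕ) : cliff (zPow m) = zMat m := by
  rw [zPow, cliff_replicate, s_pow, zMat, pow_mul, Complex.I_sq]

/-- The correction `Z ^ m` cancels the sign that the measured neighbours leave at a vertex. -/
theorem zMat_apply_mul_sign (M : Matrix (Fin 2) (Fin 2) ℂ) (m : ℕ) (i b : Fin 2) :
    (M * zMat m) i b * (if b = 1 then (-1) ^ m else 1) = M i b := by
  have h : ((-1 : ℂ) ^ m) * (-1) ^ m = 1 := by rw [← mul_pow]; simp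
  rcases (by decide : ∀ b : Fin 2, b = 0 ∨ b = 1) b with rfl | rfl
  · simp [zMat, Matrix.mul_apply, Fin.sum_univ_two]
  · simp [zMat, Matrix.mul_apply, Fin.sum_univ_two, mul_assoc, h]

theorem sum_edgeFactor (A : Fin 2 → ℂ) (b : Fin 2) :
    ∑ c, A c * edgeFactor c b = ∑ c, A c * edgeMat c b := by
  refine Finset.sum_congr rfl fun c _ => ?_
  congr 1
  fin_cases c <;> fin_cases b <;> simp [edgeFactor, edgeMat]

theorem zMat_zero : zMat 0 = 1 := by
  ext i k; fin_cases i <;> fin_cases k <;> simp [zMat]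

theorem hadamard_mul_edgeMat :
    Gate.h.mat * edgeMat = ((Real.sqrt 2 : ℝ) : ℂ) • (1 : Matrix (Fin 2) (Fin 2) ℂ) := by
  have h : ((Real.sqrt 2 : ℝ) : ℂ)⁻¹ * 2 = ((Real.sqrt 2 : ℝ) : ℂ) := by
    rw [← sqrt_two_mul_self, ← mul_assoc, inv_mul_cancel₀ sqrt_two_ne_zero, one_mul]
  ext i k
  fin_cases i <;> fin_cases k <;>
    simp [Gate.mat, edgeMat, Matrix.mul_apply, Fin.sum_univ_two, ← two_mul] <;>
    rw [mul_comm, h]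

/-- `H` inverts the edge matrix up to `√2`. For outcome `|-⟩` the two powers of `Z` cancel as well.
For `|+⟩` the `Z` in front of the edge reappears behind it as `X`, and this `X` is what the next
vertex has to correct. -/
theorem cliff_sqrtY (r : Fin 2) : cliff (PathData.sqrtY r) * edgeMat * zMat r =
    ((Real.sqrt 2 : ℝ) : ℂ) • xMat (1 - (r : ℕ)) := by
  have h2 := hadamard_mul_edgeMat
  rcases (by decide : ∀ b : Fin 2, b = 0 ∨ b = 1) r with rfl | rfl
  · have h3 : zMat 1 * edgeMat = edgeMat * Letter.x.mat := by
      ext i k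
      fin_cases i <;> fin_cases k <;>
        simp [zMat, edgeMat, Letter.mat, Matrix.mul_apply, Fin.sum_univ_two]
    have h4 : cliff (PathData.sqrtY 0) = Gate.h.mat * zMat 1 := by
      rw [← cliff_zPow]
      simp [PathData.sqrtY, cliff]
    have h5 : zMat ((0 : Fin 2) : ℕ) = 1 := zMat_zero
    have h6 : xMat (1 - ((0 : Fin 2) : ℕ)) = Letter.x.mat := pow_one _
    rw [h4, Matrix.mul_assoc Gate.h.mat, h3, ← Matrix.mul_assoc, h2, h5, h6, Matrix.mul_one,
      smul_mul_assoc, Matrix.one_mul]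
  · have h4 : cliff (PathData.sqrtY 1) = zMat 1 * Gate.h.mat := by
      rw [← cliff_zPow, PathData.sqrtY, if_neg (by decide), cliff_append]
      simp [cliff]
    have h5 : zMat ((1 : Fin 2) : ℕ) = zMat 1 := rfl
    have h6 : xMat (1 - ((1 : Fin 2) : ℕ)) = 1 := pow_zero _
    have h7 : zMat 1 * zMat 1 = 1 := by
      ext i k; fin_cases i <;> fin_cases k <;> simp [zMat, Matrix.mul_apply, Fin.sum_univ_two]
    rw [h4, Matrix.mul_assoc (zMat 1), h2, h5, h6, mul_smul_comm, Matrix.mul_one,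
      smul_mul_assoc, h7]

/-- A leftover `X` becomes a `Z` when it passes the next edge, and this is the exponent `carry` of
the correction there. -/
theorem xMat_mul_edgeMat {c : ℕ} (hc : c ≤ 1) : xMat c * edgeMat = edgeMat * zMat c := by
  interval_cases c
  · simp [xMat, zMat_zero]
  · ext i k
    fin_cases i <;> fin_cases k <;>
      simp [xMat, zMat, edgeMat, Letter.mat, Matrix.mul_apply, Fin.sum_univ_two]

theorem zMat_mul (a b : ℕ) : zMat a * zMat b = zMat (a + b) := by
  ext i k
  fin_cases i <;> fin_cases k <;> simp [zMat, Matrix.mul_apply, Fin.sum_univ_two, pow_add]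

theorem zMat_two_mul (a : ℕ) : zMat (a + a) = 1 := by
  ext i k
  fin_cases i <;> fin_cases k <;> simp [zMat, ← two_mul]

theorem proj_x_mul_zMat_apply (r x b : Fin 2) (m : ℕ) :
    (Axis.x.proj r * zMat m) x b = (1 / 2 * if x = 1 then (-1) ^ (r : ℕ) else 1) *
      (if b = 1 then (-1) ^ ((r : ℕ) + m) else 1) := by
  fin_cases r <;> fin_cases x <;> fin_cases b <;>
    simp [Axis.proj, Axis.mat, Letter.mat, zMat, Matrix.mul_apply, Fin.sum_univ_two, pow_add]

theorem PathData.carry_le (o : Fin n → Fin 2) (u : Option (Fin n)) : carry o u ≤ 1 := by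
  cases u
  · exact Nat.zero_le 1
  · exact Nat.sub_le 1 _

variable {n : ℕ} (d : PathData n)

/-- Summing out the inner vertices of the path cancels the corrections of party `j` for their
outcomes. -/
theorem transfer_innerTurns (o x : Fin n → Fin 2) (vs : List (Fin n)) (p : Option (Fin n)) :
    ∃ κ : ℂ, ∀ w : Option (Fin n) → Fin 2 → ℂ,
      (∀ t ∈ d.innerTurns p vs, ∀ b, w (some t.party) b =
        (t.axis.proj (o t.party) * (cliff (t.correction o) *
          (cliff (d.clifford (some t.party)))ᴴ)) (x t.party) b *
            if b = 1 then (-1) ^ d.count (some t.party) o else 1) →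
      ∀ (Q : Matrix (Fin 2) (Fin 2) ℂ) (i : Fin 2),
        transfer w (fun b => (Q * (cliff (vs.reverse.flatMap fun v => PathData.sqrtY (o v)) *
          xMat (PathData.carry o p))) i b) (vs.map some ++ [none]) =
        κ * transfer w (fun b => (Q * xMat (PathData.carry o (vs.getLast?.or p))) i b) [none] := by
  induction vs generalizing p with
  | nil => exact ⟨1, fun w _ Q i => by simp [cliff]⟩
  | cons v vs ih =>
    obtain ⟨κ, h⟩ := ih (some v)
    -- One inner vertex contributes the `1 / 2` and the sign from its projector and the `√2` of
    -- `cliff_sqrtY`.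
    refine ⟨1 / 2 * (if x v = 1 then (-1) ^ (o v : ℕ) else 1) * ((Real.sqrt 2 : ℝ) : ℂ) * κ,
      fun w hw Q i => ?_⟩
    have hv := hw _ (List.mem_cons_self ..)
    have hlast : (v :: vs).getLast?.or p = vs.getLast?.or (some v) := by
      rw [List.getLast?_cons]
      cases vs.getLast? <;> rfl
    rw [hlast, mul_assoc _ κ, ← h w (fun t ht => hw t (List.mem_cons_of_mem _ ht))]
    rw [List.map_cons, List.cons_append, transfer]
    have hlin : ∀ (l : List (Option (Fin n))) (c : ℂ) (A : Fin 2 → ℂ),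
        transfer w (fun b => c * A b) l = c * transfer w A l := by
      intro l
      induction l with
      | nil => intro c A; simp [transfer, mul_add]
      | cons u l ih =>
        intro c A
        rw [transfer, transfer, ← ih]
        congr 1
        funext b
        simp only [mul_assoc, ← Finset.mul_sum]
    rw [← hlin]
    congr 1
    funext b
    rw [sum_edgeFactor, ← Matrix.mul_apply, hv b]
    dsimp only
    have hU : cliff (d.clifford (some v)) * (cliff (d.clifford (some v)))ᴴ = 1 :=
      mul_eq_one_comm.1 (cliff_unitary _)
    rw [cliff_append, cliff_zPow, Matrix.mul_assoc (zMat _), hU, Matrix.mul_one,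
      proj_x_mul_zMat_apply]
    -- The signs of the measured neighbours meet the correction for them and disappear. The carried
    -- correction and the sign of the outcome at `v` remain.
    have hsign : ∀ M : Matrix (Fin 2) (Fin 2) ℂ, M i b * (if b = 1 then (-1) ^ ((o v : ℕ) +
        (d.count (some v) o + PathData.carry o p)) else 1) *
        (if b = 1 then (-1) ^ d.count (some v) o else 1) =
          (M * zMat (PathData.carry o p + (o v : ℕ))) i b := by
      intro M
      have h1 : ((-1 : ℂ) ^ d.count (some v) o) * (-1) ^ d.count (some v) o = 1 := by
        rw [← mul_pow]; simp
      rcases (by decide : ∀ b : Fin 2, b = 0 ∨ b = 1) b with rfl | rfl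
      · simp [zMat, Matrix.mul_apply, Fin.sum_univ_two]
      · simp only [if_true, zMat, Matrix.mul_apply, Fin.sum_univ_two]
        simp only [pow_add, Matrix.of_apply, Matrix.cons_val', Matrix.cons_val_one,
          Matrix.cons_val_zero, Matrix.cons_val_fin_one, mul_zero, zero_add]
        linear_combination (M i 1 * (-1) ^ (o v : ℕ) * (-1) ^ PathData.carry o p) * h1
    have hmat : Q * (cliff ((v :: vs).reverse.flatMap fun v => PathData.sqrtY (o v)) *
        xMat (PathData.carry o p)) * edgeMat * zMat (PathData.carry o p + (o v : ℕ)) =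
          ((Real.sqrt 2 : ℝ) : ℂ) • (Q * (cliff (vs.reverse.flatMap fun v =>
            PathData.sqrtY (o v)) * xMat (PathData.carry o (some v)))) := by
      rw [List.reverse_cons, List.flatMap_append, cliff_append, List.flatMap_singleton]
      have h1 : xMat (PathData.carry o p) * edgeMat * zMat (PathData.carry o p + (o v : ℕ)) =
          edgeMat * zMat (o v) := by
        rw [xMat_mul_edgeMat (PathData.carry_le o p), Matrix.mul_assoc, zMat_mul, ← add_assoc,
          ← zMat_mul, zMat_two_mul, Matrix.one_mul]
      have h2 := cliff_sqrtY (o v)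
      rw [Matrix.mul_assoc] at h1 h2
      simp only [Matrix.mul_assoc]
      rw [h1, h2, mul_smul_comm, mul_smul_comm]
      rfl
    have := congrFun (congrFun hmat i) b
    rw [Matrix.smul_apply, smul_eq_mul] at this
    rw [← hsign] at this
    linear_combination (1 / 2 * if x v = 1 then (-1 : ℂ) ^ (o v : ℕ) else 1) * this

/-- `H` undoes the last edge, the corrections cancel the carried `Z` and the signs of the
neighbours, and `Wᵀ` applied by party `j` meets `Wᴴ` at the reference system. Unitarity of `W`
leaves a multiple of the identity. -/
theorem transfer_reference (w : Option (Fin n) → Fin 2 → ℂ) (W : Matrix (Fin 2) (Fin 2) ℂ)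
    (hW : Wᴴ * W = 1) (m : ℕ) {c : ℕ} (hc : c ≤ 1) (a i : Fin 2)
    (hw : ∀ b, w none b = Wᴴ a b * if b = 1 then (-1) ^ m else 1) :
    transfer w (fun b => (Wᵀ * zMat (m + c) * Gate.h.mat * xMat c) i b) [none] =
      if i = a then ((Real.sqrt 2 : ℝ) : ℂ) else 0 := by
  have h1 : Wᵀ * zMat (m + c) * Gate.h.mat * xMat c * edgeMat =
      ((Real.sqrt 2 : ℝ) : ℂ) • (Wᵀ * zMat m) := by
    rw [Matrix.mul_assoc _ (xMat c), xMat_mul_edgeMat hc, Matrix.mul_assoc _ Gate.h.mat,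
      ← Matrix.mul_assoc Gate.h.mat, hadamard_mul_edgeMat, smul_mul_assoc, Matrix.one_mul, mul_smul_comm,
      Matrix.mul_assoc, zMat_mul, add_assoc, ← zMat_mul, zMat_two_mul, Matrix.mul_one]
  rw [transfer, transfer]
  simp only [sum_edgeFactor, ← Matrix.mul_apply, h1, hw]
  have h4 : ∀ b, (((Real.sqrt 2 : ℝ) : ℂ) • (Wᵀ * zMat m)) i b *
      (Wᴴ a b * if b = 1 then (-1) ^ m else 1) = ((Real.sqrt 2 : ℝ) : ℂ) * (Wᴴ a b * W b i) := by
    intro b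
    have := zMat_apply_mul_sign Wᵀ m i b
    rw [Matrix.transpose_apply] at this
    rw [Matrix.smul_apply, smul_eq_mul, ← this]
    ring
  rw [Finset.sum_congr rfl fun b _ => h4 b, ← Finset.mul_sum, ← Matrix.mul_apply, hW,
    Matrix.one_apply]
  simp only [mul_ite, mul_one, mul_zero, eq_comm (a := a)]

end

section

/-! ### The protocol along a shortest path extracts the quantum information -/

variable {n m : ℕ} {g : Fin m → PauliOp n} {b : LogicalBasis g} {d : PathData n} {j : Fin n}

theorem cliff_reverse (w : List Gate) : cliff w.reverse = (cliff w)ᵀ := by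
  have hg : ∀ a : Gate, a.matᵀ = a.mat := by
    intro a
    cases a <;> ext i k <;> fin_cases i <;> fin_cases k <;> simp [Gate.mat]
  induction w with
  | nil => simp [cliff]
  | cons a w ih =>
    rw [List.reverse_cons, cliff_append, ih]
    simp [cliff, Matrix.transpose_mul, hg]

/-- The neighbours of `v` outside of the path are side parties, and their state is their outcome.
The reference system is on the path and gives no sign. -/
theorem neg_one_pow_count (d : PathData n) (v : Option (Fin n)) (hv : v ∈ d.path)
    (o : Fin n → Fin 2) (y : Option (Fin n) → Fin 2) (hnone : none ∈ d.path)
    (hy : ∀ u ∈ d.side, y (some u) = o u) :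
    outSign d.graph {u | u ∈ d.path} v y = (-1) ^ d.count v o := by
  classical
  have key : ∀ (L : List (Fin n)) (P : Fin n → Prop) [DecidablePred P] (f : Fin n → ℕ),
      (-1 : ℂ) ^ ((L.filter P).map f).sum =
        (L.map fun u => if P u then (-1 : ℂ) ^ f u else 1).prod := by
    intro L P _ f
    induction L with
    | nil => simp
    | cons a L ih => by_cases ha : P a <;> simp [ha, ih, pow_add]
  rw [PathData.count, PathData.side, key, ← Fin.prod_univ_def, outSign, Fintype.prod_option]
  rw [if_neg (c := d.graph.Adj v none ∧ none ∉ {u | u ∈ d.path} ∧ y none = 1)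
    fun h => h.2.1 hnone, one_mul]
  refine Finset.prod_congr rfl fun u _ => ?_
  by_cases hu : some u ∉ d.path
  · by_cases hadj : d.graph.Adj v (some u)
    · have hside : u ∈ d.side := PathData.mem_side.2 ⟨hu, v, hv, hadj⟩
      rw [if_pos (⟨hu, v, hv, hadj⟩ : _ ∧ _), if_pos hadj.symm, ← hy u hside]
      rcases (by decide : ∀ b : Fin 2, b = 0 ∨ b = 1) (y (some u)) with h | h <;>
        simp [h, hadj, hu]
    · rw [if_neg fun h => hadj h.1, if_neg fun h : d.graph.Adj (some u) v => hadj h.symm]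
      simp
  · rw [if_neg fun h => h.2.1 (by simpa using hu), if_neg fun h => hu h.1]

/-- In every branch the state of the code is carried to qubit `j`. -/
theorem branch_amplitude (hd : Describes d b) (hp : d.HasShortestPath j) (o : Fin n → Fin 2)
    (N : Fin n → Matrix (Fin 2) (Fin 2) ℂ) (hj : N j = cliff ((d.protocol j).final o))
    (ht : ∀ t ∈ (d.protocol j).turns,
      N t.party = t.axis.proj (o t.party) * cliff (t.correction o))
    (x : Fin n → Fin 2) :
    ∃ κ : ℂ, ∀ r a, (tens N *ᵥ b.ket a) (Function.update x j r) = if r = a then κ else 0 := by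
  obtain ⟨z, hz⟩ := hd.maxEntangled_eq
  -- The inverse Clifford operations carry the graph state to the entangled state, so every vertex
  -- applies its protocol operator after such an inverse; the reference system applies only the
  -- inverse.
  set W : Option (Fin n) → Matrix (Fin 2) (Fin 2) ℂ := fun v =>
    v.elim 1 N * (cliff (d.clifford v))ᴴ with hW
  have hpath := hp.path_eq
  have hU : ∀ v, cliff (d.clifford v) * (cliff (d.clifford v))ᴴ = 1 := fun v =>
    mul_eq_one_comm.1 (cliff_unitary _)
  have hside : ∀ u ∈ d.side, W (some u) = Axis.z.proj (o u) := by
    intro u hu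
    have h := ht ⟨u, .z, fun _ => d.clifford (some u)⟩
      (List.mem_append_left _ (List.mem_map_of_mem hu))
    simp only [hW, Option.elim_some]
    change N u = _ at h
    rw [h, Matrix.mul_assoc]
    change _ * (cliff (d.clifford (some u)) * _) = _
    rw [hU, Matrix.mul_one]
  -- At a side party the Clifford operations cancel and a bare `Z` projector is left. It fixes the
  -- state of that vertex in the sum over basis states, and with it the signs on the path.
  have hs : ∀ y : Option (Fin n) → Fin 2, (∀ u, u ∉ d.path → W u (withRef 0 x u) (y u) ≠ 0) →
      ∀ u ∈ d.path, outSign d.graph {u | u ∈ d.path} u y = (-1) ^ d.count u o := by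
    intro y hy u hu
    refine neg_one_pow_count d u hu o y hp.none_mem_path fun k hk => ?_
    have h := hy (some k) (PathData.mem_side.1 hk).1
    rw [hside k hk] at h
    revert h
    generalize withRef 0 x (some k) = x1
    generalize y (some k) = y1
    generalize o k = o1
    fin_cases x1 <;> fin_cases y1 <;> fin_cases o1 <;> simp [Axis.proj, Axis.mat, Letter.mat]
  have hind := hp.induced
  have hnd := hp.nodup
  rw [hpath] at hs hind hnd
  obtain ⟨K, hK⟩ := tens_mulVec_graphState d.graph W (fun u => (-1) ^ d.count u o) (some j)
    (d.inner.map some ++ [none]) hind hnd (withRef 0 x) hs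
  obtain ⟨κ, hκ⟩ := transfer_innerTurns d o x d.inner none
  refine ⟨((Real.sqrt 2 : ℝ) : ℂ) * z * (κ * ((Real.sqrt 2 : ℝ) : ℂ) * ∑ y, K y), fun r a => ?_⟩
  have h1 : (tens N *ᵥ b.ket a) (Function.update x j r) = ((Real.sqrt 2 : ℝ) : ℂ) * z *
      (tens W *ᵥ graphState d.graph) (withRef a (Function.update x j r)) := by
    rw [LogicalBasis.ket_eq_slice, Matrix.mulVec_smul, Pi.smul_apply, tens_mulVec_slice, hz,
      Matrix.mulVec_smul, Matrix.mulVec_mulVec, tens_mul, Pi.smul_apply, smul_eq_mul, smul_eq_mul,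
      mul_assoc]
  have hagree : ∀ u, u ∉ some j :: (d.inner.map some ++ [none]) →
      withRef a (Function.update x j r) u = withRef 0 x u := by
    intro u hu
    cases u with
    | none => simp at hu
    | some k =>
      have : k ≠ j := by rintro rfl; simp at hu
      simp [withRef, this]
  rw [h1, hK _ hagree]
  have hfirst : (fun c => W (some j) (withRef a (Function.update x j r) (some j)) c *
      if c = 1 then (-1 : ℂ) ^ d.count (some j) o else 1) =
      fun c => (((cliff (d.clifford none))ᵀ * zMat (d.count none o +
        PathData.carry o d.inner.getLast?) * Gate.h.mat) *
        (cliff (d.inner.reverse.flatMap fun v => PathData.sqrtY (o v)) *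
          xMat (PathData.carry o none))) r c := by
    funext c
    have hx : xMat (PathData.carry o none) = 1 := pow_zero _
    have hr : withRef a (Function.update x j r) (some j) = r := by simp [withRef]
    have hg : cliff [Gate.h] = Gate.h.mat := by simp [cliff]
    simp only [hW, Option.elim_some, hr, hj, PathData.protocol]
    rw [cliff_append _ (d.clifford (some j)), Matrix.mul_assoc _ (cliff (d.clifford (some j))), hU,
      Matrix.mul_one, cliff_append _ (zPow _), cliff_zPow, zMat_apply_mul_sign, hx, Matrix.mul_one]
    simp only [cliff_append, cliff_zPow, cliff_reverse, hg, Matrix.mul_assoc]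
  rw [hfirst, hκ]
  · have hor : d.inner.getLast?.or none = d.inner.getLast? := by simp
    rw [hor, transfer_reference _ (cliff (d.clifford none)) (cliff_unitary _)
      (d.count none o) (PathData.carry_le _ _) a r]
    · by_cases hra : r = a
      · simp only [hra, if_true]
      · simp [hra]
    · intro c
      simp [hW, withRef]
  · intro t htm c
    have hmem : t.party ∈ d.inner := by
      rw [← PathData.innerTurns_party (d := d) none d.inner]
      exact List.mem_map_of_mem htm
    have hne : t.party ≠ j := fun h => hp.notMem_inner (h ▸ hmem)
    have h2 := ht t (List.mem_append_right _ htm)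
    have h3 : withRef a (Function.update x j r) (some t.party) = x t.party := by
      simp [withRef, hne]
    simp only [hW, Option.elim_some, h2, h3, Matrix.mul_assoc]

theorem trace_addAncillas {D : ℕ} (σ : Matrix (Fin n → Fin 2) (Fin n → Fin 2) ℂ) :
    (addAncillas (D := D) σ).trace = σ.trace := by
  simp only [Matrix.trace, Matrix.diag_apply, addAncillas, Matrix.of_apply, and_self]
  rw [← Finset.sum_filter]
  refine Finset.sum_bij' (fun x _ k => (x k).1) (fun y _ k => (y k, 0)) ?_ ?_ ?_ ?_ ?_
  · simp
  · simp
  · intro x hx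
    funext k
    rw [Finset.mem_filter] at hx
    exact Prod.ext rfl (hx.2 k).symm
  · simp
  · simp

theorem LogicalBasis.trace_encode (b : LogicalBasis g) (ρ : Matrix (Fin 2) (Fin 2) ℂ) :
    (b.encode ρ).trace = ρ.trace := by
  have h : ∀ a c, (Matrix.vecMulVec (b.ket a) (star (b.ket c))).trace = if c = a then 1 else 0 := by
    intro a c
    rw [Matrix.trace_vecMulVec, dotProduct_comm, b.ket_dotProduct]
  simp only [LogicalBasis.encode, Matrix.trace_sum, Matrix.trace_smul, h, smul_eq_mul, mul_ite,
    mul_one, mul_zero, Finset.sum_ite_eq', Finset.mem_univ, if_true]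
  rfl

/-- A protocol that preserves the amplitudes of the logical state in every branch extracts it. -/
theorem extracts_of_branches {D : ℕ} {p : LOCCProtocol n D} {ι : Type} [Fintype ι]
    {M : ι → Fin n → Matrix (Loc D) (Loc D) ℂ}
    (hM : ∀ σ, p.channel σ = ∑ i, tens (M i) * σ * (tens (M i))ᴴ)
    (κ : ι → (Fin n → Loc D) → ℂ)
    (hκ : ∀ i x r s, κ i (Function.update x j (r, s)) = κ i (Function.update x j (0, s)))
    (h : ∀ i x a, (tens (M i) *ᵥ withAncillas D (b.ket a)) x = if (x j).1 = a then κ i x else 0) :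
    Extracts b (p.toMap j) := by
  -- Input and output are proportional with a factor that does not depend on the input; preservation
  -- of the trace makes it `1`.
  have key : ∃ c : ℂ, ∀ ρ, p.toMap j (b.encode ρ) = c • ρ := by
    refine ⟨∑ i, ∑ x : Fin n → Loc D, if (x j).1 = 0 then κ i x * star (κ i x) else 0,
      fun ρ => ?_⟩
    ext r s
    rw [toMap_encode_apply b j hM, Matrix.smul_apply, smul_eq_mul, Finset.sum_mul]
    refine Finset.sum_congr rfl fun i _ => ?_
    rw [← sum_ite_update j r 0, Finset.sum_mul]
    refine Finset.sum_congr rfl fun x _ => ?_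
    rw [ite_mul, zero_mul]
    refine if_ctx_congr Iff.rfl (fun hx => ?_) fun _ => rfl
    have hself : κ i x = κ i (Function.update x j (0, (x j).2)) := by
      conv_lhs => rw [← Function.update_eq_self j x, ← Prod.mk.eta (p := x j), hκ]
    simp only [h, hx, Function.update_self, hκ i x s, hself]
    rw [Finset.sum_eq_single r, Finset.sum_eq_single s]
    · simp; ring
    · intro c _ hc; simp [hc.symm]
    · simp
    · intro c _ hc; simp [hc.symm]
    · simp
  obtain ⟨c, hc⟩ := key
  intro ρ _ hρ
  have h1 : (p.toMap j (b.encode ρ)).trace = ρ.trace := by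
    rw [LOCCProtocol.toMap, reduceTo_trace, channel_trace, trace_addAncillas, b.trace_encode]
  rw [hc, Matrix.trace_smul, hρ, smul_eq_mul, mul_one] at h1
  rw [hc, h1, one_smul]

theorem Describes.protocol_extracts (hd : Describes d b) (hp : d.HasShortestPath j) :
    Extracts b (((d.protocol j).toLOCC j).toMap j) := by
  obtain ⟨ι, hι, out, N, hN, h⟩ := exists_outcomes j (d.protocol j).final (d.protocol j).turns
    hp.isOneWay hp.causal fun _ => 0
  choose κ hκ using fun (i : ι) => branch_amplitude hd hp (out i) (N i) (h i).2.1 (h i).2.2.1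
  -- The scalar is evaluated with the qubit of `j` reset to `0`, which makes its independence of
  -- that qubit visible.
  refine extracts_of_branches hN (fun i x => κ i fun k => if k = j then 0 else (x k).1) ?_ ?_
  · intro i x r s
    congr 1
    funext k
    by_cases hk : k = j <;> simp [hk]
  · intro i x a
    rw [tens_lift_mulVec, ← hκ]
    congr 1
    funext k
    by_cases hk : k = j
    · subst hk; simp
    · simp [hk]

end

section

/-! ### Reasoning about programs -/

/-- The bound for the contents of registers and cells. -/
def wordBound (n : ℕ) : ℕ := (n + 2) ^ 2

theorem lt_wordBound {n v : ℕ} (h : v ≤ n + 3) : v < wordBound n := by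
  unfold wordBound
  nlinarith

theorem two_le_wordBound (n : ℕ) : 2 ≤ wordBound n := lt_wordBound (by omega)

/-- The size of an expression, as an exponent of the word bound. -/
def Expr.deg : Expr → ℕ
  | const c => c + 1
  | reg _ => 1
  | read _ i => i.deg + 1
  | add e f => e.deg + f.deg
  | sub e f => e.deg + f.deg
  | mul e f => e.deg + f.deg
  | div e f => e.deg + f.deg
  | mod e f => e.deg + f.deg
  | lt e f => e.deg + f.deg

/-- All registers and cells are less than the word bound. -/
structure Bounded (n : ℕ) (s : Store) : Prop where
  reg : ∀ r, s.reg r < wordBound n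
  arr : ∀ a i, s.arr a i < wordBound n

theorem Bounded.setReg {n : ℕ} {s : Store} (hs : Bounded n s) (r : ℕ) {v : ℕ}
    (hv : v < wordBound n) : Bounded n (s.setReg r v) := by
  refine ⟨fun r' => ?_, hs.arr⟩
  by_cases h : r' = r
  · subst h; simpa [Store.setReg]
  · simpa [Store.setReg, h] using hs.reg r'

theorem Bounded.setCell {n : ℕ} {s : Store} (hs : Bounded n s) (a i : ℕ) {v : ℕ}
    (hv : v < wordBound n) : Bounded n (s.setCell a i v) := by
  refine ⟨hs.reg, fun a' i' => ?_⟩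
  by_cases h : a' = a
  · subst h
    by_cases h' : i' = i
    · subst h'; simpa [Store.setCell]
    · simpa [Store.setCell, h'] using hs.arr a' i'
  · simpa [Store.setCell, h] using hs.arr a' i'

theorem Expr.deg_pos (e : Expr) : 1 ≤ e.deg := by
  induction e <;> simp only [deg] <;> omega

/-- Degrees add under multiplication, and this covers sums too since both powers are at least `2`. A
degree read off from the expression thus bounds all intermediate values, and a fixed power of
`wordBound n` serves as word size. -/
theorem Expr.eval_lt {n : ℕ} {s : Store} (hs : Bounded n s) (e : Expr) :
    e.eval s < wordBound n ^ e.deg := by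
  have h2 := two_le_wordBound n
  have hone : ∀ f : Expr, 2 ≤ wordBound n ^ f.deg := fun f =>
    h2.trans (Nat.le_self_pow (by have := f.deg_pos; omega) _)
  have hleft : ∀ {x : ℕ} (e f : Expr), x < wordBound n ^ e.deg →
      x < wordBound n ^ (e.deg + f.deg) := fun e f h =>
    h.trans_le (Nat.pow_le_pow_right (by omega) (Nat.le_add_right _ _))
  induction e with
  | const c =>
    calc c < 2 ^ c := Nat.lt_two_pow_self
      _ ≤ wordBound n ^ c := Nat.pow_le_pow_left h2 _
      _ ≤ wordBound n ^ (c + 1) := Nat.pow_le_pow_right (by omega) (Nat.le_succ _)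
  | reg r => simpa [deg, eval] using hs.reg r
  | read a i ih =>
    exact (hs.arr a _).trans_le (Nat.le_self_pow (by simp [deg]) _)
  | add e f ihe ihf =>
    simp only [deg, eval, pow_add]
    nlinarith [hone e, hone f]
  | sub e f ihe ihf => exact hleft e f ((Nat.sub_le _ _).trans_lt ihe)
  | mul e f ihe ihf =>
    simp only [deg, eval, pow_add]
    exact Nat.mul_lt_mul'' ihe ihf
  | div e f ihe ihf => exact hleft e f ((Nat.div_le_self _ _).trans_lt ihe)
  | mod e f ihe ihf => exact hleft e f ((Nat.mod_le _ _).trans_lt ihe)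
  | lt e f ihe ihf =>
    simp only [eval]
    have : 2 ≤ wordBound n ^ (e.lt f).deg := hone (e.lt f)
    split_ifs <;> omega

theorem Expr.fits {n D : ℕ} {s : Store} (hs : Bounded n s) (e : Expr) (he : e.deg ≤ D) :
    e.Fits (wordBound n ^ D) s := by
  have key : ∀ f : Expr, f.deg ≤ D → f.eval s < wordBound n ^ D := fun f hf =>
    (f.eval_lt hs).trans_le
      (Nat.pow_le_pow_right (by have := two_le_wordBound n; omega) hf)
  induction e with
  | const c => exact key (.const c) he
  | reg r => exact key (.reg r) he
  | read a i ih => exact ⟨ih (by simp only [deg] at he; omega), key (.read a i) he⟩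
  | add e f ihe ihf =>
    have h := he
    simp only [deg] at h
    exact ⟨ihe (by omega), ihf (by omega), key (.add e f) he⟩
  | mul e f ihe ihf =>
    have h := he
    simp only [deg] at h
    exact ⟨ihe (by omega), ihf (by omega), key (.mul e f) he⟩
  | sub e f ihe ihf | div e f ihe ihf | mod e f ihe ihf =>
    simp only [deg] at he
    exact ⟨ihe (by omega), ihf (by omega)⟩
  | lt e f ihe ihf =>
    have h := he
    have h1 := e.deg_pos
    simp only [deg] at h
    refine ⟨ihe (by omega), ihf (by omega), ?_⟩
    have := two_le_wordBound n
    exact lt_of_lt_of_le (by omega) (Nat.le_self_pow (by omega) _)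

/-- A bound for the number of steps of a program all of whose loops have at most `N` rounds. -/
def Program.time (N : ℕ) : Program → ℕ
  | skip => 1
  | set _ e => e.cost + 1
  | write _ i e => i.cost + e.cost + 1
  | seq p q => p.time N + q.time N
  | ite e p q => e.cost + 1 + (p.time N + q.time N)
  | loop e p => (N + 1) * (e.cost + 1 + p.time N)

/-- The nesting depth of the loops of a program. -/
def Program.depth : Program → ℕ
  | skip => 0
  | set _ _ => 0
  | write _ _ _ => 0
  | seq p q => max p.depth q.depth
  | ite _ p q => max p.depth q.depth
  | loop _ p => p.depth + 1

/-- Every level of nesting costs one factor `N + 1`; everything else is a constant of the program.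
-/
theorem Program.time_le (N : ℕ) (p : Program) : p.time N ≤ p.time 0 * (N + 1) ^ p.depth := by
  have hpow : ∀ {a b : ℕ}, a ≤ b → (N + 1) ^ a ≤ (N + 1) ^ b := fun h =>
    Nat.pow_le_pow_right (by omega) h
  have hone : ∀ a, 1 ≤ (N + 1) ^ a := fun a => Nat.one_le_pow _ _ (by omega)
  induction p with
  | skip => simp [time, depth]
  | set _ _ => simp [time, depth]
  | write _ _ _ => simp [time, depth]
  | seq p q ihp ihq =>
    simp only [time, depth]
    nlinarith [hpow (le_max_left p.depth q.depth), hpow (le_max_right p.depth q.depth),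
      Nat.mul_le_mul_left (p.time 0) (hpow (le_max_left p.depth q.depth)),
      Nat.mul_le_mul_left (q.time 0) (hpow (le_max_right p.depth q.depth))]
  | ite e p q ihp ihq =>
    simp only [time, depth]
    nlinarith [Nat.mul_le_mul_left (p.time 0) (hpow (le_max_left p.depth q.depth)),
      Nat.mul_le_mul_left (q.time 0) (hpow (le_max_right p.depth q.depth)),
      Nat.mul_le_mul_left (e.cost + 1) (hone (max p.depth q.depth))]
  | loop e p ih =>
    simp only [time, depth, zero_add, one_mul, pow_succ]
    have h1 := Nat.mul_le_mul_left (e.cost + 1) (hone p.depth)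
    calc (N + 1) * (e.cost + 1 + p.time N)
        ≤ (N + 1) * ((e.cost + 1 + p.time 0) * (N + 1) ^ p.depth) :=
          Nat.mul_le_mul_left _ (by nlinarith)
      _ = _ := by ring

/-- From the store `s` the program halts in time and in a store with property `Q`, and all numbers
that occur are words. -/
def WP (n : ℕ) (p : Program) (s : Store) (Q : Store → Prop) : Prop :=
  ∃ t s', Exec (wordBound n ^ 100) p s t s' ∧ t ≤ p.time (n + 1) ∧ Bounded n s' ∧ Q s'

namespace WP

variable {n : ℕ} {p q : Program} {s : Store} {Q R : Store → Prop}

theorem mono (h : WP n p s R) (hQ : ∀ s', Bounded n s' → R s' → Q s') : WP n p s Q := by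
  obtain ⟨t, s', h1, h2, h3, h4⟩ := h
  exact ⟨t, s', h1, h2, h3, hQ s' h3 h4⟩

theorem skip (hs : Bounded n s) (hQ : Q s) : WP n .skip s Q :=
  ⟨1, s, .skip s, le_rfl, hs, hQ⟩

theorem set {r : ℕ} {e : Expr} (hs : Bounded n s) (hv : e.eval s < wordBound n)
    (hQ : Q (s.setReg r (e.eval s))) (hd : e.deg ≤ 100 := by decide) : WP n (.set r e) s Q :=
  ⟨_, _, .set r e s (e.fits hs hd), le_rfl, hs.setReg r hv, hQ⟩

theorem write {a : ℕ} {i e : Expr} (hs : Bounded n s) (hv : e.eval s < wordBound n)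
    (hQ : Q (s.setCell a (i.eval s) (e.eval s))) (hi : i.deg ≤ 100 := by decide)
    (hd : e.deg ≤ 100 := by decide) : WP n (.write a i e) s Q :=
  ⟨_, _, .write a i e s (i.fits hs hi) (e.fits hs hd), le_rfl, hs.setCell a _ hv, hQ⟩

theorem seq (h : WP n p s R) (h' : ∀ s', Bounded n s' → R s' → WP n q s' Q) :
    WP n (.seq p q) s Q := by
  obtain ⟨t, s', h1, h2, h3, h4⟩ := h
  obtain ⟨t', s'', h1', h2', h3', h4'⟩ := h' s' h3 h4
  exact ⟨_, _, .seq p q s s' s'' t t' h1 h1', Nat.add_le_add h2 h2', h3', h4'⟩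

theorem ite {e : Expr} (hs : Bounded n s) (hp : e.eval s ≠ 0 → WP n p s Q)
    (hq : e.eval s = 0 → WP n q s Q) (hd : e.deg ≤ 100 := by decide) :
    WP n (.ite e p q) s Q := by
  by_cases h : e.eval s = 0
  · obtain ⟨t, s', h1, h2, h3, h4⟩ := hq h
    exact ⟨_, _, .ite_false e p q s s' t (e.fits hs hd) h h1,
      by simp only [Program.time]; omega, h3, h4⟩
  · obtain ⟨t, s', h1, h2, h3, h4⟩ := hp h
    exact ⟨_, _, .ite_true e p q s s' t (e.fits hs hd) h h1,
      by simp only [Program.time]; omega, h3, h4⟩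

end WP

/-- Repeat `p` with the values `0, 1, …` of register `r`, up to the value of `e`. -/
def forLoop (r : ℕ) (e : Expr) (p : Program) : Program :=
  .seq (.set r (.const 0))
    (.loop (.lt (.reg r) e) (.seq p (.set r (.add (.reg r) (.const 1)))))

/-- `I k` describes the store at the start of round `k`, with the counter already set. The bound `e`
is evaluated in every round, hence `hI`, and the body has to preserve the counter. `N ≤ n + 1`
matches the number of rounds for which `WP` allows time. -/
theorem WP.forLoop {n N : ℕ} {r : ℕ} {e : Expr} {p : Program} {s : Store} (I : ℕ → Store → Prop)
    (hs : Bounded n s) (hN : N ≤ n + 1) (h0 : I 0 (s.setReg r 0))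
    (hI : ∀ k s', k ≤ N → I k s' → e.eval s' = N)
    (hp : ∀ k s', k < N → Bounded n s' → s'.reg r = k → I k s' →
      WP n p s' fun s'' => s''.reg r = k ∧ I (k + 1) (s''.setReg r (k + 1)))
    (hd : (Expr.lt (.reg r) e).deg ≤ 100 := by decide) :
    WP n (StabLOCC.forLoop r e p) s (I N) := by
  have key : ∀ l k s', k + l = N → Bounded n s' → s'.reg r = k → I k s' →
      ∃ t s'', Exec (wordBound n ^ 100) (.loop (.lt (.reg r) e)
        (.seq p (.set r (.add (.reg r) (.const 1))))) s' t s'' ∧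
        t ≤ (l + 1) * ((Expr.lt (.reg r) e).cost + 1 +
          (Program.seq p (.set r (.add (.reg r) (.const 1)))).time (n + 1)) ∧
        Bounded n s'' ∧ I N s'' := by
    intro l
    induction l with
    | zero =>
      intro k s' hk hs' hr h
      rw [add_zero] at hk
      subst hk
      refine ⟨_, s', .loop_false _ _ s' (Expr.fits hs' _ hd) ?_, ?_, hs', h⟩
      · simp [Expr.eval, hI _ s' le_rfl h, hr]
      · omega
    | succ l ih =>
      intro k s' hk hs' hr h
      obtain ⟨t, s1, h1, h2, h3, h4, h5⟩ := hp k s' (by omega) hs' hr h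
      have hw : k + 1 < wordBound n := lt_wordBound (by omega)
      have heval : (Expr.add (.reg r) (.const 1)).eval s1 = k + 1 := by simp [Expr.eval, h4]
      obtain ⟨t', s2, g1, g2, g3, g4⟩ := ih (k + 1) (s1.setReg r (k + 1)) (by omega)
        (h3.setReg r hw) (by simp [Store.setReg]) h5
      have hset := Exec.set (B := wordBound n ^ 100) r (.add (.reg r) (.const 1)) s1
        (Expr.fits h3 _ (by simp [Expr.deg]))
      rw [heval] at hset
      refine ⟨_, s2, .loop_true _ _ s' (s1.setReg r (k + 1)) s2 _ _ (Expr.fits hs' _ hd) ?_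
        (.seq _ _ s' s1 _ _ _ h1 hset) g1, ?_, g3, g4⟩
      · simp [Expr.eval, hI k s' (by omega) h, hr]
        omega
      · simp only [Program.time] at g2 ⊢
        rw [add_mul (l + 1)]
        omega
  obtain ⟨t, s', h1, h2, h3, h4⟩ := key N 0 (s.setReg r 0) (by omega)
    (hs.setReg r (lt_wordBound (by omega))) (by simp [Store.setReg]) h0
  refine ⟨_, s', .seq _ _ s (s.setReg r 0) s' _ _ (.set r (.const 0) s
    (Expr.fits hs _ (by simp [Expr.deg]))) h1, ?_, h3, h4⟩
  rw [StabLOCC.forLoop, Program.time, Program.time, Program.time]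
  refine Nat.add_le_add le_rfl (h2.trans (Nat.mul_le_mul_right _ (by omega)))

/-- The registers below `R` and the arrays not in `A` are the same in both stores. -/
structure Frame (R : ℕ) (A : List ℕ) (s s' : Store) : Prop where
  reg : ∀ r, r < R → s'.reg r = s.reg r
  arr : ∀ a, a ∉ A → s'.arr a = s.arr a

namespace Frame

variable {R R' : ℕ} {A A' : List ℕ} {s s' s'' : Store}

theorem refl (R : ℕ) (A : List ℕ) (s : Store) : Frame R A s s := ⟨fun _ _ => rfl, fun _ _ => rfl⟩

theorem trans (h : Frame R A s s') (h' : Frame R A s' s'') : Frame R A s s'' :=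
  ⟨fun r hr => (h'.reg r hr).trans (h.reg r hr), fun a ha => (h'.arr a ha).trans (h.arr a ha)⟩

theorem mono (h : Frame R A s s') (hR : R' ≤ R) (hA : A ⊆ A') : Frame R' A' s s' :=
  ⟨fun r hr => h.reg r (hr.trans_le hR), fun a ha => h.arr a fun h' => ha (hA h')⟩

theorem setReg (h : Frame R A s s') {r : ℕ} (hr : R ≤ r) (v : ℕ) :
    Frame R A s (s'.setReg r v) :=
  ⟨fun r' hr' => (Function.update_of_ne (by omega) _ _).trans (h.reg r' hr'), h.arr⟩

theorem setCell (h : Frame R A s s') {a : ℕ} (ha : a ∈ A) (i v : ℕ) :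
    Frame R A s (s'.setCell a i v) :=
  ⟨h.reg, fun a' ha' =>
    (Function.update_of_ne (by rintro rfl; exact ha' ha) _ _).trans (h.arr a' ha')⟩

end Frame

@[simp] theorem Store.setReg_arr (s : Store) (r v : ℕ) : (s.setReg r v).arr = s.arr := rfl

@[simp] theorem Store.setCell_reg (s : Store) (a i v : ℕ) : (s.setCell a i v).reg = s.reg := rfl

theorem Store.setReg_reg (s : Store) (r v r' : ℕ) :
    (s.setReg r v).reg r' = if r' = r then v else s.reg r' := Function.update_apply ..

theorem Store.setCell_arr_of_ne (s : Store) {a a' : ℕ} (h : a' ≠ a) (i v : ℕ) :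
    (s.setCell a i v).arr a' = s.arr a' := Function.update_of_ne h ..

theorem Store.setCell_arr_self (s : Store) (a i v : ℕ) :
    (s.setCell a i v).arr a = Function.update (s.arr a) i v := Function.update_self ..

/-! ### Vertices and matrices in the store -/

section Layout

variable {n : ℕ}

theorem vertexCode_le (v : Option (Fin n)) : vertexCode v ≤ n := by
  cases v with
  | none => exact le_rfl
  | some k => exact k.2.le

theorem vertexCode_injective : Function.Injective (vertexCode (n := n)) := by
  intro u v h
  cases u with
  | none =>
    cases v with
    | none => rfl
    | some k => exact absurd h k.2.ne'
  | some i =>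
    cases v with
    | none => exact absurd h i.2.ne
    | some k => exact congrArg some (Fin.ext h)

theorem exists_vertexCode {k : ℕ} (h : k < n + 1) : ∃ v : Option (Fin n), vertexCode v = k := by
  by_cases hk : k < n
  · exact ⟨some ⟨k, hk⟩, rfl⟩
  · exact ⟨none, by simp only [vertexCode]; omega⟩

/-- Row and column are quotient and remainder of the index by `n + 1`, as vertex numbers are at most
`n`. -/
theorem cell_inj {k k' : ℕ} {v v' : Option (Fin n)}
    (h : k * (n + 1) + vertexCode v = k' * (n + 1) + vertexCode v') : k = k' ∧ v = v' := by
  have h1 := vertexCode_le v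
  have h2 := vertexCode_le v'
  have hk : k = k' := by
    have := congrArg (· / (n + 1)) h
    simp only [mul_comm _ (n + 1)] at this
    rwa [Nat.mul_add_div (by omega), Nat.mul_add_div (by omega), Nat.div_eq_of_lt (by omega),
      Nat.div_eq_of_lt (by omega), add_zero, add_zero] at this
  subst hk
  exact ⟨rfl, vertexCode_injective (by omega)⟩

/-- The array `A` holds the matrix `f`. -/
def IsMatrix (A : ℕ → ℕ) (f : ℕ → Option (Fin n) → ℕ) : Prop :=
  ∀ k v, A (k * (n + 1) + vertexCode v) = f k v

/-- The array `A` holds the vector `f`. -/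
def IsVector (A : ℕ → ℕ) (f : Option (Fin n) → ℕ) : Prop := ∀ v, A (vertexCode v) = f v

theorem IsMatrix.update {A : ℕ → ℕ} {f f' : ℕ → Option (Fin n) → ℕ} (h : IsMatrix A f) {k : ℕ}
    {v : Option (Fin n)} {x : ℕ} (hx : f' k v = x)
    (hf : ∀ k' v', ¬ (k' = k ∧ v' = v) → f' k' v' = f k' v') :
    IsMatrix (Function.update A (k * (n + 1) + vertexCode v) x) f' := by
  intro k' v'
  by_cases hkv : k' = k ∧ v' = v
  · obtain ⟨rfl, rfl⟩ := hkv
    rw [Function.update_self, hx]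
  · rw [Function.update_of_ne fun h' => hkv (cell_inj h'), h, hf _ _ hkv]

theorem IsVector.update {A : ℕ → ℕ} {f f' : Option (Fin n) → ℕ} (h : IsVector A f)
    {v : Option (Fin n)} {x : ℕ} (hx : f' v = x) (hf : ∀ v', v' ≠ v → f' v' = f v') :
    IsVector (Function.update A (vertexCode v) x) f' := by
  intro v'
  by_cases hv : v' = v
  · subst hv
    rw [Function.update_self, hx]
  · rw [Function.update_of_ne fun h' => hv (vertexCode_injective h'), h, hf _ hv]

end Layout

end

section

/-! ### Letters in the store -/

/-- The index of a matrix entry. -/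
def entryIndex (k v : Expr) : Expr := .add (.mul k (.reg 3)) v

/-- A matrix entry. -/
def entry (a : ℕ) (k v : Expr) : Expr := .read a (entryIndex k v)

/-- The code of the product of two letters. -/
def mulExpr (e f : Expr) : Expr :=
  .add (.mod (.add e f) (.const 2))
    (.mul (.const 2) (.mod (.add (.div e (.const 2)) (.div f (.const 2))) (.const 2)))

/-- The exponent of `i` in the product of two letters. -/
def lamExpr (e f : Expr) : Expr :=
  .mul (.lt (.const 0) (.mul e f))
    (.add (.mod (.sub (.add f (.const 3)) e) (.const 3))
      (.div (.mod (.sub (.add f (.const 3)) e) (.const 3)) (.const 2)))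

/-- Whether a letter is `X` or `Y`. -/
def xbExpr (e : Expr) : Expr := .lt (.const 0) (.mod e (.const 3))

/-- Whether a letter is `Y` or `Z`. -/
def zbExpr (e : Expr) : Expr := .div e (.const 2)

/-- Whether a letter is `Y`. -/
def isYExpr (e : Expr) : Expr := .mul (.div e (.const 2)) (.sub (.const 3) e)

/-- The code of the conjugation of a letter by the Hadamard gate. -/
def swapExpr (e : Expr) : Expr := .mod (.mul (.const 3) e) (.const 4)

theorem entry_eval (s : Store) {n : ℕ} (h3 : s.reg 3 = n + 1) (a : ℕ) (k v : Expr) :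
    (entry a k v).eval s = s.arr a (k.eval s * (n + 1) + v.eval s) := by
  simp [entry, entryIndex, Expr.eval, h3]

theorem entryIndex_eval (s : Store) {n : ℕ} (h3 : s.reg 3 = n + 1) (k v : Expr) :
    (entryIndex k v).eval s = k.eval s * (n + 1) + v.eval s := by
  simp [entryIndex, Expr.eval, h3]

section LetterExpr

variable {s : Store} {e f : Expr} {a b : Letter}

/-- In binary the codes of `I, X, Y, Z` are `00, 01, 10, 11`, and multiplication of letters is
addition of the two digits modulo 2. -/
theorem mulExpr_eval (he : e.eval s = a.code) (hf : f.eval s = b.code) :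
    (mulExpr e f).eval s = (a.mul b).code := by
  simp only [mulExpr, Expr.eval, he, hf]
  cases a <;> cases b <;> rfl

/-- For nontrivial letters the difference of the codes modulo 3 is `0`, `1` or `2`, according to the
cyclic order `X, Y, Z`, and `d + d / 2` maps this to the exponent `0`, `1` or `3`. Adding `3` first
avoids truncated subtraction. -/
theorem lamExpr_eval (he : e.eval s = a.code) (hf : f.eval s = b.code) :
    (lamExpr e f).eval s = a.lam b := by
  simp only [lamExpr, Expr.eval, he, hf]
  cases a <;> cases b <;> rfl

theorem xbExpr_eval (he : e.eval s = a.code) :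
    (xbExpr e).eval s = if a.xb = 1 then 1 else 0 := by
  simp only [xbExpr, Expr.eval, he]
  cases a <;> rfl

theorem zbExpr_eval (he : e.eval s = a.code) :
    (zbExpr e).eval s = if a.zb = 1 then 1 else 0 := by
  simp only [zbExpr, Expr.eval, he]
  cases a <;> rfl

theorem isYExpr_eval (he : e.eval s = a.code) :
    (isYExpr e).eval s = if a = .y then 1 else 0 := by
  simp only [isYExpr, Expr.eval, he]
  cases a <;> rfl

/-- Multiplication by `3` modulo `4` exchanges the codes `1` and `3` and fixes `0` and `2`. -/
theorem swapExpr_eval (he : e.eval s = a.code) : (swapExpr e).eval s = a.swap.code := by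
  simp only [swapExpr, Expr.eval, he]
  cases a <;> rfl

theorem Letter.code_le (a : Letter) : a.code ≤ 3 := by cases a <;> decide

end LetterExpr

theorem mod_four_lt_wordBound (x n : ℕ) : x % 4 < wordBound n := lt_wordBound (by omega)

theorem Letter.code_lt_wordBound (a : Letter) (n : ℕ) : a.code < wordBound n :=
  lt_wordBound (a.code_le.trans (by omega))

/-! ### Row operations -/

variable {n : ℕ}

/-- Array 7 holds the letters of the rows, and array 1 their phases. -/
structure IsRows (s : Store) (τ : ℕ → Pauli (Option (Fin n))) : Prop where
  letter : IsMatrix (s.arr 7) fun k v => ((τ k).letter v).code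
  phase : ∀ k, s.arr 1 k = (τ k).phase

theorem IsRows.of_arr {s s' : Store} {τ : ℕ → Pauli (Option (Fin n))} (h : IsRows s τ)
    (h7 : s'.arr 7 = s.arr 7) (h1 : s'.arr 1 = s.arr 1) : IsRows s' τ :=
  ⟨h7 ▸ h.letter, h1 ▸ h.phase⟩

theorem sum_vertexCode_succ (f : Option (Fin n) → ℕ) (v : Option (Fin n)) :
    (∑ w, if vertexCode w < vertexCode v + 1 then f w else 0) =
      (∑ w, if vertexCode w < vertexCode v then f w else 0) + f v := by
  have h : f v = ∑ w, if w = v then f w else 0 := by simp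
  rw [h, ← Finset.sum_add_distrib]
  refine Finset.sum_congr rfl fun w _ => ?_
  by_cases hw : w = v
  · subst hw; simp
  · have : vertexCode w ≠ vertexCode v := fun h => hw (vertexCode_injective h)
    simp only [hw, if_false, add_zero]
    exact if_congr (by omega) rfl rfl

/-- Multiply row `k` (register 8) by row `i` (register 4). -/
def mulRow : Program :=
  .seq (.set 10 (.const 0)) <|
  .seq (forLoop 9 (.reg 3) <|
    .seq (.set 10 (.mod (.add (.reg 10) (lamExpr (entry 7 (.reg 8) (.reg 9))
      (entry 7 (.reg 4) (.reg 9)))) (.const 4)))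
    (.write 7 (entryIndex (.reg 8) (.reg 9)) (mulExpr (entry 7 (.reg 8) (.reg 9))
      (entry 7 (.reg 4) (.reg 9)))))
  (.write 1 (.reg 8)
    (.mod (.add (.add (.read 1 (.reg 8)) (.read 1 (.reg 4))) (.reg 10)) (.const 4)))

/-- Row `k` is overwritten while row `i` is still read, so the rows must differ. The exponent is
accumulated before the letter it depends on is replaced. -/
theorem mulRow_spec {s : Store} {τ : ℕ → Pauli (Option (Fin n))} {k i : ℕ} (hs : Bounded n s)
    (h3 : s.reg 3 = n + 1) (h8 : s.reg 8 = k) (h4 : s.reg 4 = i) (hki : k ≠ i) (h : IsRows s τ) :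
    WP n mulRow s fun s' => Frame 9 [1, 7] s s' ∧
      IsRows s' (Function.update τ k ((τ k).mul (τ i))) := by
  refine WP.seq (WP.set (Q := fun s' => s' = s.setReg 10 0) hs (lt_wordBound (Nat.zero_le _)) rfl)
    fun s1 hs1 e1 => ?_
  have hI0 : Frame 9 [1, 7] s s1 ∧ s1.arr = s.arr ∧ s1.reg 10 = 0 := by
    subst e1
    exact ⟨(Frame.refl ..).setReg (by norm_num) _, rfl, by simp [Store.setReg_reg]⟩
  clear e1
  refine WP.seq (WP.forLoop (N := n + 1) (fun u s' => Frame 9 [1, 7] s s' ∧ s'.arr 1 = s.arr 1 ∧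
    s'.reg 10 = (∑ v, if vertexCode v < u then ((τ k).letter v).lam ((τ i).letter v) else 0) % 4 ∧
    IsMatrix (s'.arr 7) fun k' v => if k' = k ∧ vertexCode v < u then
      (((τ k).letter v).mul ((τ i).letter v)).code else ((τ k').letter v).code)
    hs1 le_rfl ?_ ?_ ?_) ?_
  · refine ⟨hI0.1.setReg le_rfl _, by rw [Store.setReg_arr, hI0.2.1], ?_, ?_⟩
    · simp [Store.setReg_reg, hI0.2.2]
    · simpa [hI0.2.1] using h.letter
  · intro u s' _ hI
    simp [Expr.eval, hI.1.reg 3 (by norm_num), h3]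
  · rintro u s' hu hs' h9 ⟨hF, hA1, h10, hM⟩
    obtain ⟨v, rfl⟩ := exists_vertexCode hu
    have r3 : s'.reg 3 = n + 1 := (hF.reg 3 (by norm_num)).trans h3
    have r8 : s'.reg 8 = k := (hF.reg 8 (by norm_num)).trans h8
    have r4 : s'.reg 4 = i := (hF.reg 4 (by norm_num)).trans h4
    have ek : (entry 7 (.reg 8) (.reg 9)).eval s' = ((τ k).letter v).code := by
      simp [entry_eval s' r3, Expr.eval, r8, h9, hM k v]
    have ei : (entry 7 (.reg 4) (.reg 9)).eval s' = ((τ i).letter v).code := by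
      simp [entry_eval s' r3, Expr.eval, r4, h9, hM i v, hki.symm]
    have hev : (Expr.mod (.add (.reg 10) (lamExpr (entry 7 (.reg 8) (.reg 9))
        (entry 7 (.reg 4) (.reg 9)))) (.const 4)).eval s' =
        (∑ w, if vertexCode w < vertexCode v + 1 then
          ((τ k).letter w).lam ((τ i).letter w) else 0) % 4 := by
      have := lamExpr_eval ek ei
      simp only [Expr.eval, this, h10, sum_vertexCode_succ fun w =>
        ((τ k).letter w).lam ((τ i).letter w), Nat.mod_add_mod]
    refine WP.seq (WP.set (Q := fun s'' => s'' = s'.setReg 10 _) hs' ?_ rfl) fun s2 hs2 e2 => ?_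
    · rw [hev]
      exact mod_four_lt_wordBound _ _
    rw [hev] at e2
    have r3' : s2.reg 3 = n + 1 := by subst e2; simpa [Store.setReg_reg] using r3
    have r8' : s2.reg 8 = k := by subst e2; simpa [Store.setReg_reg] using r8
    have r4' : s2.reg 4 = i := by subst e2; simpa [Store.setReg_reg] using r4
    have r9' : s2.reg 9 = vertexCode v := by subst e2; simpa [Store.setReg_reg] using h9
    have a2 : s2.arr = s'.arr := by subst e2; rfl
    have ek' : (entry 7 (.reg 8) (.reg 9)).eval s2 = ((τ k).letter v).code := by
      simp [entry_eval s2 r3', Expr.eval, r8', r9', a2, hM k v]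
    have ei' : (entry 7 (.reg 4) (.reg 9)).eval s2 = ((τ i).letter v).code := by
      simp [entry_eval s2 r3', Expr.eval, r4', r9', a2, hM i v, hki.symm]
    have hmul := mulExpr_eval ek' ei'
    refine WP.write hs2 ?_ ?_
    · rw [hmul]
      exact Letter.code_lt_wordBound _ _
    · rw [hmul, entryIndex_eval s2 r3']
      simp only [Expr.eval, r8', r9']
      refine ⟨r9', ((Frame.setCell ?_ (by simp) _ _).setReg le_rfl _), ?_, ?_, ?_⟩
      · subst e2
        exact hF.setReg (by norm_num) _
      · simpa [Store.setCell_arr_of_ne, a2] using hA1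
      · subst e2
        simp [Store.setReg_reg]
      · rw [Store.setReg_arr, Store.setCell_arr_self, a2]
        refine hM.update (by simp) fun k' v' hkv => if_congr ?_ rfl rfl
        refine and_congr_right fun hk => ?_
        have : vertexCode v' ≠ vertexCode v := fun hv => hkv ⟨hk, vertexCode_injective hv⟩
        omega
  · rintro s2 hs2 ⟨hF, hA1, h10, hM⟩
    have r8 : s2.reg 8 = k := (hF.reg 8 (by norm_num)).trans h8
    have r4 : s2.reg 4 = i := (hF.reg 4 (by norm_num)).trans h4
    have hlt : ∀ v : Option (Fin n), vertexCode v < n + 1 := fun v =>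
      Nat.lt_succ_of_le (vertexCode_le v)
    have hev : (Expr.mod (.add (.add (.read 1 (.reg 8)) (.read 1 (.reg 4))) (.reg 10))
        (.const 4)).eval s2 = ((τ k).mul (τ i)).phase := by
      simp [Expr.eval, r8, r4, h10, hA1, h.phase, hlt, Pauli.mul]
    refine WP.write hs2 ?_ ?_
    · rw [hev]
      exact mod_four_lt_wordBound _ _
    · rw [hev]
      simp only [Expr.eval, r8]
      refine ⟨hF.setCell (by simp) _ _, ?_, fun k' => ?_⟩
      · rw [Store.setCell_arr_of_ne _ (by norm_num)]
        intro k' v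
        rw [hM k' v]
        by_cases hk : k' = k
        · subst hk; simp [hlt, Pauli.mul]
        · simp [hk]
      · rw [Store.setCell_arr_self]
        by_cases hk : k' = k
        · subst hk; simp
        · simp [hk, hA1, h.phase]

/-- Clear column `c` (register 5) by row `i` (register 4). -/
def eliminateColumn : Program :=
  forLoop 8 (.reg 3) <|
    .ite (.mul (xbExpr (entry 7 (.reg 8) (.reg 5)))
      (.add (.lt (.reg 8) (.reg 4)) (.lt (.reg 4) (.reg 8)))) mulRow .skip

/-- Row `i` never changes during the loop, so all rows are treated with the same multiplier. Rows
from `n + 1` on have no flip in the column and are left alone by `elim` as well. -/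
theorem eliminateColumn_spec {s : Store} {τ : ℕ → Pauli (Option (Fin n))} {i : ℕ}
    {c : Option (Fin n)} (hs : Bounded n s) (h3 : s.reg 3 = n + 1) (h4 : s.reg 4 = i)
    (h5 : s.reg 5 = vertexCode c) (h : IsRows s τ)
    (htriv : ∀ k, n + 1 ≤ k → ((τ k).letter c).xb = 0) :
    WP n eliminateColumn s fun s' => Frame 8 [1, 7] s s' ∧ IsRows s' (elim τ i c) := by
  have hlast : (fun k => if k < n + 1 then elim τ i c k else τ k) = elim τ i c := by
    funext k
    by_cases hk : k < n + 1
    · simp [hk]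
    · simp [hk, elim, htriv k (by omega)]
  rw [← hlast]
  refine WP.forLoop (N := n + 1) (fun u s' => Frame 8 [1, 7] s s' ∧
    IsRows s' fun k => if k < u then elim τ i c k else τ k) hs le_rfl ?_ ?_ ?_
  · refine ⟨(Frame.refl ..).setReg le_rfl _, ?_⟩
    simp only [Nat.not_lt_zero, if_false]
    exact h.of_arr rfl rfl
  · intro u s' _ hI
    simp [Expr.eval, hI.1.reg 3 (by norm_num), h3]
  · rintro k s' hk hs' h8 ⟨hF, hR⟩
    have r3 : s'.reg 3 = n + 1 := (hF.reg 3 (by norm_num)).trans h3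
    have r4 : s'.reg 4 = i := (hF.reg 4 (by norm_num)).trans h4
    have r5 : s'.reg 5 = vertexCode c := (hF.reg 5 (by norm_num)).trans h5
    have hki : elim τ i c i = τ i := by simp [elim]
    have eki : (fun k' => if k' < k then elim τ i c k' else τ k') i = τ i := by simp [hki]
    have ekc : (entry 7 (.reg 8) (.reg 5)).eval s' = ((τ k).letter c).code := by
      simp [entry_eval s' r3, Expr.eval, r5, h8, hR.letter k c]
    have hcond : (Expr.mul (xbExpr (entry 7 (.reg 8) (.reg 5)))
        (.add (.lt (.reg 8) (.reg 4)) (.lt (.reg 4) (.reg 8)))).eval s' ≠ 0 ↔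
        k ≠ i ∧ ((τ k).letter c).xb = 1 := by
      have := xbExpr_eval ekc
      simp only [Expr.eval, this, h8, r4]
      split_ifs <;> simp_all <;> omega
    refine WP.ite hs' (fun he => ?_) fun he => ?_
    · rw [hcond] at he
      refine (mulRow_spec hs' r3 h8 r4 he.1 hR).mono fun s'' _ ⟨hF', hR'⟩ => ?_
      have r8 : s''.reg 8 = k := (hF'.reg 8 (by norm_num)).trans h8
      refine ⟨r8, (hF.trans (hF'.mono (by norm_num) (by simp))).setReg le_rfl _, ?_⟩
      have := hR'.of_arr (s' := s''.setReg 8 (k + 1)) rfl rfl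
      convert this using 1
      funext k'
      by_cases hk' : k' = k
      · subst hk'
        simp [elim, he.1, he.2]
      · rw [Function.update_of_ne hk']
        exact if_congr (by omega) rfl rfl
    · have he' : ¬ (k ≠ i ∧ ((τ k).letter c).xb = 1) := by
        rw [← hcond]; simpa using he
      refine WP.skip hs' ⟨h8, hF.setReg le_rfl _, ?_⟩
      have := hR.of_arr (s' := s'.setReg 8 (k + 1)) rfl rfl
      convert this using 1
      funext k'
      by_cases hk' : k' = k
      · subst hk'
        simp only [Nat.lt_succ_self, if_true, lt_irrefl, if_false, elim, if_neg he']
      · exact if_congr (by omega) rfl rfl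

/-- Conjugate column `c` (register 5) by the Hadamard gate, and record this in array 9. -/
def hadamardColumn : Program :=
  .seq (forLoop 8 (.reg 3) <|
    .seq (.write 1 (.reg 8) (.mod (.add (.read 1 (.reg 8))
      (.mul (.const 2) (isYExpr (entry 7 (.reg 8) (.reg 5))))) (.const 4)))
    (.write 7 (entryIndex (.reg 8) (.reg 5)) (swapExpr (entry 7 (.reg 8) (.reg 5)))))
  (.write 9 (.reg 5) (.const 1))

/-- The phase is updated before the letter because the sign depends on the old letter. Rows beyond
the loop are trivial, hence unchanged by the conjugation. -/
theorem hadamardColumn_spec {s : Store} {τ : ℕ → Pauli (Option (Fin n))}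
    {h : Option (Fin n) → ℕ} {c : Option (Fin n)} (hs : Bounded n s) (h3 : s.reg 3 = n + 1)
    (h5 : s.reg 5 = vertexCode c) (hR : IsRows s τ) (hv : IsVector (s.arr 9) h)
    (htriv : ∀ k, n + 1 ≤ k → τ k = ⟨0, fun _ => .one⟩) :
    WP n hadamardColumn s fun s' => Frame 8 [1, 7, 9] s s' ∧
      IsRows s' (fun k => (τ k).had c) ∧ IsVector (s'.arr 9) (Function.update h c 1) := by
  have hlast : (fun k => if k < n + 1 then (τ k).had c else τ k) = fun k => (τ k).had c := by
    funext k
    by_cases hk : k < n + 1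
    · simp [hk]
    · rw [if_neg hk, htriv k (by omega)]
      simp [Pauli.had, Letter.swap]
  refine WP.seq (WP.forLoop (N := n + 1) (fun u s' => Frame 8 [1, 7] s s' ∧
    IsRows s' fun k => if k < u then (τ k).had c else τ k) hs le_rfl ?_ ?_ ?_) ?_
  · refine ⟨(Frame.refl ..).setReg le_rfl _, ?_⟩
    simp only [Nat.not_lt_zero, if_false]
    exact hR.of_arr rfl rfl
  · intro u s' _ hI
    simp [Expr.eval, hI.1.reg 3 (by norm_num), h3]
  · rintro k s' hk hs' h8 ⟨hF, hR'⟩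
    have r3 : s'.reg 3 = n + 1 := (hF.reg 3 (by norm_num)).trans h3
    have r5 : s'.reg 5 = vertexCode c := (hF.reg 5 (by norm_num)).trans h5
    have ekc : (entry 7 (.reg 8) (.reg 5)).eval s' = ((τ k).letter c).code := by
      simp [entry_eval s' r3, Expr.eval, r5, h8, hR'.letter k c]
    have hev : (Expr.mod (.add (.read 1 (.reg 8))
        (.mul (.const 2) (isYExpr (entry 7 (.reg 8) (.reg 5))))) (.const 4)).eval s' =
        ((τ k).had c).phase := by
      have := isYExpr_eval ekc
      have hp := hR'.phase k
      simp only [lt_irrefl, if_false] at hp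
      simp [Expr.eval, this, h8, hp, Pauli.had]
    refine WP.seq (WP.write (Q := fun s'' => s'' = s'.setCell 1 k ((τ k).had c).phase) hs' ?_ ?_)
      fun s2 hs2 e2 => ?_
    · rw [hev]
      exact mod_four_lt_wordBound _ _
    · rw [hev]
      simp [Expr.eval, h8]
    have r3' : s2.reg 3 = n + 1 := by subst e2; exact r3
    have r5' : s2.reg 5 = vertexCode c := by subst e2; exact r5
    have r8' : s2.reg 8 = k := by subst e2; exact h8
    have a7 : s2.arr 7 = s'.arr 7 := by subst e2; exact Store.setCell_arr_of_ne _ (by norm_num) _ _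
    have ekc' : (entry 7 (.reg 8) (.reg 5)).eval s2 = ((τ k).letter c).code := by
      simp [entry_eval s2 r3', Expr.eval, r5', r8', a7, hR'.letter k c]
    have hsw := swapExpr_eval ekc'
    refine WP.write hs2 ?_ ?_
    · rw [hsw]
      exact Letter.code_lt_wordBound _ _
    · rw [hsw, entryIndex_eval s2 r3']
      simp only [Expr.eval, r8', r5']
      refine ⟨r8', (Frame.setCell ?_ (by simp) _ _).setReg le_rfl _, ?_, fun k' => ?_⟩
      · subst e2
        exact hF.setCell (by simp) _ _
      · rw [Store.setReg_arr, Store.setCell_arr_self, a7]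
        refine hR'.letter.update (by simp [Pauli.had]) fun k' v' hkv => ?_
        by_cases hk' : k' = k
        · subst hk'
          have : v' ≠ c := fun hv => hkv ⟨rfl, hv⟩
          simp [Pauli.had, Function.update_of_ne this]
        · rw [if_congr (show k' < k + 1 ↔ k' < k by omega) rfl rfl]
      · rw [Store.setReg_arr, Store.setCell_arr_of_ne _ (by norm_num)]
        subst e2
        rw [Store.setCell_arr_self]
        by_cases hk' : k' = k
        · subst hk'; simp
        · rw [Function.update_of_ne hk', hR'.phase]
          rw [if_congr (show k' < k ↔ k' < k + 1 by omega) rfl rfl]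
  · rintro s2 hs2 ⟨hF, hR2⟩
    rw [hlast] at hR2
    have r5 : s2.reg 5 = vertexCode c := (hF.reg 5 (by norm_num)).trans h5
    refine WP.write hs2 (lt_wordBound (by simp [Expr.eval])) ⟨?_, ?_, ?_⟩
    · exact (hF.mono le_rfl (by simp)).setCell (by simp) _ _
    · exact hR2.of_arr (Store.setCell_arr_of_ne _ (by norm_num) _ _)
        (Store.setCell_arr_of_ne _ (by norm_num) _ _)
    · rw [Store.setCell_arr_self, hF.arr 9 (by simp)]
      simp only [Expr.eval, r5]
      exact hv.update (by simp) fun v' hv' => by simp [hv']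

/-- Find a column without pivot in which row `i` (register 4) is not trivial (register 5). -/
def findColumn : Program :=
  forLoop 8 (.reg 3) <|
    .ite (.mul (.lt (.read 8 (.reg 8)) (.const 1)) (entry 7 (.reg 4) (.reg 8)))
      (.set 5 (.reg 8)) .skip

/-- The last suitable column is kept. The invariant promises a column only if a suitable one has
been passed, so existence is needed only at the end. -/
theorem findColumn_spec {s : Store} {τ : ℕ → Pauli (Option (Fin n))}
    {pr : Option (Fin n) → ℕ} {i : ℕ} (hs : Bounded n s) (h3 : s.reg 3 = n + 1)
    (h4 : s.reg 4 = i) (hR : IsRows s τ) (hv : IsVector (s.arr 8) pr)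
    (hex : ∃ c, pr c = 0 ∧ (τ i).letter c ≠ .one) :
    WP n findColumn s fun s' => Frame 5 [] s s' ∧
      ∃ c, s'.reg 5 = vertexCode c ∧ pr c = 0 ∧ (τ i).letter c ≠ .one := by
  have hW : WP n findColumn s fun s' => Frame 5 [] s s' ∧ ((∃ c, vertexCode c < n + 1 ∧ pr c = 0 ∧
      (τ i).letter c ≠ .one) →
      ∃ c, s'.reg 5 = vertexCode c ∧ pr c = 0 ∧ (τ i).letter c ≠ .one) := by
    refine WP.forLoop (N := n + 1) (fun u s' => Frame 5 [] s s' ∧ ((∃ c, vertexCode c < u ∧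
      pr c = 0 ∧ (τ i).letter c ≠ .one) →
      ∃ c, s'.reg 5 = vertexCode c ∧ pr c = 0 ∧ (τ i).letter c ≠ .one)) hs le_rfl ?_ ?_ ?_
    · exact ⟨(Frame.refl ..).setReg (by norm_num) _, by simp⟩
    · intro u s' _ hI
      simp [Expr.eval, hI.1.reg 3 (by norm_num), h3]
    · rintro k s' hk hs' h8 ⟨hF, hc⟩
      obtain ⟨v, rfl⟩ := exists_vertexCode hk
      have r3 : s'.reg 3 = n + 1 := (hF.reg 3 (by norm_num)).trans h3
      have r4 : s'.reg 4 = i := (hF.reg 4 (by norm_num)).trans h4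
      have hcond : (Expr.mul (.lt (.read 8 (.reg 8)) (.const 1))
          (entry 7 (.reg 4) (.reg 8))).eval s' ≠ 0 ↔ pr v = 0 ∧ (τ i).letter v ≠ .one := by
        have e : (entry 7 (.reg 4) (.reg 8)).eval s' = ((τ i).letter v).code := by
          simp [entry_eval s' r3, Expr.eval, r4, h8, hF.arr, hR.letter i v]
        have e' : s'.arr 8 (vertexCode v) = pr v := by rw [hF.arr 8 (by simp), hv v]
        have hcode : ((τ i).letter v).code = 0 ↔ (τ i).letter v = .one := by
          cases (τ i).letter v <;> simp [Letter.code]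
        simp [Expr.eval, e, h8, e', hcode]
      refine WP.ite hs' (fun he => ?_) fun he => ?_
      · rw [hcond] at he
        refine WP.set hs' (hs'.reg 8) ⟨by simp [Store.setReg_reg, h8],
          (hF.setReg le_rfl _).setReg (by norm_num) _, fun _ => ⟨v, ?_, he⟩⟩
        simp [Store.setReg_reg, Expr.eval, h8]
      · have he' : ¬ (pr v = 0 ∧ (τ i).letter v ≠ .one) := by
          rw [← hcond]; simpa using he
        refine WP.skip hs' ⟨h8, hF.setReg (by norm_num) _, ?_⟩
        rintro ⟨c, hc1, hc2⟩
        have hcv : c ≠ v := by rintro rfl; exact he' hc2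
        have : vertexCode c ≠ vertexCode v := fun h => hcv (vertexCode_injective h)
        simpa [Store.setReg_reg] using hc ⟨c, by omega, hc2⟩
  refine hW.mono fun s' _ ⟨hF, h⟩ => ⟨hF, h ?_⟩
  obtain ⟨c, hc⟩ := hex
  exact ⟨c, Nat.lt_succ_of_le (vertexCode_le c), hc⟩

end

section

variable {n : ℕ} {g : Fin (n - 1) → PauliOp n}

/-! ### The elimination as a program -/

/-- Compute `n + 1` (register 3) and copy the generators to array 7. -/
def copyInput : Program :=
  .seq (.set 3 (.add (.reg 0) (.const 1))) <|
  forLoop 4 (.sub (.reg 0) (.const 1)) <| forLoop 8 (.reg 0) <|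
    .write 7 (entryIndex (.reg 4) (.reg 8)) (.read 0 (.add (.mul (.reg 4) (.reg 0)) (.reg 8)))

theorem inputStore_bounded (g : Fin (n - 1) → PauliOp n) (j : Fin n) :
    Bounded n (inputStore g j) := by
  refine ⟨fun r => ?_, fun a i => ?_⟩
  · have := j.2
    simp only [inputStore]
    split_ifs <;> exact lt_wordBound (by omega)
  · simp only [inputStore]
    split_ifs
    · exact Letter.code_lt_wordBound _ _
    · exact lt_wordBound (Nat.zero_le _)
    · exact lt_wordBound (by omega)
    · exact lt_wordBound (Nat.zero_le _)
    · exact lt_wordBound (Nat.zero_le _)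

theorem inputStore_letter (g : Fin (n - 1) → PauliOp n) (j : Fin n) {k : ℕ} (hk : k < n - 1)
    (v : Fin n) : (inputStore g j).arr 0 (k * n + v) = ((genRows g k).letter (some v)).code := by
  have h1 : k * n + v < (n - 1) * n := by
    have := v.2
    calc k * n + v < k * n + n := by omega
      _ = (k + 1) * n := by ring
      _ ≤ (n - 1) * n := Nat.mul_le_mul_right _ hk
  have h2 : (⟨k * n + v, h1⟩ : Fin ((n - 1) * n)) = finProdFinEquiv (⟨k, hk⟩, v) := by
    ext
    simp [mul_comm, add_comm]
  simp only [inputStore, if_true, dif_pos h1, h2, Equiv.symm_apply_apply, genRows_of_lt hk]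
  rfl

theorem copyInput_spec (j : Fin n) :
    WP n copyInput (inputStore g j) fun s' => Frame 3 [7] (inputStore g j) s' ∧
      s'.reg 3 = n + 1 ∧ IsRows s' (genRows g) := by
  refine WP.seq (WP.set (Q := fun s' => s' = (inputStore g j).setReg 3 (n + 1))
    (inputStore_bounded g j) (lt_wordBound ?_) rfl) fun s1 hs1 e1 => ?_
  · simp [Expr.eval, inputStore]
  have f1 : Frame 3 [7] (inputStore g j) s1 := by
    subst e1
    exact (Frame.refl ..).setReg le_rfl _
  have r3 : s1.reg 3 = n + 1 := by subst e1; simp [Store.setReg_reg]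
  have a1 : s1.arr = (inputStore g j).arr := by subst e1; rfl
  clear e1
  have hreg0 : ∀ {s : Store}, Frame 3 [7] (inputStore g j) s → s.reg 0 = n := fun hF =>
    (hF.reg 0 (by norm_num)).trans rfl
  have hW : WP n (forLoop 4 (.sub (.reg 0) (.const 1)) <| forLoop 8 (.reg 0) <|
      .write 7 (entryIndex (.reg 4) (.reg 8))
        (.read 0 (.add (.mul (.reg 4) (.reg 0)) (.reg 8)))) s1 fun s' =>
      Frame 3 [7] (inputStore g j) s' ∧ s'.reg 3 = n + 1 ∧ IsMatrix (s'.arr 7) fun k v =>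
        if k < n - 1 then ((genRows g k).letter v).code else 0 := by
    refine WP.forLoop (N := n - 1) (fun k s' => Frame 3 [7] (inputStore g j) s' ∧
      s'.reg 3 = n + 1 ∧ IsMatrix (s'.arr 7) fun k' v =>
        if k' < k then ((genRows g k').letter v).code else 0) hs1 (by omega) ?_ ?_ ?_
    · refine ⟨f1.setReg (by norm_num) _, by simpa [Store.setReg_reg] using r3, fun k' v => ?_⟩
      simp [a1, inputStore]
    · intro k s' _ hI
      simp [Expr.eval, hreg0 hI.1]
    · rintro k s' hk hs' h4 ⟨hF, h3, hM⟩
      refine (WP.forLoop (N := n) (fun u s'' => Frame 3 [7] (inputStore g j) s'' ∧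
        s''.reg 3 = n + 1 ∧ s''.reg 4 = k ∧ IsMatrix (s''.arr 7) fun k' v =>
          if k' < k ∨ k' = k ∧ vertexCode v < u then ((genRows g k').letter v).code else 0)
        hs' (by omega) ?_ ?_ ?_).mono ?_
      · refine ⟨hF.setReg (by norm_num) _, by simpa [Store.setReg_reg] using h3,
          by simpa [Store.setReg_reg] using h4, ?_⟩
        simpa using hM
      · intro u s'' _ hI
        simp [Expr.eval, hreg0 hI.1]
      · rintro u s'' hu hs'' h8 ⟨hF', h3', h4', hM'⟩
        have hev : (Expr.read 0 (.add (.mul (.reg 4) (.reg 0)) (.reg 8))).eval s'' =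
            ((genRows g k).letter (some ⟨u, hu⟩)).code := by
          simp only [Expr.eval, h4', h8, hreg0 hF', hF'.arr 0 (by simp)]
          exact inputStore_letter g j hk ⟨u, hu⟩
        refine WP.write hs'' ?_ ?_
        · rw [hev]
          exact Letter.code_lt_wordBound _ _
        · rw [hev, entryIndex_eval s'' h3']
          simp only [Expr.eval, h4', h8]
          refine ⟨h8, (hF'.setCell (by simp) _ _).setReg (by norm_num) _,
            by simpa [Store.setReg_reg] using h3', by simpa [Store.setReg_reg] using h4', ?_⟩
          rw [Store.setReg_arr, Store.setCell_arr_self]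
          refine IsMatrix.update (v := some ⟨u, hu⟩) hM' (by simp [vertexCode]) fun k' v hkv => ?_
          refine if_congr (or_congr_right (and_congr_right fun hk' => ?_)) rfl rfl
          have : vertexCode v ≠ vertexCode (some (⟨u, hu⟩ : Fin n)) := fun h =>
            hkv ⟨hk', vertexCode_injective h⟩
          change vertexCode v ≠ u at this
          omega
      · rintro s'' - ⟨hF', h3', h4', hM'⟩
        refine ⟨h4', hF'.setReg (by norm_num) _, by simpa [Store.setReg_reg] using h3',
          fun k' v => (hM' k' v).trans ?_⟩
        -- The column of the reference system is never written; its zeros are the code of the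
        -- identity.
        cases v with
        | none =>
          by_cases hk' : k' < n - 1
          · dsimp only
            rw [genRows_of_lt hk']
            simp [PauliOp.extend, PauliOp.withLetter, Letter.code]
          · simp [show ¬ k' < k by omega, show ¬ k' = k by omega, show ¬ k' < k + 1 by omega]
        | some v =>
          have hv : vertexCode (some v) < n := v.2
          exact if_congr (by omega) rfl rfl
  refine hW.mono fun s' _ ⟨hF, h3, hM⟩ => ⟨hF, h3, fun k v => ?_, fun k => ?_⟩
  · rw [hM k v]
    by_cases hk : k < n - 1
    · simp [hk]
    · simp [hk, genRows, Letter.code]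
  · rw [hF.arr 1 (by simp)]
    by_cases hk : k < n - 1
    · simp only [inputStore, genRows_of_lt hk, if_true, dif_pos hk]
      rfl
    · simp [inputStore, hk, genRows]

theorem elim_phase_lt {τ : ℕ → Pauli (Option (Fin n))} (h : ∀ k, (τ k).phase < 4) (i : ℕ)
    (c : Option (Fin n)) (k : ℕ) : (elim τ i c k).phase < 4 := by
  unfold elim
  split_ifs
  · exact Nat.mod_lt _ (by norm_num)
  · exact h k

theorem genRows_phase_lt (g : Fin (n - 1) → PauliOp n) (k : ℕ) : (genRows g k).phase < 4 := by
  unfold genRows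
  split_ifs
  · exact Fin.is_lt _
  · exact Nat.zero_lt_succ _

/-- Reduce the rows of the generators. -/
def reduceRows : Program :=
  forLoop 4 (.sub (.reg 0) (.const 1)) <|
    .seq findColumn <|
    .seq (.ite (xbExpr (entry 7 (.reg 4) (.reg 5))) .skip hadamardColumn) <|
    .seq (.write 8 (.reg 5) (.add (.reg 4) (.const 1)))
    eliminateColumn

/-- The invariant is `Reduced`, started with empty pivot and Hadamard vectors, which are the zero
arrays 8 and 9. Phases stay below `4`, which later bounds the exponents of the phase gates. -/
theorem reduceRows_spec {s : Store} (hs : Bounded n s) (h0 : s.reg 0 = n)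
    (h3 : s.reg 3 = n + 1) (hg : IsStabilizer g) (hR : IsRows s (genRows g))
    (h8 : ∀ i, s.arr 8 i = 0) (h9 : ∀ i, s.arr 9 i = 0) :
    WP n reduceRows s fun s' => Frame 4 [1, 7, 8, 9] s s' ∧
      ∃ τ pr h, Reduced (n - 1) (n - 1) none (InCode g) τ pr h ∧ (∀ k, (τ k).phase < 4) ∧ IsRows s' τ ∧
        IsVector (s'.arr 8) pr ∧ IsVector (s'.arr 9) h := by
  refine WP.forLoop (N := n - 1) (fun i s' => Frame 4 [1, 7, 8, 9] s s' ∧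
    ∃ τ pr h, Reduced (n - 1) i none (InCode g) τ pr h ∧ (∀ k, (τ k).phase < 4) ∧ IsRows s' τ ∧
      IsVector (s'.arr 8) pr ∧ IsVector (s'.arr 9) h) hs (by omega) ?_ ?_ ?_
  · exact ⟨(Frame.refl ..).setReg le_rfl _, _, _, _, hg.reduced, genRows_phase_lt g, hR.of_arr rfl rfl,
      fun v => h8 _, fun v => h9 _⟩
  · intro k s' _ hI
    simp [Expr.eval, hI.1.reg 0 (by norm_num), h0]
  · rintro i s' hi hs' r4 ⟨hF, τ, pr, h, H, hph, hR', hv8, hv9⟩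
    have r3 : s'.reg 3 = n + 1 := (hF.reg 3 (by norm_num)).trans h3
    refine WP.seq (findColumn_spec hs' r3 r4 hR' hv8 (H.exists_column hi))
      fun s1 hs1 ⟨f1, c, r5, hc, hl⟩ => ?_
    have r31 : s1.reg 3 = n + 1 := (f1.reg 3 (by norm_num)).trans r3
    have r41 : s1.reg 4 = i := (f1.reg 4 (by norm_num)).trans r4
    have hR1 : IsRows s1 τ := hR'.of_arr (f1.arr 7 (by simp)) (f1.arr 1 (by simp))
    have hv91 : IsVector (s1.arr 9) h := by rw [f1.arr 9 (by simp)]; exact hv9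
    have hv81 : IsVector (s1.arr 8) pr := by rw [f1.arr 8 (by simp)]; exact hv8
    have F1 : Frame 4 [1, 7, 8, 9] s s1 := hF.trans (f1.mono (by norm_num) (by simp))
    have hx := xbExpr_eval (s := s1) (e := entry 7 (.reg 4) (.reg 5)) (a := (τ i).letter c) (by
      simp [entry_eval s1 r31, Expr.eval, r5, r41, hR1.letter i c])
    set τ' := if ((τ i).letter c).xb = 1 then τ else fun k => (τ k).had c with hτ'
    set h' := if ((τ i).letter c).xb = 1 then h else Function.update h c 1 with hh'
    have H' := H.step hi hc hl
    refine WP.seq (R := fun s2 => Frame 8 [1, 7, 9] s1 s2 ∧ IsRows s2 τ' ∧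
      IsVector (s2.arr 9) h') (WP.ite hs1 (fun he => ?_) fun he => ?_) fun s2 hs2 ⟨f2, hR2, hv92⟩ => ?_
    · have hxb : ((τ i).letter c).xb = 1 := by
        by_contra hne
        exact he (by rw [hx, if_neg hne])
      rw [hτ', hh', if_pos hxb, if_pos hxb]
      exact WP.skip hs1 ⟨Frame.refl .., hR1, hv91⟩
    · have hxb : ((τ i).letter c).xb ≠ 1 := by
        intro hxb
        rw [hx, if_pos hxb] at he
        exact absurd he (by norm_num)
      rw [hτ', hh', if_neg hxb, if_neg hxb]
      refine hadamardColumn_spec hs1 r31 r5 hR1 hv91 fun k hk => H.trivial k (by omega)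
    have r32 : s2.reg 3 = n + 1 := (f2.reg 3 (by norm_num)).trans r31
    have r42 : s2.reg 4 = i := (f2.reg 4 (by norm_num)).trans r41
    have r52 : s2.reg 5 = vertexCode c := (f2.reg 5 (by norm_num)).trans r5
    refine WP.seq (WP.write (Q := fun s3 => s3 = s2.setCell 8 (vertexCode c) (i + 1)) hs2
      (lt_wordBound ?_) ?_) fun s3 hs3 e3 => ?_
    · simp only [Expr.eval, r42]; omega
    · simp only [Expr.eval, r42, r52]
    have hR3 : IsRows s3 τ' := by
      subst e3
      exact hR2.of_arr (Store.setCell_arr_of_ne _ (by norm_num) _ _)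
        (Store.setCell_arr_of_ne _ (by norm_num) _ _)
    have hτtriv : ∀ k, n + 1 ≤ k → ((τ' k).letter c).xb = 0 := by
      intro k hk
      have := H.trivial k (by omega)
      rw [hτ']
      split_ifs
      · rw [this]; rfl
      · simp [this, Pauli.had, Letter.swap, Letter.xb]
    refine (eliminateColumn_spec (i := i) hs3 (by subst e3; exact r32) (by subst e3; exact r42)
      (by subst e3; exact r52) hR3 hτtriv).mono fun s4 _ ⟨f4, hR4⟩ => ?_
    have F4 : Frame 4 [1, 7, 8, 9] s s4 := by
      refine F1.trans ((f2.mono (by norm_num) (by simp)).trans (Frame.trans ?_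
        (f4.mono (by norm_num) (by simp))))
      subst e3
      exact (Frame.refl ..).setCell (by simp) _ _
    refine ⟨?_, F4.setReg le_rfl _, _, _, _, H', elim_phase_lt ?_ _ _, hR4.of_arr rfl rfl, ?_, ?_⟩
    · rw [f4.reg 4 (by norm_num), e3]
      exact r42
    · intro k
      split_ifs
      · exact hph k
      · exact Nat.mod_lt _ (by norm_num)
    · rw [Store.setReg_arr, f4.arr 8 (by simp), e3, Store.setCell_arr_self, f2.arr 8 (by simp)]
      exact hv81.update (by simp) fun v hv => by simp [hv]
    · rw [Store.setReg_arr, f4.arr 9 (by simp), e3, Store.setCell_arr_of_ne _ (by norm_num)]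
      exact hv92

end

section

variable {n : ℕ} {g : Fin (n - 1) → PauliOp n} {τ : ℕ → Pauli (Option (Fin n))}
  {pr h : Option (Fin n) → ℕ} {q : Fin n}

/-! ### The logical operators as a program -/

/-- Find the qubit whose column has no pivot (register 5). -/
def findFree : Program :=
  forLoop 8 (.reg 0) <| .ite (.lt (.read 8 (.reg 8)) (.const 1)) (.set 5 (.reg 8)) .skip

theorem findFree_spec {s : Store} (hs : Bounded n s) (h0 : s.reg 0 = n)
    (hv : IsVector (s.arr 8) pr) (hex : ∃ q : Fin n, pr (some q) = 0) :
    WP n findFree s fun s' => Frame 5 [] s s' ∧ ∃ q : Fin n, s'.reg 5 = q ∧ pr (some q) = 0 := by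
  have hW : WP n findFree s fun s' => Frame 5 [] s s' ∧
      ((∃ q : Fin n, (q : ℕ) < n ∧ pr (some q) = 0) →
        ∃ q : Fin n, s'.reg 5 = q ∧ pr (some q) = 0) := by
    refine WP.forLoop (N := n) (fun u s' => Frame 5 [] s s' ∧
      ((∃ q : Fin n, (q : ℕ) < u ∧ pr (some q) = 0) →
        ∃ q : Fin n, s'.reg 5 = q ∧ pr (some q) = 0)) hs (by omega) ?_ ?_ ?_
    · exact ⟨(Frame.refl ..).setReg (by norm_num) _, by simp⟩
    · intro u s' _ hI
      simp [Expr.eval, hI.1.reg 0 (by norm_num), h0]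
    · rintro k s' hk hs' h8 ⟨hF, hc⟩
      have hk8 : s'.arr 8 k = pr (some ⟨k, hk⟩) := by
        rw [hF.arr 8 (by simp)]
        exact hv (some ⟨k, hk⟩)
      have hcond : (Expr.lt (.read 8 (.reg 8)) (.const 1)).eval s' ≠ 0 ↔
          pr (some ⟨k, hk⟩) = 0 := by
        simp [Expr.eval, h8, hk8]
      refine WP.ite hs' (fun he => ?_) fun he => ?_
      · rw [hcond] at he
        refine WP.set hs' (hs'.reg 8) ⟨by simp [Store.setReg_reg, h8],
          (hF.setReg le_rfl _).setReg (by norm_num) _, fun _ => ⟨⟨k, hk⟩, ?_, he⟩⟩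
        simp [Store.setReg_reg, Expr.eval, h8]
      · have he' : ¬ pr (some ⟨k, hk⟩) = 0 := by
          rw [← hcond]; simpa using he
        refine WP.skip hs' ⟨h8, hF.setReg (by norm_num) _, ?_⟩
        rintro ⟨c, hc1, hc2⟩
        have hcv : (c : ℕ) ≠ k := by rintro rfl; exact he' hc2
        simpa [Store.setReg_reg] using hc ⟨c, by omega, hc2⟩
  refine hW.mono fun s' _ ⟨hF, h⟩ => ⟨hF, h ?_⟩
  obtain ⟨c, hc⟩ := hex
  exact ⟨c, c.2, hc⟩

/-- The letters of the logical operators `Z` and `X` at vertex `v` (register 8), in registers 9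
and 10. -/
def pickLetters : Program :=
  .ite (.lt (.reg 8) (.reg 0))
    (.ite (.read 8 (.reg 8))
      (.seq (.set 7 (.sub (.read 8 (.reg 8)) (.const 1)))
      (.seq (.set 9 (.mul (.const 3) (zbExpr (entry 7 (.reg 7) (.reg 5)))))
        (.set 10 (.mul (.const 3) (xbExpr (entry 7 (.reg 7) (.reg 5)))))))
      (.seq (.set 9 (.const 1)) (.set 10 (.const 3))))
    (.seq (.set 9 (.const 3)) (.set 10 (.const 1)))

/-- The matrix is required only in the free column and the rows of the generators, since the two
other rows are being overwritten while this runs. -/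
theorem pickLetters_spec {s : Store} (hs : Bounded n s) (h0 : s.reg 0 = n) (h3 : s.reg 3 = n + 1)
    (h5 : s.reg 5 = vertexCode (some q)) {v : Option (Fin n)} (h8 : s.reg 8 = vertexCode v)
    (hv : IsVector (s.arr 8) pr) (hpr : ∀ v, pr v ≤ n - 1)
    (hA : ∀ k < n - 1, s.arr 7 (k * (n + 1) + vertexCode (some q)) =
      ((τ k).letter (some q)).code) :
    WP n pickLetters s fun s' => Frame 7 [] s s' ∧ s'.reg 8 = s.reg 8 ∧
      s'.reg 9 = ((zRow τ pr q).letter v).code ∧ s'.reg 10 = ((xRow τ pr q).letter v).code := by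
  have two : ∀ a b : ℕ, a ≤ 3 → b ≤ 3 → WP n (.seq (.set 9 (.const a)) (.set 10 (.const b))) s
      fun s' => Frame 7 [] s s' ∧ s'.reg 8 = s.reg 8 ∧ s'.reg 9 = a ∧ s'.reg 10 = b := by
    intro a b ha hb
    refine WP.seq (WP.set (Q := fun s' => s' = s.setReg 9 a) hs (lt_wordBound ?_) rfl ?_)
      fun s1 hs1 e1 => WP.set hs1 (lt_wordBound ?_) ?_ ?_
    · simp only [Expr.eval]; omega
    · simp only [Expr.deg]; omega
    · simp only [Expr.eval]; omega
    · subst e1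
      exact ⟨((Frame.refl ..).setReg (by norm_num) _).setReg (by norm_num) _,
        by simp [Store.setReg_reg], by simp [Store.setReg_reg],
        by simp [Store.setReg_reg, Expr.eval]⟩
    · simp only [Expr.deg]; omega
  have e8 : s.arr 8 (s.reg 8) = pr v := by rw [h8, hv v]
  refine WP.ite hs (fun he => WP.ite hs (fun he' => ?_) fun he' => ?_) fun he => ?_
  · cases v with
    | none => simp [Expr.eval, h0, h8, vertexCode] at he
    | some v =>
      simp only [Expr.eval, e8] at he'
      have hle := hpr (some v)
      have hval : (Expr.sub (.read 8 (.reg 8)) (.const 1)).eval s = pr (some v) - 1 := by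
        simp [Expr.eval, e8]
      refine WP.seq (WP.set (Q := fun s' => s' = s.setReg 7 (pr (some v) - 1)) hs
        (lt_wordBound (by rw [hval]; omega)) (by rw [hval])) fun s1 hs1 e1 => ?_
      have key : ∀ s' : Store, Frame 7 [] s s' → s'.reg 7 = pr (some v) - 1 →
          (entry 7 (.reg 7) (.reg 5)).eval s' = ((τ (pr (some v) - 1)).letter (some q)).code := by
        intro s' hF h7
        rw [entry_eval s' ((hF.reg 3 (by norm_num)).trans h3)]
        simp only [Expr.eval, h7, hF.reg 5 (by norm_num), h5, hF.arr 7 (by simp)]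
        exact hA _ (by omega)
      have f1 : Frame 7 [] s s1 := by subst e1; exact (Frame.refl ..).setReg (by norm_num) _
      have hz := zbExpr_eval (key s1 f1 (by subst e1; simp [Store.setReg_reg]))
      have hzv : (Expr.mul (.const 3) (zbExpr (entry 7 (.reg 7) (.reg 5)))).eval s1 =
          ((zRow τ pr q).letter (some v)).code := by
        simp only [Expr.eval, hz, zRow, Option.elim_some, he', if_false]
        split_ifs <;> rfl
      refine WP.seq (WP.set (Q := fun s' => s' = s1.setReg 9
        ((zRow τ pr q).letter (some v)).code) hs1 ?_ (by rw [hzv])) fun s2 hs2 e2 => ?_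
      · rw [hzv]
        exact Letter.code_lt_wordBound _ _
      have f2 : Frame 7 [] s s2 := by subst e2; exact f1.setReg (by norm_num) _
      have hx := xbExpr_eval (key s2 f2 (by subst e2 e1; simp [Store.setReg_reg]))
      have hxv : (Expr.mul (.const 3) (xbExpr (entry 7 (.reg 7) (.reg 5)))).eval s2 =
          ((xRow τ pr q).letter (some v)).code := by
        simp only [Expr.eval, hx, xRow, Option.elim_some, he', if_false]
        split_ifs <;> rfl
      refine WP.set hs2 ?_ ⟨f2.setReg (by norm_num) _, ?_, ?_, ?_⟩
      · rw [hxv]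
        exact Letter.code_lt_wordBound _ _
      · subst e2 e1; simp [Store.setReg_reg]
      · subst e2 e1; simp [Store.setReg_reg]
      · rw [hxv]; simp [Store.setReg_reg]
  · refine (two 1 3 (by norm_num) (by norm_num)).mono fun s' _ hs' => ?_
    cases v with
    | none => simp [Expr.eval, h0, h8, vertexCode] at he
    | some v =>
      simp only [Expr.eval, e8] at he'
      simpa [zRow, xRow, he', Letter.code] using hs'
  · refine (two 3 1 (by norm_num) (by norm_num)).mono fun s' _ hs' => ?_
    cases v with
    | none => simpa [zRow, xRow, Letter.code] using hs'
    | some v => 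
      simp only [Expr.eval, h0, h8, vertexCode, v.2, if_true] at he
      exact absurd he (by norm_num)

/-- Write the rows of the logical operators to the matrix, and the logical operators themselves to
arrays 5 and 6. -/
def writeLogical : Program :=
  .seq (.set 6 (.sub (.reg 0) (.const 1))) <|
  forLoop 8 (.reg 3) <|
    .seq pickLetters <|
    .seq (.write 7 (entryIndex (.reg 6) (.reg 8)) (.reg 9)) <|
    .seq (.write 7 (entryIndex (.reg 0) (.reg 8)) (.reg 10)) <|
    .ite (.read 9 (.reg 8))
      (.seq (.write 5 (.reg 8) (swapExpr (.reg 9))) (.write 6 (.reg 8) (swapExpr (.reg 10))))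
      (.seq (.write 5 (.reg 8) (.reg 9)) (.write 6 (.reg 8) (.reg 10)))

theorem IsVector.partial_update {A : ℕ → ℕ} {f : Option (Fin n) → ℕ} {v : Option (Fin n)} {x : ℕ}
    (hA : ∀ w, vertexCode w < vertexCode v → A (vertexCode w) = f w) (hx : x = f v)
    (w : Option (Fin n)) (hw : vertexCode w < vertexCode v + 1) :
    Function.update A (vertexCode v) x (vertexCode w) = f w := by
  by_cases hwv : w = v
  · subst hwv; simpa using hx
  · have hne : vertexCode w ≠ vertexCode v := fun h => hwv (vertexCode_injective h)
    rw [Function.update_of_ne hne]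
    exact hA w (by omega)

/-- Rows `n - 1` and `n` were trivial, so array 1 already holds the phase `0` of the logical rows.
Array 9 tells where a letter must be conjugated back to obtain the logical operator of the original
code. -/
theorem writeLogical_spec {s : Store} (hs : Bounded n s) (h0 : s.reg 0 = n) (h3 : s.reg 3 = n + 1)
    (h5 : s.reg 5 = q) (hn : 0 < n) (hR : IsRows s τ) (hv8 : IsVector (s.arr 8) pr)
    (hv9 : IsVector (s.arr 9) h) (hpr : ∀ v, pr v ≤ n - 1) (hh : ∀ v, h v ≤ 1)
    (htriv : ∀ k, n - 1 ≤ k → τ k = ⟨0, fun _ => .one⟩) :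
    WP n writeLogical s fun s' => Frame 6 [5, 6, 7] s s' ∧ IsRows s' (logicalRows τ pr q) ∧
      IsVector (s'.arr 5) (fun v => (((zRow τ pr q).hads h).letter v).code) ∧
      IsVector (s'.arr 6) (fun v => (((xRow τ pr q).hads h).letter v).code) := by
  have hval : (Expr.sub (.reg 0) (.const 1)).eval s = n - 1 := by simp [Expr.eval, h0]
  refine WP.seq (WP.set (Q := fun s' => s' = s.setReg 6 (n - 1)) hs
    (lt_wordBound (by rw [hval]; omega)) (by rw [hval])) fun s1 hs1 e1 => ?_
  have f1 : Frame 6 [5, 6, 7] s s1 := by subst e1; exact (Frame.refl ..).setReg le_rfl _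
  have r61 : s1.reg 6 = n - 1 := by subst e1; simp [Store.setReg_reg]
  have a1 : s1.arr = s.arr := by subst e1; rfl
  clear e1
  refine (WP.forLoop (N := n + 1) (fun u s' => Frame 6 [5, 6, 7] s s' ∧ s'.reg 6 = n - 1 ∧
    IsMatrix (s'.arr 7) (fun k v => if vertexCode v < u then ((logicalRows τ pr q k).letter v).code
      else ((τ k).letter v).code) ∧
    (∀ w, vertexCode w < u →
      s'.arr 5 (vertexCode w) = (((zRow τ pr q).hads h).letter w).code) ∧
    (∀ w, vertexCode w < u →
      s'.arr 6 (vertexCode w) = (((xRow τ pr q).hads h).letter w).code))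
    hs1 le_rfl ?_ ?_ ?_).mono ?_
  · refine ⟨f1.setReg (by norm_num) _, by simpa [Store.setReg_reg] using r61, ?_, by simp, by simp⟩
    simpa [a1] using hR.letter
  · intro u s' _ hI
    simp [Expr.eval, hI.1.reg 3 (by norm_num), h3]
  · rintro u s' hu hs' r8 ⟨hF, r6, hM, hz, hx⟩
    obtain ⟨v, rfl⟩ := exists_vertexCode hu
    have r0 : s'.reg 0 = n := (hF.reg 0 (by norm_num)).trans h0
    have r3 : s'.reg 3 = n + 1 := (hF.reg 3 (by norm_num)).trans h3
    have r5 : s'.reg 5 = vertexCode (some q) := (hF.reg 5 (by norm_num)).trans h5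
    have a8 : IsVector (s'.arr 8) pr := by rw [hF.arr 8 (by simp)]; exact hv8
    have a9 : IsVector (s'.arr 9) h := by rw [hF.arr 9 (by simp)]; exact hv9
    refine WP.seq (pickLetters_spec (τ := τ) hs' r0 r3 r5 r8 a8 hpr fun k hk => ?_)
      fun s2 hs2 ⟨f2, r82, r92, r102⟩ => ?_
    · rw [hM k (some q)]
      simp [logicalRows, show k ≠ n - 1 by omega, show k ≠ n by omega]
    have r02 : s2.reg 0 = n := (f2.reg 0 (by norm_num)).trans r0
    have r32 : s2.reg 3 = n + 1 := (f2.reg 3 (by norm_num)).trans r3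
    have r62 : s2.reg 6 = n - 1 := (f2.reg 6 (by norm_num)).trans r6
    have r82' : s2.reg 8 = vertexCode v := r82.trans r8
    refine WP.seq (WP.write (Q := fun s3 => s3 = s2.setCell 7 ((n - 1) * (n + 1) + vertexCode v)
      ((zRow τ pr q).letter v).code) hs2 (hs2.reg 9) ?_) fun s3 hs3 e3 => ?_
    · rw [entryIndex_eval s2 r32]
      simp only [Expr.eval, r62, r82', r92]
    have g3 : s3.reg = s2.reg := by subst e3; rfl
    refine WP.seq (WP.write (Q := fun s4 => s4 = s3.setCell 7 (n * (n + 1) + vertexCode v)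
      ((xRow τ pr q).letter v).code) hs3 (hs3.reg 10) ?_) fun s4 hs4 e4 => ?_
    · rw [entryIndex_eval s3 (by rw [g3, r32])]
      simp only [Expr.eval, g3, r02, r82', r102]
    have g4 : s4.reg = s2.reg := by subst e4; exact g3
    have F4 : Frame 6 [5, 6, 7] s s4 := by
      refine hF.trans ((f2.mono (by norm_num) (by simp)).trans ?_)
      subst e4 e3
      exact ((Frame.refl ..).setCell (by simp) _ _).setCell (by simp) _ _
    have a7 : IsMatrix (s4.arr 7) (fun k w => if vertexCode w < vertexCode v + 1 then
        ((logicalRows τ pr q k).letter w).code else ((τ k).letter w).code) := by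
      have e : s4.arr 7 = Function.update (Function.update (s'.arr 7)
          ((n - 1) * (n + 1) + vertexCode v) ((zRow τ pr q).letter v).code)
          (n * (n + 1) + vertexCode v) ((xRow τ pr q).letter v).code := by
        subst e4 e3
        rw [Store.setCell_arr_self, Store.setCell_arr_self, f2.arr 7 (by simp)]
      rw [e]
      have hnn : ¬ n = n - 1 := by omega
      -- Between the two writes column `v` holds the new letter in row `n - 1` but not yet in row
      -- `n`.
      refine IsMatrix.update (f := fun k w => if vertexCode w < vertexCode v ∨ w = v ∧ k = n - 1 then
        ((logicalRows τ pr q k).letter w).code else ((τ k).letter w).code)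
        (IsMatrix.update hM ?_ ?_) ?_ ?_
      · simp [logicalRows]
      · intro k w hkw
        exact if_congr (by tauto) rfl rfl
      · simp [logicalRows, hnn]
      · intro k w hkw
        by_cases hwv : w = v
        · subst hwv
          have hk : k ≠ n := fun h => hkw ⟨h, rfl⟩
          by_cases hk' : k = n - 1
          · simp [hk']
          · simp [hk', hk, logicalRows]
        · have hne : vertexCode w ≠ vertexCode v := fun h => hwv (vertexCode_injective h)
          refine if_congr ?_ rfl rfl
          constructor
          · intro hlt; exact Or.inl (by omega)
          · rintro (hlt | hlt)
            · omega
            · exact absurd hlt.1 hwv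
    have a5 : s4.arr 5 = s'.arr 5 := by
      subst e4 e3
      rw [Store.setCell_arr_of_ne _ (by norm_num), Store.setCell_arr_of_ne _ (by norm_num),
        f2.arr 5 (by simp)]
    have a6 : s4.arr 6 = s'.arr 6 := by
      subst e4 e3
      rw [Store.setCell_arr_of_ne _ (by norm_num), Store.setCell_arr_of_ne _ (by norm_num),
        f2.arr 6 (by simp)]
    have a94 : s4.arr 9 (s4.reg 8) = h v := by
      rw [g4, r82', F4.arr 9 (by simp), hv9 v]
    have fin : ∀ e f : Expr, e.deg ≤ 100 → f.deg ≤ 100 →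
        e.eval s4 = (((zRow τ pr q).hads h).letter v).code →
        (∀ i x, f.eval (s4.setCell 5 i x) = (((xRow τ pr q).hads h).letter v).code) →
        WP n (.seq (.write 5 (.reg 8) e) (.write 6 (.reg 8) f)) s4 fun s'' =>
          s''.reg 8 = vertexCode v ∧ Frame 6 [5, 6, 7] s (s''.setReg 8 (vertexCode v + 1)) ∧
          (s''.setReg 8 (vertexCode v + 1)).reg 6 = n - 1 ∧
          IsMatrix ((s''.setReg 8 (vertexCode v + 1)).arr 7)
            (fun k w => if vertexCode w < vertexCode v + 1 then
              ((logicalRows τ pr q k).letter w).code else ((τ k).letter w).code) ∧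
          (∀ w, vertexCode w < vertexCode v + 1 → (s''.setReg 8 (vertexCode v + 1)).arr 5
            (vertexCode w) = (((zRow τ pr q).hads h).letter w).code) ∧
          (∀ w, vertexCode w < vertexCode v + 1 → (s''.setReg 8 (vertexCode v + 1)).arr 6
            (vertexCode w) = (((xRow τ pr q).hads h).letter w).code) := by
      intro e f hed hfd he hf
      refine WP.seq (WP.write (Q := fun s5 => s5 = s4.setCell 5 (vertexCode v)
        (((zRow τ pr q).hads h).letter v).code) hs4 ?_ ?_ (by decide) hed) fun s5 hs5 e5 =>
        WP.write hs5 ?_ ?_ (by decide) hfd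
      · rw [he]; exact Letter.code_lt_wordBound _ _
      · simp only [he, Expr.eval, g4, r82']
      · rw [e5, hf]; exact Letter.code_lt_wordBound _ _
      · have r85 : s5.reg 8 = vertexCode v := by rw [e5, Store.setCell_reg, g4, r82']
        rw [show f.eval s5 = _ from e5 ▸ hf _ _]
        simp only [Expr.eval, r85]
        refine ⟨by simp [r85], ((Frame.setCell ?_ (by simp) _ _).setReg (by norm_num) _), ?_, ?_,
          ?_, ?_⟩
        · rw [e5]
          exact F4.setCell (by simp) _ _
        · simp [Store.setReg_reg, e5, g4, r62]
        · rw [Store.setReg_arr, Store.setCell_arr_of_ne _ (by norm_num), e5,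
            Store.setCell_arr_of_ne _ (by norm_num)]
          exact a7
        · rw [Store.setReg_arr, Store.setCell_arr_of_ne _ (by norm_num), e5,
            Store.setCell_arr_self, a5]
          exact fun w hw => IsVector.partial_update (f := fun w =>
            (((zRow τ pr q).hads h).letter w).code) hz rfl w hw
        · rw [Store.setReg_arr, Store.setCell_arr_self, e5,
            Store.setCell_arr_of_ne _ (by norm_num), a6]
          exact fun w hw => IsVector.partial_update (f := fun w =>
            (((xRow τ pr q).hads h).letter w).code) hx rfl w hw
    have r94 : s4.reg 9 = ((zRow τ pr q).letter v).code := by rw [g4, r92]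
    have r104 : s4.reg 10 = ((xRow τ pr q).letter v).code := by rw [g4, r102]
    refine WP.ite hs4 (fun he => ?_) fun he => ?_
    · simp only [Expr.eval, a94] at he
      have hv1 : h v = 1 := by have := hh v; omega
      refine fin _ _ (by decide) (by decide) ?_ fun i x => ?_
      · rw [swapExpr_eval (a := (zRow τ pr q).letter v) (by simp [Expr.eval, r94])]
        simp [Pauli.hads, hv1]
      · rw [swapExpr_eval (a := (xRow τ pr q).letter v) (by simp [Expr.eval, r104])]
        simp [Pauli.hads, hv1]
    · simp only [Expr.eval, a94] at he
      refine fin _ _ (by decide) (by decide) ?_ fun i x => ?_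
      · simp [Expr.eval, r94, Pauli.hads, he]
      · simp [Expr.eval, r104, Pauli.hads, he]
  · rintro s' - ⟨hF, -, hM, hz, hx⟩
    have hlt : ∀ v : Option (Fin n), vertexCode v < n + 1 := fun v =>
      Nat.lt_succ_of_le (vertexCode_le v)
    refine ⟨hF, ⟨fun k v => ?_, fun k => ?_⟩, fun v => hz v (hlt v), fun v => hx v (hlt v)⟩
    · rw [hM k v]; simp [hlt]
    · rw [hF.arr 1 (by simp), hR.phase]
      unfold logicalRows
      split_ifs with hk hk
      · rw [htriv k (by omega)]; rfl
      · rw [htriv k (by omega)]; rfl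
      · rfl

end

section

variable {n : ℕ} {g : Fin (n - 1) → PauliOp n} {τ : ℕ → Pauli (Option (Fin n))}
  {pr h : Option (Fin n) → ℕ} {q : Fin n}

/-! ### The graph as a program -/

/-- Clear the last column by the row of the logical operator `Z`, and record the pivots of the rows
of the logical operators. -/
def finishElimination : Program :=
  .seq (.set 4 (.sub (.reg 0) (.const 1))) <|
  .seq eliminateColumn <|
  .seq (.write 8 (.reg 5) (.reg 0)) (.write 8 (.reg 0) (.reg 3))

/-- Pivots are stored as row number plus one: the `Z` row `n - 1` is entered as `n` at the free
qubit, the `X` row `n` as `n + 1` at the reference system. -/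
theorem finishElimination_spec {s : Store} (hs : Bounded n s) (h0 : s.reg 0 = n)
    (h3 : s.reg 3 = n + 1) (h5 : s.reg 5 = q) (hR : IsRows s (logicalRows τ pr q))
    (hv8 : IsVector (s.arr 8) pr) (htriv : ∀ k, n - 1 ≤ k → τ k = ⟨0, fun _ => .one⟩) :
    WP n finishElimination s fun s' => Frame 4 [1, 7, 8] s s' ∧
      IsRows s' (elim (logicalRows τ pr q) (n - 1) (some q)) ∧
      IsVector (s'.arr 8) (Function.update (Function.update pr (some q) n) none (n + 1)) := by
  have hval : (Expr.sub (.reg 0) (.const 1)).eval s = n - 1 := by simp [Expr.eval, h0]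
  refine WP.seq (WP.set (Q := fun s' => s' = s.setReg 4 (n - 1)) hs
    (lt_wordBound (by rw [hval]; omega)) (by rw [hval])) fun s1 hs1 e1 => ?_
  have f1 : Frame 4 [1, 7, 8] s s1 := by subst e1; exact (Frame.refl ..).setReg le_rfl _
  have r51 : s1.reg 5 = vertexCode (some q) := by subst e1; exact h5
  refine WP.seq (eliminateColumn_spec (i := n - 1) (c := some q) hs1 ((f1.reg 3 (by norm_num)).trans h3)
    (by subst e1; simp [Store.setReg_reg]) r51
    (hR.of_arr (by rw [e1, Store.setReg_arr]) (by rw [e1, Store.setReg_arr])) fun k hk => ?_)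
    fun s2 hs2 ⟨f2, hR2⟩ => ?_
  · simp only [logicalRows, show ¬ k = n - 1 by omega, show ¬ k = n by omega, if_false,
      htriv k (by omega)]
    rfl
  have F2 : Frame 4 [1, 7, 8] s s2 := f1.trans (f2.mono (by norm_num) (by simp))
  have r52 : s2.reg 5 = vertexCode (some q) := (f2.reg 5 (by norm_num)).trans r51
  have r02 : s2.reg 0 = n := (F2.reg 0 (by norm_num)).trans h0
  have r32 : s2.reg 3 = n + 1 := (F2.reg 3 (by norm_num)).trans h3
  have a82 : s2.arr 8 = s.arr 8 := by rw [f2.arr 8 (by simp), e1, Store.setReg_arr]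
  refine WP.seq (WP.write (Q := fun s3 => s3 = s2.setCell 8 (vertexCode (some q)) n) hs2
    (hs2.reg 0) ?_) fun s3 hs3 e3 => ?_
  · simp only [Expr.eval, r02, r52]
  have r03 : s3.reg 0 = vertexCode (none : Option (Fin n)) := by rw [e3, Store.setCell_reg, r02]; rfl
  have r33 : s3.reg 3 = n + 1 := by rw [e3, Store.setCell_reg, r32]
  refine WP.write hs3 (hs3.reg 3) ?_
  simp only [Expr.eval]
  rw [r03, r33, e3]
  refine ⟨(F2.setCell (by simp) _ _).setCell (by simp) _ _, hR2.of_arr ?_ ?_, ?_⟩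
  · rw [Store.setCell_arr_of_ne _ (by norm_num), Store.setCell_arr_of_ne _ (by norm_num)]
  · rw [Store.setCell_arr_of_ne _ (by norm_num), Store.setCell_arr_of_ne _ (by norm_num)]
  · rw [Store.setCell_arr_self, Store.setCell_arr_self, a82]
    refine IsVector.update (f := Function.update pr (some q) n) (hv8.update (by simp) fun v hv => ?_)
      (by simp) fun v hv => ?_
    · rw [Function.update_of_ne hv]
    · rw [Function.update_of_ne hv]

/-- Write the adjacency matrix and the exponents of the local Clifford operators. -/
def writeGraph : Program :=
  forLoop 4 (.reg 3) <|
    .seq (.set 6 (.sub (.read 8 (.reg 4)) (.const 1))) <|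
    .seq (.write 3 (.mul (.const 4) (.reg 4))
      (.add (.read 1 (.reg 6)) (.mul (.const 3) (isYExpr (entry 7 (.reg 6) (.reg 4)))))) <|
    .seq (.write 3 (.add (.mul (.const 4) (.reg 4)) (.const 1)) (.read 9 (.reg 4))) <|
    .seq (.write 3 (.add (.mul (.const 4) (.reg 4)) (.const 2)) (.const 0)) <|
    .seq (.write 3 (.add (.mul (.const 4) (.reg 4)) (.const 3)) (.const 0)) <|
    forLoop 8 (.reg 3) <|
      .write 2 (entryIndex (.reg 4) (.reg 8)) (.mul (zbExpr (entry 7 (.reg 6) (.reg 8)))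
        (.add (.lt (.reg 4) (.reg 8)) (.lt (.reg 8) (.reg 4))))

/-- The four exponents of the Clifford operator at vertex `v`. -/
def HasExponents (A : ℕ → ℕ) (v : Option (Fin n)) (a b : ℕ) : Prop :=
  A (4 * vertexCode v) = a ∧ A (4 * vertexCode v + 1) = b ∧ A (4 * vertexCode v + 2) = 0 ∧
    A (4 * vertexCode v + 3) = 0

/-- `p u - 1` is the row with pivot at `u`, and its `Z` bits are the neighbours of `u`. The sum of
the two comparisons is `1` off the diagonal and `0` on it, which discards the `Z` bit that a letter
`Y` has at the vertex itself. -/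
theorem writeGraph_spec {s : Store} {ρ : ℕ → Pauli (Option (Fin n))} {p : Option (Fin n) → ℕ}
    (hn : 0 < n) (hs : Bounded n s) (h3 : s.reg 3 = n + 1) (hR : IsRows s ρ)
    (hph : ∀ k, (ρ k).phase < 4) (hv8 : IsVector (s.arr 8) p) (hp : ∀ v, p v ≤ n + 1)
    (hv9 : IsVector (s.arr 9) h) :
    WP n writeGraph s fun s' => Frame 4 [2, 3] s s' ∧
      (∀ v, HasExponents (s'.arr 3) v (rowExponent (ρ (p v - 1)) v) (h v)) ∧
      ∀ u v, s'.arr 2 (vertexCode u * (n + 1) + vertexCode v) =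
        if u ≠ v ∧ ((ρ (p u - 1)).letter v).zb = 1 then 1 else 0 := by
  have hlt : ∀ v : Option (Fin n), vertexCode v < n + 1 := fun v =>
    Nat.lt_succ_of_le (vertexCode_le v)
  refine (WP.forLoop (N := n + 1) (fun k s' => Frame 4 [2, 3] s s' ∧
    (∀ v, vertexCode v < k → HasExponents (s'.arr 3) v (rowExponent (ρ (p v - 1)) v) (h v)) ∧
    ∀ u v, vertexCode u < k → s'.arr 2 (vertexCode u * (n + 1) + vertexCode v) =
      if u ≠ v ∧ ((ρ (p u - 1)).letter v).zb = 1 then 1 else 0) hs le_rfl ?_ ?_ ?_).mono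
    fun s' _ ⟨hF, hE, hA⟩ => ⟨hF, fun v => hE v (hlt v), fun u v => hA u v (hlt u)⟩
  · exact ⟨(Frame.refl ..).setReg le_rfl _, by simp, by simp⟩
  · intro u s' _ hI
    simp [Expr.eval, hI.1.reg 3 (by norm_num), h3]
  · rintro k s' hk hs' r4 ⟨hF, hE, hA⟩
    obtain ⟨u, rfl⟩ := exists_vertexCode hk
    have a8 : s'.arr 8 (vertexCode u) = p u := by rw [hF.arr 8 (by simp), hv8 u]
    have a9 : s'.arr 9 (vertexCode u) = h u := by rw [hF.arr 9 (by simp), hv9 u]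
    have hval : (Expr.sub (.read 8 (.reg 4)) (.const 1)).eval s' = p u - 1 := by
      simp [Expr.eval, r4, a8]
    have hpu := hp u
    refine WP.seq (WP.set (Q := fun s1 => s1 = s'.setReg 6 (p u - 1)) hs'
      (lt_wordBound (by rw [hval]; omega)) (by rw [hval])) fun s1 hs1 e1 => ?_
    have F1 : Frame 4 [2, 3] s s1 := by subst e1; exact hF.setReg (by norm_num) _
    have r31 : s1.reg 3 = n + 1 := (F1.reg 3 (by norm_num)).trans h3
    have r41 : s1.reg 4 = vertexCode u := by subst e1; simpa [Store.setReg_reg] using r4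
    have r61 : s1.reg 6 = p u - 1 := by subst e1; simp [Store.setReg_reg]
    have arr1 : s1.arr = s'.arr := by subst e1; rfl
    have hy := isYExpr_eval (s := s1) (e := entry 7 (.reg 6) (.reg 4))
      (a := (ρ (p u - 1)).letter u) (by
        simp [entry_eval s1 r31, Expr.eval, r61, r41, F1.arr, hR.letter (p u - 1) u])
    have hexp : (Expr.add (.read 1 (.reg 6)) (.mul (.const 3)
        (isYExpr (entry 7 (.reg 6) (.reg 4))))).eval s1 = rowExponent (ρ (p u - 1)) u := by
      simp only [Expr.eval, hy, r61, F1.arr 1 (by simp), hR.phase, rowExponent]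
      split_ifs <;> rfl
    -- An exponent is at most `3 + 3`, and the word bound is at least `9` for positive `n`.
    have hsmall : rowExponent (ρ (p u - 1)) u < wordBound n := by
      have := hph (p u - 1)
      unfold rowExponent wordBound
      have : 3 ^ 2 ≤ (n + 2) ^ 2 := Nat.pow_le_pow_left (by omega) 2
      split_ifs <;> omega
    refine WP.seq (WP.write (Q := fun s2 => s2 = s1.setCell 3 (4 * vertexCode u)
      (rowExponent (ρ (p u - 1)) u)) hs1 (by rw [hexp]; exact hsmall)
      (by rw [hexp]; simp only [Expr.eval, r41])) fun s2 hs2 e2 => ?_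
    have g2 : s2.reg = s1.reg := by rw [e2, Store.setCell_reg]
    have a92 : s2.arr 9 (vertexCode u) = h u := by
      rw [e2, Store.setCell_arr_of_ne _ (by norm_num), arr1, a9]
    refine WP.seq (WP.write (Q := fun s3 => s3 = s2.setCell 3 (4 * vertexCode u + 1) (h u)) hs2
      (hs2.arr 9 _) (by simp only [Expr.eval, g2, r41, a92])) fun s3 hs3 e3 => ?_
    have g3 : s3.reg = s1.reg := by rw [e3, Store.setCell_reg, g2]
    refine WP.seq (WP.write (Q := fun s4 => s4 = s3.setCell 3 (4 * vertexCode u + 2) 0) hs3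
      (lt_wordBound (Nat.zero_le _)) (by simp only [Expr.eval, g3, r41])) fun s4 hs4 e4 => ?_
    have g4 : s4.reg = s1.reg := by rw [e4, Store.setCell_reg, g3]
    refine WP.seq (WP.write (Q := fun s5 => s5 = s4.setCell 3 (4 * vertexCode u + 3) 0) hs4
      (lt_wordBound (Nat.zero_le _)) (by simp only [Expr.eval, g4, r41])) fun s5 hs5 e5 => ?_
    have g5 : s5.reg = s1.reg := by rw [e5, Store.setCell_reg, g4]
    have F5 : Frame 4 [2, 3] s s5 := by
      subst e5 e4 e3 e2
      exact (((F1.setCell (by simp) _ _).setCell (by simp) _ _).setCell (by simp) _ _).setCell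
        (by simp) _ _
    have a2 : s5.arr 2 = s'.arr 2 := by
      rw [e5, Store.setCell_arr_of_ne _ (by norm_num), e4, Store.setCell_arr_of_ne _ (by norm_num),
        e3, Store.setCell_arr_of_ne _ (by norm_num), e2, Store.setCell_arr_of_ne _ (by norm_num),
        arr1]
    have a3 : ∀ v, vertexCode v < vertexCode u + 1 →
        HasExponents (s5.arr 3) v (rowExponent (ρ (p v - 1)) v) (h v) := by
      intro v hv
      have e : s5.arr 3 = Function.update (Function.update (Function.update (Function.update
          (s'.arr 3) (4 * vertexCode u) (rowExponent (ρ (p u - 1)) u)) (4 * vertexCode u + 1) (h u))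
          (4 * vertexCode u + 2) 0) (4 * vertexCode u + 3) 0 := by
        rw [e5, Store.setCell_arr_self, e4, Store.setCell_arr_self, e3, Store.setCell_arr_self, e2,
          Store.setCell_arr_self, arr1]
      rw [e]
      by_cases hvu : v = u
      · subst hvu
        simp [HasExponents]
      · have hne : vertexCode v ≠ vertexCode u := fun h => hvu (vertexCode_injective h)
        obtain ⟨h1, h2, h3, h4⟩ := hE v (by omega)
        refine ⟨?_, ?_, ?_, ?_⟩
        · repeat rw [Function.update_of_ne (by omega)]
          exact h1
        · repeat rw [Function.update_of_ne (by omega)]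
          exact h2
        · repeat rw [Function.update_of_ne (by omega)]
          exact h3
        · repeat rw [Function.update_of_ne (by omega)]
          exact h4
    have r35 : s5.reg 3 = n + 1 := by rw [g5, r31]
    have r45 : s5.reg 4 = vertexCode u := by rw [g5, r41]
    have r65 : s5.reg 6 = p u - 1 := by rw [g5, r61]
    refine (WP.forLoop (N := n + 1) (fun l s6 => Frame 8 [2] s5 s6 ∧
      ∀ w v, vertexCode w < vertexCode u ∨ w = u ∧ vertexCode v < l →
        s6.arr 2 (vertexCode w * (n + 1) + vertexCode v) =
          if w ≠ v ∧ ((ρ (p w - 1)).letter v).zb = 1 then 1 else 0) hs5 le_rfl ?_ ?_ ?_).mono ?_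
    · refine ⟨(Frame.refl ..).setReg le_rfl _, fun w v hw => ?_⟩
      rw [Store.setReg_arr, a2]
      exact hA w v (hw.resolve_right (by simp))
    · intro l s6 _ hI
      simp [Expr.eval, hI.1.reg 3 (by norm_num), r35]
    · rintro l s6 hl hs6 r8 ⟨f6, hA6⟩
      obtain ⟨v, rfl⟩ := exists_vertexCode hl
      have r36 : s6.reg 3 = n + 1 := (f6.reg 3 (by norm_num)).trans r35
      have r46 : s6.reg 4 = vertexCode u := (f6.reg 4 (by norm_num)).trans r45
      have r66 : s6.reg 6 = p u - 1 := (f6.reg 6 (by norm_num)).trans r65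
      have hz := zbExpr_eval (s := s6) (e := entry 7 (.reg 6) (.reg 8))
        (a := (ρ (p u - 1)).letter v) (by
          simp [entry_eval s6 r36, Expr.eval, r66, r8, f6.arr, F5.arr, hR.letter (p u - 1) v])
      have hev : (Expr.mul (zbExpr (entry 7 (.reg 6) (.reg 8)))
          (.add (.lt (.reg 4) (.reg 8)) (.lt (.reg 8) (.reg 4)))).eval s6 =
          if u ≠ v ∧ ((ρ (p u - 1)).letter v).zb = 1 then 1 else 0 := by
        simp only [Expr.eval, hz, r46, r8]
        by_cases huv : u = v
        · subst huv; simp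
        · have hne : vertexCode u ≠ vertexCode v := fun h => huv (vertexCode_injective h)
          have hone : (if vertexCode u < vertexCode v then 1 else 0) +
              (if vertexCode v < vertexCode u then 1 else 0) = 1 := by
            split_ifs <;> omega
          rw [hone]
          simp [huv]
      refine WP.write hs6 ?_ ?_
      · rw [hev]
        refine lt_wordBound ?_
        split_ifs <;> omega
      · rw [hev, entryIndex_eval s6 r36]
        simp only [Expr.eval, r46, r8]
        refine ⟨r8, (f6.setCell (by simp) _ _).setReg le_rfl _, fun w v' hw => ?_⟩
        rw [Store.setReg_arr, Store.setCell_arr_self]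
        by_cases hc : w = u ∧ v' = v
        · obtain ⟨rfl, rfl⟩ := hc
          rw [Function.update_self]
        · rw [Function.update_of_ne fun h => hc ?_]
          · refine hA6 w v' (hw.imp_right fun hw => ⟨hw.1, ?_⟩)
            have : vertexCode v' ≠ vertexCode v := fun h => hc ⟨hw.1, vertexCode_injective h⟩
            omega
          · have := cell_inj h
            exact ⟨vertexCode_injective this.1, this.2⟩
    · rintro s6 - ⟨f6, hA6⟩
      refine ⟨(f6.reg 4 (by norm_num)).trans r45,
        (F5.trans (f6.mono (by norm_num) (by simp))).setReg le_rfl _, ?_, ?_⟩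
      · rw [Store.setReg_arr, f6.arr 3 (by simp)]
        exact a3
      · intro w v hw
        rw [Store.setReg_arr]
        refine hA6 w v ?_
        by_cases hwu : w = u
        · exact Or.inr ⟨hwu, hlt v⟩
        · have : vertexCode w ≠ vertexCode u := fun h => hwu (vertexCode_injective h)
          exact Or.inl (by omega)

end

section

variable {n : ℕ} {G : SimpleGraph (Option (Fin n))}

/-! ### The search for a shortest path -/

/-- The entry of the table of walks for vertex `v` and length `r + 1` is zero if no neighbour of `v`
has a walk of length `r`, and otherwise points to such a neighbour. -/
def WalkStep (G : SimpleGraph (Option (Fin n))) (A : ℕ → ℕ) (r : ℕ) (v : Option (Fin n)) : Prop :=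
  (A ((r + 1) * (n + 1) + vertexCode v) = 0 ∧
    ∀ u, G.Adj u v → A (r * (n + 1) + vertexCode u) = 0) ∨
  ∃ u, G.Adj u v ∧ A (r * (n + 1) + vertexCode u) ≠ 0 ∧
    A ((r + 1) * (n + 1) + vertexCode v) = vertexCode u + 1

/-- A table of walks to the reference system of length at most `N`. -/
structure WalkTable (G : SimpleGraph (Option (Fin n))) (A : ℕ → ℕ) (N : ℕ) : Prop where
  zero : ∀ v : Option (Fin n), A (0 * (n + 1) + vertexCode v) = if v = none then 1 else 0
  step : ∀ r < N, ∀ v, WalkStep G A r v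

/-- A nonzero entry points to a neighbour with nonzero entry one layer below, and in layer `0` only
the reference system is left. The pointers along the walk are recorded because `writePath` follows
them. -/
theorem WalkTable.exists_walk {A : ℕ → ℕ} {N : ℕ} (h : WalkTable G A N) {r : ℕ} (hr : r ≤ N)
    {v : Option (Fin n)} (hv : A (r * (n + 1) + vertexCode v) ≠ 0) :
    ∃ p : G.Walk v none, p.length = r ∧ ∀ i < r,
      A ((r - i) * (n + 1) + vertexCode (p.getVert i)) = vertexCode (p.getVert (i + 1)) + 1 := by
  induction r generalizing v with
  | zero =>
    rw [h.zero] at hv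
    have : v = none := by
      by_contra hne
      exact hv (if_neg hne)
    subst this
    exact ⟨.nil, rfl, by simp⟩
  | succ r ih =>
    rcases h.step r hr v with h0 | ⟨u, hu, hu0, hvu⟩
    · exact absurd h0.1 hv
    · obtain ⟨p, hp, hpi⟩ := ih (by omega) hu0
      refine ⟨.cons hu.symm p, by simp [hp], fun i hi => ?_⟩
      cases i with
      | zero => simpa using hvu
      | succ i =>
        rw [SimpleGraph.Walk.getVert_cons_succ, SimpleGraph.Walk.getVert_cons_succ,
          Nat.succ_sub_succ]
        exact hpi i (by omega)

/-- A zero entry denies all neighbours in the layer below, so the nonzero entries propagate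
backwards along a walk. Layers refer to exact lengths, which makes a list of visited vertices
unnecessary. -/
theorem WalkTable.ne_zero {A : ℕ → ℕ} {N : ℕ} (h : WalkTable G A N) {r : ℕ} (hr : r ≤ N)
    {v : Option (Fin n)} (p : G.Walk v none) (hp : p.length = r) :
    A (r * (n + 1) + vertexCode v) ≠ 0 := by
  induction r generalizing v with
  | zero =>
    have := SimpleGraph.Walk.eq_of_length_eq_zero hp
    rw [h.zero, if_pos this]
    exact one_ne_zero
  | succ r ih =>
    cases p with
    | nil => simp at hp
    | @cons _ u _ hvu p =>
      rw [SimpleGraph.Walk.length_cons] at hp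
      have h0 := ih (by omega) p (by omega)
      rcases h.step r hr v with h1 | ⟨u', -, -, h1⟩
      · exact absurd (h1.2 u hvu.symm) h0
      · rw [h1]
        exact Nat.succ_ne_zero _

/-- Enter the walk of length zero. -/
def initWalks : Program :=
  forLoop 8 (.reg 3) (.write 10 (.reg 8) (.sub (.const 1) (.lt (.reg 8) (.reg 0))))

theorem initWalks_spec {s : Store} (hs : Bounded n s) (h0 : s.reg 0 = n) (h3 : s.reg 3 = n + 1) :
    WP n initWalks s fun s' => Frame 4 [10] s s' ∧
      ∀ v : Option (Fin n), s'.arr 10 (vertexCode v) = if v = none then 1 else 0 := by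
  refine (WP.forLoop (N := n + 1) (fun k s' => Frame 4 [10] s s' ∧
    ∀ v : Option (Fin n), vertexCode v < k → s'.arr 10 (vertexCode v) = if v = none then 1 else 0)
    hs le_rfl ?_ ?_ ?_).mono
    fun s' _ ⟨hF, h⟩ => ⟨hF, fun v => h v (Nat.lt_succ_of_le (vertexCode_le v))⟩
  · exact ⟨(Frame.refl ..).setReg (by norm_num) _, by simp⟩
  · intro k s' _ hI
    simp [Expr.eval, hI.1.reg 3 (by norm_num), h3]
  · rintro k s' hk hs' r8 ⟨hF, h⟩
    obtain ⟨v, rfl⟩ := exists_vertexCode hk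
    have r0 : s'.reg 0 = n := (hF.reg 0 (by norm_num)).trans h0
    have hev : (Expr.sub (.const 1) (.lt (.reg 8) (.reg 0))).eval s' =
        if v = none then 1 else 0 := by
      simp only [Expr.eval, r8, r0]
      cases v with
      | none => simp [vertexCode]
      | some v => simp [vertexCode]
    refine WP.write hs' ?_ ⟨r8, (hF.setCell (by simp) _ _).setReg (by norm_num) _, ?_⟩
    · rw [hev]
      refine lt_wordBound ?_
      split_ifs <;> omega
    · rw [hev, Store.setReg_arr, Store.setCell_arr_self]
      simp only [Expr.eval, r8]
      exact IsVector.partial_update (f := fun v => if v = none then 1 else 0) h rfl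

/-- Enter the walks of lengths `1, …, n`. -/
def fillWalks : Program :=
  forLoop 4 (.reg 0) <| forLoop 8 (.reg 3) <|
    .seq (.set 9 (.const 0)) <|
    .seq (forLoop 11 (.reg 3) <|
      .ite (.mul (entry 2 (.reg 11) (.reg 8)) (entry 10 (.reg 4) (.reg 11)))
        (.set 9 (.add (.reg 11) (.const 1))) .skip)
    (.write 10 (entryIndex (.add (.reg 4) (.const 1)) (.reg 8)) (.reg 9))

/-- Writing an entry of layer `r + 1` affects neither lower layers nor the other entries of its own
layer. -/
theorem WalkStep.update {A : ℕ → ℕ} {r r' : ℕ} {v v' : Option (Fin n)} {x : ℕ}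
    (h : WalkStep G A r' v') (hr : r' ≤ r) (hv : ¬ (r' = r ∧ v' = v)) :
    WalkStep G (Function.update A ((r + 1) * (n + 1) + vertexCode v) x) r' v' := by
  have h1 : ∀ u, Function.update A ((r + 1) * (n + 1) + vertexCode v) x
      (r' * (n + 1) + vertexCode u) = A (r' * (n + 1) + vertexCode u) := fun u =>
    Function.update_of_ne (fun h => by have := (cell_inj h).1; omega) _ _
  have h2 : Function.update A ((r + 1) * (n + 1) + vertexCode v) x
      ((r' + 1) * (n + 1) + vertexCode v') = A ((r' + 1) * (n + 1) + vertexCode v') :=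
    Function.update_of_ne (fun h => hv ⟨by have := (cell_inj h).1; omega, (cell_inj h).2⟩) _ _
  simp only [WalkStep, h1, h2]
  exact h

theorem fillWalks_spec {s : Store} (hs : Bounded n s) (h0 : s.reg 0 = n) (h3 : s.reg 3 = n + 1)
    (hG : ∀ u v, s.arr 2 (vertexCode u * (n + 1) + vertexCode v) ≠ 0 ↔ G.Adj u v)
    (hW : ∀ v : Option (Fin n), s.arr 10 (vertexCode v) = if v = none then 1 else 0) :
    WP n fillWalks s fun s' => Frame 4 [10] s s' ∧ WalkTable G (s'.arr 10) n := by
  refine WP.forLoop (N := n) (fun k s' => Frame 4 [10] s s' ∧ WalkTable G (s'.arr 10) k)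
    hs (by omega) ?_ ?_ ?_
  · refine ⟨(Frame.refl ..).setReg le_rfl _, fun v => ?_, by simp⟩
    rw [zero_mul, zero_add]
    exact hW v
  · intro k s' _ hI
    simp [Expr.eval, hI.1.reg 0 (by norm_num), h0]
  · rintro r s' hr hs' r4 ⟨hF, hT⟩
    refine (WP.forLoop (N := n + 1) (fun l s1 => Frame 4 [10] s s1 ∧ s1.reg 4 = r ∧
      WalkTable G (s1.arr 10) r ∧ ∀ v, vertexCode v < l → WalkStep G (s1.arr 10) r v)
      hs' le_rfl ?_ ?_ ?_).mono ?_
    · exact ⟨hF.setReg (by norm_num) _, by simpa [Store.setReg_reg] using r4, hT, by simp⟩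
    · intro k s1 _ hI
      simp [Expr.eval, hI.1.reg 3 (by norm_num), h3]
    · rintro l s1 hl hs1 r8 ⟨hF1, r41, hT1, hS⟩
      obtain ⟨v, rfl⟩ := exists_vertexCode hl
      refine WP.seq (WP.set (Q := fun s2 => s2 = s1.setReg 9 0) hs1 (lt_wordBound (Nat.zero_le _))
        rfl) fun s2 hs2 e2 => ?_
      -- Register 9 is zero until a suitable neighbour is met, and then holds the number of the
      -- latest one plus one.
      refine WP.seq (WP.forLoop (N := n + 1) (fun m s3 => Frame 9 [] s1 s3 ∧
        ((s3.reg 9 = 0 ∧ ∀ u, vertexCode u < m → G.Adj u v →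
          s1.arr 10 (r * (n + 1) + vertexCode u) = 0) ∨
        ∃ u, G.Adj u v ∧ s1.arr 10 (r * (n + 1) + vertexCode u) ≠ 0 ∧
          s3.reg 9 = vertexCode u + 1)) hs2 le_rfl ?_ ?_ ?_) ?_
      · refine ⟨?_, Or.inl ⟨by rw [e2]; simp [Store.setReg_reg], by simp⟩⟩
        rw [e2]
        exact ((Frame.refl ..).setReg le_rfl _).setReg (by norm_num) _
      · intro k s3 _ hI
        simp [Expr.eval, hI.1.reg 3 (by norm_num), hF1.reg 3 (by norm_num), h3]
      · rintro m s3 hm hs3 r11 ⟨f3, h9⟩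
        obtain ⟨u, rfl⟩ := exists_vertexCode hm
        have r33 : s3.reg 3 = n + 1 := by
          rw [f3.reg 3 (by norm_num), hF1.reg 3 (by norm_num), h3]
        have r43 : s3.reg 4 = r := (f3.reg 4 (by norm_num)).trans r41
        have r83 : s3.reg 8 = vertexCode v := (f3.reg 8 (by norm_num)).trans r8
        have hcond : (Expr.mul (entry 2 (.reg 11) (.reg 8)) (entry 10 (.reg 4) (.reg 11))).eval
            s3 ≠ 0 ↔ G.Adj u v ∧ s1.arr 10 (r * (n + 1) + vertexCode u) ≠ 0 := by
          rw [← hG, ← hF1.arr 2 (by simp)]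
          simp [Expr.eval, entry_eval s3 r33, r11, r83, r43, f3.arr]
        refine WP.ite hs3 (fun he => ?_) fun he => ?_
        · rw [hcond] at he
          have hval : (Expr.add (.reg 11) (.const 1)).eval s3 = vertexCode u + 1 := by
            simp [Expr.eval, r11]
          have := vertexCode_le u
          refine WP.set hs3 (lt_wordBound (by rw [hval]; omega)) ⟨by simp [Store.setReg_reg, r11],
            (f3.setReg le_rfl _).setReg (by norm_num) _, Or.inr ⟨u, he.1, he.2, ?_⟩⟩
          rw [hval]
          simp [Store.setReg_reg]
        · have he' : ¬ (G.Adj u v ∧ s1.arr 10 (r * (n + 1) + vertexCode u) ≠ 0) := by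
            rw [← hcond]; simpa using he
          refine WP.skip hs3 ⟨r11, f3.setReg (by norm_num) _, ?_⟩
          rw [Store.setReg_reg, if_neg (by norm_num)]
          refine h9.imp_left fun h => ⟨h.1, fun w hw hwv => ?_⟩
          by_cases hwu : w = u
          · subst hwu
            by_contra hne
            exact he' ⟨hwv, hne⟩
          · have : vertexCode w ≠ vertexCode u := fun h => hwu (vertexCode_injective h)
            exact h.2 w (by omega) hwv
      · rintro s3 hs3 ⟨f3, h9⟩
        have r33 : s3.reg 3 = n + 1 := by
          rw [f3.reg 3 (by norm_num), hF1.reg 3 (by norm_num), h3]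
        have r43 : s3.reg 4 = r := (f3.reg 4 (by norm_num)).trans r41
        have r83 : s3.reg 8 = vertexCode v := (f3.reg 8 (by norm_num)).trans r8
        have a3 : s3.arr 10 = s1.arr 10 := f3.arr 10 (by simp)
        refine WP.write hs3 (hs3.reg 9) ?_
        rw [entryIndex_eval s3 r33]
        simp only [Expr.eval, r43, r83]
        refine ⟨r83, (Frame.setCell (hF1.trans (f3.mono (by norm_num) (by simp))) (by simp) _
          _).setReg (by norm_num) _, by simpa [Store.setReg_reg] using r43, ?_, ?_⟩
        · rw [Store.setReg_arr, Store.setCell_arr_self, a3]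
          refine ⟨fun w => ?_, fun r' hr' w => (hT1.step r' hr' w).update (by omega) (by omega)⟩
          rw [Function.update_of_ne fun h => by have := (cell_inj h).1; omega, hT1.zero]
        · rw [Store.setReg_arr, Store.setCell_arr_self, a3]
          intro w hw
          by_cases hwv : w = v
          · subst hwv
            have hlow : ∀ u, Function.update (s1.arr 10) ((r + 1) * (n + 1) + vertexCode w)
                (s3.reg 9) (r * (n + 1) + vertexCode u) = s1.arr 10 (r * (n + 1) + vertexCode u) :=
              fun u => Function.update_of_ne (fun h => by have := (cell_inj h).1; omega) _ _
            simp only [WalkStep, hlow, Function.update_self]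
            exact h9.imp_left fun h => ⟨h.1, fun u =>
              h.2 u (Nat.lt_succ_of_le (vertexCode_le u))⟩
          · have : vertexCode w ≠ vertexCode v := fun h => hwv (vertexCode_injective h)
            exact (hS w (by omega)).update le_rfl fun h => hwv h.2
    · rintro s1 - ⟨hF1, r41, hT1, hS⟩
      refine ⟨r41, hF1.setReg le_rfl _, hT1.zero, fun r' hr' v => ?_⟩
      rw [Store.setReg_arr]
      rcases Nat.lt_succ_iff_lt_or_eq.1 hr' with h | rfl
      · exact hT1.step r' h v
      · exact hS v (Nat.lt_succ_of_le (vertexCode_le v))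

/-- Find the number of vertices of a shortest path (register 5), or zero. -/
def findLength : Program :=
  .seq (.set 5 (.const 0)) <|
  forLoop 4 (.reg 3) <|
    .ite (.mul (.lt (.reg 5) (.const 1)) (entry 10 (.reg 4) (.reg 1)))
      (.set 5 (.add (.reg 4) (.const 1))) .skip

/-- Lengths are tried in increasing order, and register 5 is set only while it is zero, so the first
success stays. It holds the length plus one, the number of vertices. -/
theorem findLength_spec {s : Store} {j : Fin n} (hs : Bounded n s) (h1 : s.reg 1 = j)
    (h3 : s.reg 3 = n + 1) :
    WP n findLength s fun s' => Frame 4 [] s s' ∧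
      ((s'.reg 5 = 0 ∧ ∀ r < n + 1, s.arr 10 (r * (n + 1) + vertexCode (some j)) = 0) ∨
      ∃ r < n + 1, s'.reg 5 = r + 1 ∧ s.arr 10 (r * (n + 1) + vertexCode (some j)) ≠ 0 ∧
        ∀ r' < r, s.arr 10 (r' * (n + 1) + vertexCode (some j)) = 0) := by
  refine WP.seq (WP.set (Q := fun s1 => s1 = s.setReg 5 0) hs (lt_wordBound (Nat.zero_le _)) rfl)
    fun s1 hs1 e1 => ?_
  refine WP.forLoop (N := n + 1) (fun k s' => Frame 4 [] s s' ∧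
      ((s'.reg 5 = 0 ∧ ∀ r < k, s.arr 10 (r * (n + 1) + vertexCode (some j)) = 0) ∨
      ∃ r < k, s'.reg 5 = r + 1 ∧ s.arr 10 (r * (n + 1) + vertexCode (some j)) ≠ 0 ∧
        ∀ r' < r, s.arr 10 (r' * (n + 1) + vertexCode (some j)) = 0)) hs1 le_rfl ?_ ?_ ?_
  · rw [e1]
    exact ⟨((Frame.refl ..).setReg (by norm_num) _).setReg (by norm_num) _,
      Or.inl ⟨by simp [Store.setReg_reg], by simp⟩⟩
  · intro k s' _ hI
    simp [Expr.eval, hI.1.reg 3 (by norm_num), h3]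
  · rintro k s' hk hs' r4 ⟨hF, h5⟩
    have r3 : s'.reg 3 = n + 1 := (hF.reg 3 (by norm_num)).trans h3
    have r1 : s'.reg 1 = vertexCode (some j) := (hF.reg 1 (by norm_num)).trans h1
    have hcond : (Expr.mul (.lt (.reg 5) (.const 1)) (entry 10 (.reg 4) (.reg 1))).eval s' ≠ 0 ↔
        s'.reg 5 = 0 ∧ s.arr 10 (k * (n + 1) + vertexCode (some j)) ≠ 0 := by
      simp [Expr.eval, entry_eval s' r3, r4, r1, hF.arr]
    refine WP.ite hs' (fun he => ?_) fun he => ?_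
    · rw [hcond] at he
      have hval : (Expr.add (.reg 4) (.const 1)).eval s' = k + 1 := by simp [Expr.eval, r4]
      refine WP.set hs' (lt_wordBound (by rw [hval]; omega)) ⟨by simp [Store.setReg_reg, r4],
        (hF.setReg (by norm_num) _).setReg le_rfl _, Or.inr ⟨k, by omega, ?_, he.2, ?_⟩⟩
      · rw [hval]
        simp [Store.setReg_reg]
      · rcases h5 with h5 | ⟨r, -, h5, -⟩
        · exact h5.2
        · omega
    · have he' : ¬ (s'.reg 5 = 0 ∧ s.arr 10 (k * (n + 1) + vertexCode (some j)) ≠ 0) := by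
        rw [← hcond]; simpa using he
      refine WP.skip hs' ⟨r4, hF.setReg le_rfl _, ?_⟩
      rw [Store.setReg_reg, if_neg (by norm_num)]
      rcases h5 with h5 | ⟨r, hr, h5⟩
      · refine Or.inl ⟨h5.1, fun r hr => ?_⟩
        rcases Nat.lt_succ_iff_lt_or_eq.1 hr with h | rfl
        · exact h5.2 r h
        · by_contra hne
          exact he' ⟨h5.1, hne⟩
      · exact Or.inr ⟨r, by omega, h5⟩

/-- Follow the pointers of the table of walks. -/
def writePath : Program :=
  .seq (.set 6 (.reg 1)) <|
  forLoop 4 (.reg 5) <|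
    .seq (.write 4 (.reg 4) (.reg 6))
    (.set 6 (.sub (entry 10 (.sub (.sub (.reg 5) (.const 1)) (.reg 4)) (.reg 6)) (.const 1)))

/-- Vertex `k` of a path with `L` vertices lies in layer `L - 1 - k`. After the last vertex register
6 has no meaning, hence the condition `k < L` in the invariant. Failure is the case `L = 0`. -/
theorem writePath_spec {s : Store} {L : ℕ} {p : ℕ → Option (Fin n)} (hs : Bounded n s)
    (h3 : s.reg 3 = n + 1) (h5 : s.reg 5 = L) (hL : L ≤ n + 1)
    (hp0 : 0 < L → s.reg 1 = vertexCode (p 0))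
    (hp : ∀ i, i + 1 < L → s.arr 10 ((L - 1 - i) * (n + 1) + vertexCode (p i)) =
      vertexCode (p (i + 1)) + 1) :
    WP n writePath s fun s' => Frame 4 [4] s s' ∧ s'.reg 5 = L ∧
      ∀ i < L, s'.arr 4 i = vertexCode (p i) := by
  refine WP.seq (WP.set (Q := fun s1 => s1 = s.setReg 6 (s.reg 1)) hs (hs.reg 1) rfl)
    fun s1 hs1 e1 => ?_
  refine (WP.forLoop (N := L) (fun k s' => Frame 4 [4] s s' ∧ s'.reg 5 = L ∧
    (k < L → s'.reg 6 = vertexCode (p k)) ∧ ∀ i < k, s'.arr 4 i = vertexCode (p i))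
    hs1 hL ?_ ?_ ?_).mono fun s' _ ⟨hF, h5, _, h⟩ => ⟨hF, h5, h⟩
  · rw [e1]
    refine ⟨((Frame.refl ..).setReg (by norm_num) _).setReg le_rfl _, ?_, fun h => ?_, by simp⟩
    · simpa [Store.setReg_reg] using h5
    · simpa [Store.setReg_reg] using hp0 h
  · intro k s' _ hI
    simp [Expr.eval, hI.2.1]
  · rintro k s' hk hs' r4 ⟨hF, r5, h6, h4⟩
    have r3 : s'.reg 3 = n + 1 := (hF.reg 3 (by norm_num)).trans h3
    have r6 := h6 hk
    refine WP.seq (WP.write (Q := fun s2 => s2 = s'.setCell 4 k (vertexCode (p k))) hs' (hs'.reg 6)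
      (by simp only [Expr.eval, r4, r6])) fun s2 hs2 e2 => ?_
    have g2 : s2.reg = s'.reg := by rw [e2, Store.setCell_reg]
    have F2 : Frame 4 [4] s s2 := by rw [e2]; exact hF.setCell (by simp) _ _
    have hval : (Expr.sub (entry 10 (.sub (.sub (.reg 5) (.const 1)) (.reg 4)) (.reg 6))
        (.const 1)).eval s2 = s.arr 10 ((L - 1 - k) * (n + 1) + vertexCode (p k)) - 1 := by
      simp [Expr.eval, entry_eval s2 (by rw [g2, r3]), g2, r5, r4, r6, F2.arr]
    refine WP.set hs2 ?_ ⟨?_, (F2.setReg (by norm_num) _).setReg le_rfl _, ?_, fun hk' => ?_, ?_⟩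
    · rw [hval]
      exact (Nat.sub_le _ _).trans_lt (hs.arr 10 _)
    · simp [Store.setReg_reg, g2, r4]
    · simp [Store.setReg_reg, g2, r5]
    · rw [hval, hp k hk']
      simp [Store.setReg_reg]
    · intro i hi
      simp only [Store.setReg_arr, e2, Store.setCell_arr_self]
      by_cases hik : i = k
      · subst hik; simp
      · rw [Function.update_of_ne hik]
        exact h4 i (by omega)

end

section

variable {n : ℕ} {g : Fin (n - 1) → PauliOp n} {τ : ℕ → Pauli (Option (Fin n))}
  {pr h : Option (Fin n) → ℕ} {q : Fin n}

/-! ### The whole algorithm -/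

/-- The part of the algorithm that computes the graph and the logical operators. -/
def graphProgram : Program :=
  .seq copyInput <| .seq reduceRows <| .seq findFree <| .seq writeLogical <|
    .seq finishElimination writeGraph

/-- The part of the algorithm that computes a shortest path. -/
def pathProgram : Program :=
  .seq initWalks <| .seq fillWalks <| .seq findLength writePath

/-- The algorithm. -/
def mainProgram : Program :=
  .seq graphProgram <| .seq pathProgram <| .seq (.set 0 (.reg 5)) (.set 1 (.const 0))

theorem graphProgram_spec (hg : IsStabilizer g) (j : Fin n) :
    WP n graphProgram (inputStore g j) fun s' => s'.reg 0 = n ∧ s'.reg 1 = j ∧ s'.reg 2 = 0 ∧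
      s'.reg 3 = n + 1 ∧ ∃ (τ : ℕ → Pauli (Option (Fin n))) (pr h : Option (Fin n) → ℕ) (q : Fin n)
        (_ : Eliminated g τ pr h q),
        (∀ v, HasExponents (s'.arr 3) v (rowExponent (finalRow τ pr q v) v) (h v)) ∧
        (∀ u v, s'.arr 2 (vertexCode u * (n + 1) + vertexCode v) =
          if u ≠ v ∧ ((finalRow τ pr q u).letter v).zb = 1 then 1 else 0) ∧
        (∀ k : Fin n, s'.arr 5 k = ((logZ τ pr h q).letter k).code) ∧
        ∀ k : Fin n, s'.arr 6 k = ((logX τ pr h q).letter k).code := by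
  have hn : 0 < n := j.pos
  refine WP.seq (copyInput_spec j) fun s1 hs1 ⟨f1, r31, hR1⟩ => ?_
  have r01 : s1.reg 0 = n := (f1.reg 0 (by norm_num)).trans rfl
  have r11 : s1.reg 1 = j := (f1.reg 1 (by norm_num)).trans rfl
  have r21 : s1.reg 2 = 0 := (f1.reg 2 (by norm_num)).trans rfl
  refine WP.seq (reduceRows_spec hs1 r01 r31 hg hR1 (fun i => ?_) fun i => ?_)
    fun s2 hs2 ⟨f2, τ, pr, h, H, hph, hR2, hv8, hv9⟩ => ?_
  · rw [f1.arr 8 (by simp)]; rfl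
  · rw [f1.arr 9 (by simp)]; rfl
  have r02 : s2.reg 0 = n := (f2.reg 0 (by norm_num)).trans r01
  have r32 : s2.reg 3 = n + 1 := (f2.reg 3 (by norm_num)).trans r31
  obtain ⟨q', hq', huniq'⟩ := H.pivots.exists_free hn (H.pivots.none_eq_zero le_rfl H.untouched)
  refine WP.seq (findFree_spec hs2 r02 hv8 ⟨q', hq'⟩) fun s3 hs3 ⟨f3, q, r53, hq⟩ => ?_
  have huniq : ∀ v, pr (some v) = 0 → v = q := fun v hv => (huniq' v hv).trans (huniq' q hq).symm
  have r03 : s3.reg 0 = n := (f3.reg 0 (by norm_num)).trans r02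
  have r33 : s3.reg 3 = n + 1 := (f3.reg 3 (by norm_num)).trans r32
  have HE : Eliminated g τ pr h q := ⟨hn, H, hq, huniq⟩
  refine WP.seq (writeLogical_spec (h := h) (pr := pr) hs3 r03 r33 r53 hn
    (hR2.of_arr (f3.arr 7 (by simp)) (f3.arr 1 (by simp))) (by rw [f3.arr 8 (by simp)]; exact hv8)
    (by rw [f3.arr 9 (by simp)]; exact hv9) H.pivots.le H.had_le H.trivial)
    fun s4 hs4 ⟨f4, hR4, hz, hx⟩ => ?_
  have r54 : s4.reg 5 = q := (f4.reg 5 (by norm_num)).trans r53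
  have r04 : s4.reg 0 = n := (f4.reg 0 (by norm_num)).trans r03
  have r34 : s4.reg 3 = n + 1 := (f4.reg 3 (by norm_num)).trans r33
  refine WP.seq (finishElimination_spec hs4 r04 r34 r54 hR4
    (by rw [f4.arr 8 (by simp), f3.arr 8 (by simp)]; exact hv8) H.trivial)
    fun s5 hs5 ⟨f5, hR5, hv85⟩ => ?_
  have r35 : s5.reg 3 = n + 1 := (f5.reg 3 (by norm_num)).trans r34
  have hph' : ∀ k, (logicalRows τ pr q k).phase < 4 := by
    intro k
    unfold logicalRows
    split_ifs
    · exact Nat.zero_lt_succ _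
    · exact Nat.zero_lt_succ _
    · exact hph k
  refine (writeGraph_spec (h := h) hn hs5 r35 hR5 (elim_phase_lt hph' _ _) hv85 HE.pivots.le
    (by rw [f5.arr 9 (by simp), f4.arr 9 (by simp), f3.arr 9 (by simp)]; exact hv9)).mono
    fun s6 hs6 ⟨f6, hE, hA⟩ => ?_
  have hreg : ∀ r < 4, s6.reg r = s1.reg r := fun r hr => by
    rw [f6.reg r hr, f5.reg r hr, f4.reg r (by omega), f3.reg r (by omega), f2.reg r hr]
  refine ⟨(hreg 0 (by norm_num)).trans r01, (hreg 1 (by norm_num)).trans r11,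
    (hreg 2 (by norm_num)).trans r21, (hreg 3 (by norm_num)).trans r31, τ, pr, h, q, HE, hE, hA,
    fun k => ?_, fun k => ?_⟩
  · rw [f6.arr 5 (by simp), f5.arr 5 (by simp)]
    exact hz (some k)
  · rw [f6.arr 6 (by simp), f5.arr 6 (by simp)]
    exact hx (some k)

theorem pathProgram_spec {G : SimpleGraph (Option (Fin n))} {s : Store} {j : Fin n}
    (hs : Bounded n s) (h0 : s.reg 0 = n) (h1 : s.reg 1 = j) (h3 : s.reg 3 = n + 1)
    (hG : ∀ u v, s.arr 2 (vertexCode u * (n + 1) + vertexCode v) ≠ 0 ↔ G.Adj u v) :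
    WP n pathProgram s fun s' => Frame 4 [4, 10] s s' ∧ ∃ path : List (Option (Fin n)),
      s'.reg 5 = path.length ∧
      (∀ (i : ℕ) (hi : i < path.length), s'.arr 4 i = vertexCode path[i]) ∧
      ((path = [] ∧ ¬ G.Reachable (some j) none) ∨
        ∃ w : G.Walk (some j) none, w.support = path ∧ w.length = G.dist (some j) none) := by
  refine WP.seq (initWalks_spec hs h0 h3) fun s1 hs1 ⟨f1, hW⟩ => ?_
  have r01 : s1.reg 0 = n := (f1.reg 0 (by norm_num)).trans h0
  have r31 : s1.reg 3 = n + 1 := (f1.reg 3 (by norm_num)).trans h3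
  refine WP.seq (fillWalks_spec (G := G) hs1 r01 r31 (by rw [f1.arr 2 (by simp)]; exact hG) hW)
    fun s2 hs2 ⟨f2, hT⟩ => ?_
  have r12 : s2.reg 1 = j := ((f2.reg 1 (by norm_num)).trans (f1.reg 1 (by norm_num))).trans h1
  have r32 : s2.reg 3 = n + 1 := (f2.reg 3 (by norm_num)).trans r31
  have F2 : Frame 4 [4, 10] s s2 := (f1.trans f2).mono le_rfl (by simp)
  refine WP.seq (findLength_spec hs2 r12 r32) fun s3 hs3 ⟨f3, h5⟩ => ?_
  have r33 : s3.reg 3 = n + 1 := (f3.reg 3 (by norm_num)).trans r32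
  have F3 : Frame 4 [4, 10] s s3 := F2.trans (f3.mono le_rfl (by simp))
  rcases h5 with ⟨h5, hnone⟩ | ⟨r, hr, h5, hne, hmin⟩
  · refine (writePath_spec (L := 0) (p := fun _ => none) hs3 r33 h5 (Nat.zero_le _) (by simp)
      (by simp)).mono fun s4 _ ⟨f4, r54, _⟩ => ?_
    refine ⟨F3.trans (f4.mono le_rfl (by simp)), [], r54, by simp, Or.inl ⟨rfl, fun hreach => ?_⟩⟩
    -- A path repeats no vertex, so it has at most `n` edges and would show up in the table.
    obtain ⟨p, hp, hpd⟩ := hreach.exists_path_of_dist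
    have hlt := hp.length_lt
    rw [Fintype.card_option, Fintype.card_fin] at hlt
    exact hT.ne_zero (Nat.lt_succ_iff.1 hlt) p rfl (hnone _ hlt)
  · obtain ⟨p, hp, hpi⟩ := hT.exists_walk (Nat.lt_succ_iff.1 hr) hne
    refine (writePath_spec (L := r + 1) (p := p.getVert) hs3 r33 h5 hr (fun _ => ?_)
      fun i hi => ?_).mono fun s4 _ ⟨f4, r54, h4⟩ => ?_
    · rw [f3.reg 1 (by norm_num), r12, SimpleGraph.Walk.getVert_zero]
      rfl
    · rw [f3.arr 10 (by simp), Nat.add_sub_cancel]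
      exact hpi i (by omega)
    refine ⟨F3.trans (f4.mono le_rfl (by simp)), p.support, ?_, fun i hi => ?_, Or.inr ⟨p, rfl, ?_⟩⟩
    · rw [r54, SimpleGraph.Walk.length_support, hp]
    · rw [SimpleGraph.Walk.length_support, hp] at hi
      rw [h4 i hi, SimpleGraph.Walk.support_getElem_eq_getVert]
    -- A shorter walk would have made the entry of `j` nonzero in an earlier layer.
    · refine le_antisymm ?_ (SimpleGraph.dist_le p)
      by_contra hlt
      obtain ⟨p', hp'⟩ := p.reachable.exists_walk_length_eq_dist
      rw [hp, not_le] at hlt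
      exact hT.ne_zero (by omega) p' hp' (hmin _ hlt)

theorem mainProgram_spec (hg : IsStabilizer g) (j : Fin n) :
    WP n mainProgram (inputStore g j) fun s' => ∃ d : PathData n, Outputs s' d ∧
      (∃ b : LogicalBasis g, Describes d b) ∧
      ((d.path = [] ∧ ¬ d.graph.Reachable (some j) none) ∨ d.HasShortestPath j) := by
  refine WP.seq (graphProgram_spec hg j) fun s1 hs1 ⟨r0, r1, r2, r3, τ, pr, h, q, H, hE, hA, hZ, hX⟩ => ?_
  have hadj : ∀ u v, H.graph.Adj u v ↔ u ≠ v ∧ ((finalRow τ pr q u).letter v).zb = 1 :=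
    fun _ _ => Iff.rfl
  refine WP.seq (pathProgram_spec (G := H.graph) hs1 r0 r1 r3 fun u v => ?_)
    fun s2 hs2 ⟨f2, path, r5, h4, hpath⟩ => ?_
  · rw [hA, hadj]
    split_ifs with hc <;> simp [hc]
  refine WP.seq (WP.set (Q := fun s3 => s3 = s2.setReg 0 (s2.reg 5)) hs2 (hs2.reg 5) rfl)
    fun s3 hs3 e3 => WP.set hs3 (lt_wordBound (Nat.zero_le _)) ?_
  refine ⟨H.data path, ⟨?_, ?_, ?_, fun u v => ?_, fun v => ?_, fun i hi => ?_, fun k => ?_,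
    fun k => ?_⟩, H.exists_describes path, hpath⟩
  · rw [e3]
    simp [Store.setReg_reg, r5, Eliminated.data]
  · simp [Store.setReg_reg, Expr.eval, Eliminated.data, logZ]
  · rw [e3]
    simp [Store.setReg_reg, f2.reg 2, r2, Eliminated.data, logX]
  · rw [e3]
    simp only [Store.setReg_arr, f2.arr 2 (by simp), hA]
    change (H.graph.Adj u v → _) ∧ (¬ H.graph.Adj u v → _)
    rw [hadj]
    exact ⟨fun h => if_pos h, fun h => if_neg h⟩
  · rw [e3]
    simp only [Store.setReg_arr, f2.arr 3 (by simp)]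
    obtain ⟨e1, e2, e3, e4⟩ := hE v
    rw [e1, e2, e3, e4]
    rfl
  · rw [e3]
    exact h4 i hi
  · rw [e3, Store.setReg_arr, Store.setReg_arr, f2.arr 5 (by simp)]
    exact hZ k
  · rw [e3, Store.setReg_arr, Store.setReg_arr, f2.arr 6 (by simp)]
    exact hX k

/-- The deepest nests are the multiplication of rows inside the clearing of a column inside the loop
over rows, and the scan of neighbours inside the loops over vertices and lengths. -/
theorem mainProgram_depth : mainProgram.depth = 3 := by decide

theorem mainProgram_time (hn : 0 < n) : mainProgram.time (n + 1) ≤ mainProgram.time 0 * 27 * n ^ 3 := by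
  have h := mainProgram.time_le (n + 1)
  rw [mainProgram_depth] at h
  -- For positive `n` one has `n + 2 ≤ 3 * n`, whence the constant `27`.
  have h3 : (n + 1 + 1) ^ 3 ≤ (3 * n) ^ 3 := Nat.pow_le_pow_left (by omega) 3
  calc mainProgram.time (n + 1) ≤ mainProgram.time 0 * (n + 1 + 1) ^ 3 := h
    _ ≤ mainProgram.time 0 * (3 * n) ^ 3 := Nat.mul_le_mul_left _ h3
    _ = _ := by ring

/-- The dichotomy for the data that the algorithm computes. -/
theorem PathData.extracts_iff {d : PathData n} {b : LogicalBasis g} {j : Fin n}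
    (hd : Describes d b)
    (hp : (d.path = [] ∧ ¬ d.graph.Reachable (some j) none) ∨ d.HasShortestPath j) :
    d.path ≠ [] ↔ ∃ C, IsLOCCMap j C ∧ Extracts b C := by
  constructor
  · intro hne
    rcases hp with hp | hp
    · exact absurd hp.1 hne
    · exact ⟨_, ⟨0, (d.protocol j).toLOCC j, rfl⟩, hd.protocol_extracts hp⟩
  · rintro ⟨C, hC, hE⟩ hnil
    rcases hp with hp | hp
    · obtain ⟨A, hj, hA⟩ := hd.exists_factorsOn hp.2
      exact not_extracts_of_factorsOn hj hA hC hE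
    · rw [hp.path_eq] at hnil
      exact absurd hnil (by simp)

end

end StabLOCC

end

/-! ### The main theorem -/

open StabLOCC in
theorem theorem1 :
    (∀ (n : ℕ) (g : Fin (n - 1) → PauliOp n), IsStabilizer g →
      ∀ (b : LogicalBasis g) (j : Fin n),
        (∃ C, IsLOCCMap j C ∧ Extracts b C) ↔ ¬ ∃ A : Finset (Fin n), j ∈ A ∧ FactorsOn b A) ∧
    (∃ (P : Program) (c K : ℕ), ∀ (n : ℕ) (g : Fin (n - 1) → PauliOp n), IsStabilizer g →
      ∀ j : Fin n, ∃ (t : ℕ) (s : Store) (d : PathData n) (b : LogicalBasis g),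
        Exec ((n + 2) ^ c) P (inputStore g j) t s ∧ t ≤ K * n ^ 3 ∧ Outputs s d ∧
        Describes d b ∧
        (d.path ≠ [] ↔ ∃ C, IsLOCCMap j C ∧ Extracts b C) ∧
        (d.path = [] → ¬ d.graph.Reachable (some j) none) ∧
        (d.path ≠ [] →
          (∃ w : d.graph.Walk (some j) none,
            w.support = d.path ∧ w.length = d.graph.dist (some j) none) ∧
          (d.protocol j).IsOneWay j ∧
          Extracts b (((d.protocol j).toLOCC j).toMap j))) := by
  -- The exponent `200` comes from words below `wordBound n ^ 100 = (n + 2) ^ 200`.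
  refine ⟨fun n g hg b j => ⟨?_, fun h => ?_⟩,
    mainProgram, 200, mainProgram.time 0 * 27, fun n g hg j => ?_⟩
  · rintro ⟨C, hC, hE⟩ ⟨A, hj, hA⟩
    exact not_extracts_of_factorsOn hj hA hC hE
  -- The run of the algorithm provides a graph. Its logical basis `b'` need not be `b`, so
  -- factorization or extraction is transferred from `b'`.
  · obtain ⟨_, _, _, _, _, d, _, ⟨b', hd⟩, hp⟩ := mainProgram_spec hg j
    rcases hp with hp | hp
    · obtain ⟨A, hj, hA⟩ := hd.exists_factorsOn hp.2
      exact absurd ⟨A, hj, hA.of_basis b⟩ h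
    · exact Extracts.of_basis ⟨0, (d.protocol j).toLOCC j, rfl⟩ (hd.protocol_extracts hp) b
  · obtain ⟨t, s, hs, ht, _, d, ho, ⟨b, hd⟩, hp⟩ := mainProgram_spec hg j
    rw [wordBound, ← pow_mul] at hs
    refine ⟨t, s, d, b, hs, ht.trans (mainProgram_time j.pos), ho, hd,
      PathData.extracts_iff hd hp, fun h => ?_, fun h => ?_⟩
    · rcases hp with hp | hp
      · exact hp.2
      · rw [hp.path_eq] at h
        exact absurd h (by simp)
    · rcases hp with hp | hp
      · exact absurd hp.1 h
      · exact ⟨hp, hp.isOneWay, hd.protocol_extracts hp⟩
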